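/- **Definitions.** Let $(Q,\cdot)$ be a quasigroup. An *abstract light dual multinet labeled by $Q$* is a set $P$ of points, the disjoint union of three components $P_1,P_2,P_3$, together with a set $\mathcal M$ of more than one subset of $P$ (the blocks), such that any two distinct points lie in at most one common block, and there are bijections $\alpha_i:Q\to P_i$ such that for all $x,y\in Q$ some block contains $\alpha_1(x),\alpha_2(y),\alpha_3(x\cdot y)$. Its order is $|Q|$. A set $B$ of points has *length* $r$ if $|\{x\in Q:\alpha_i(x)\in B\}|=r$ for $i=1,2,3$. The multinet *has a unique superline of length $2$* if one block has length $2$ and all other blocks have length $1$. An isomorphism of multinets is a bijection of the point sets which induces a bijection of the sets of blocks. A *weak projective $\mathbb Q$-embedding* is an injective map $\beta:P\to \mathrm{PG}(2,\mathbb L)$, where $\mathbb L$ is an extension field of $\mathbb Q$, whose image spans the plane and which maps any three distinct points of a common block to collinear points. A *merged block* of $\beta$ is a set $S\subseteq P$ with $|S|>1$, $S\notin\mathcal M$ and $S=\beta^{-1}(\ell)$ for some line $\ell$ of $\mathrm{PG}(2,\mathbb L)$. **The table.** Each of the loops below has underlying set $\{0,\dots,5\}$, unit $0$ and subloop $\{0,1\}$;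 the string $c_0c_1c_2c_3c_4c_5$ in position $x=0,\dots,5$ means $x\cdot y=c_y$. The corresponding multinet has points $(i,x)$, $i\in\{1,2,3\}$, $x\in\{0,\dots,5\}$, components $P_i=\{i\}\times\{0,\dots,5\}$, the superline $\{1,2,3\}\times\{0,1\}$, and the $32$ further blocks $\{(1,x),(2,y),(3,x\cdot y)\}$, where $x,y$ are not both in $\{0,1\}$. A triple $(S_1,S_2,S_3)$ stands for the set of the points $(i,x)$ with $x\in S_i$; a set $T$ listed "in $P_i$" stands for $\{i\}\times T$. - $M_{3}$: rows 012345, 104523, 243150, 351402, 425031, 530214; new long lines: $(\{2,4\},\{2,4\},\{3,5\})$; $(\{3,5\},\{3,5\},\{2,4\})$; no sets inside the components. - $M_{4}$: rows 012345, 104523, 250431, 345012, 431250, 523104; no new long lines; in $P_1$: $\{0,4,5\}$, $\{1,2,3\}$; in $P_2$: $\{0,4,5\}$, $\{1,2,3\}$; in $P_3$: $\{0,4,5\}$, $\{1,2,3\}$. - $M_{8}$: rows 012345, 105423, 250134, 341052, 423501, 534210; no new long lines; in $P_3$: $\{1,2,3,4,5\}$. - $M_{9}$: rows 012345, 105432,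 240153, 351024, 423510, 534201; no new long lines; in $P_3$: $\{0,4,5\}$, $\{1,2,3\}$. - $M_{10}$: rows 012345, 105423, 250134, 341052, 423510, 534201; no new long lines; in $P_3$: $\{0,2,5\}$, $\{0,3,4\}$, $\{1,2,4\}$, $\{1,3,5\}$. - $M_{11}$: rows 012345, 105423, 253014, 340251, 421530, 534102; no new long lines; in $P_3$: $\{0,2,3\}$. - $M_{13}$: rows 012345, 103452, 251034, 345120, 420513, 534201; no new long lines; no sets inside the components. - $M_{14}$: rows 012345, 104532, 235401, 320154, 451023, 543210; new long lines: $(\{0,5\},\{2,3\},\{2,3\})$; in $P_1$: $\{0,2,4\}$, $\{1,3,5\}$; in $P_2$: $\{0,3,4\}$, $\{1,2,5\}$; in $P_3$: $\{0,2,4\}$, $\{1,3,5\}$. - $M_{15}$: rows 012345, 103254, 250413, 345102, 421530, 534021; no new long lines; in $P_1$: $\{0,2,4\}$, $\{1,3,5\}$. - $M_{16}$: rows 012345, 103524, 234051, 350412, 425103, 541230; new long lines: $(\{4,5\},\{4,5\},\{0,3\})$; in $P_3$: $\{1,3,4\}$, $\{2,4,5\}$. **Proposition.** Let $\mathcal M$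 be an abstract light dual multinet of order $6$ with a unique superline of length $2$. Assume that $\mathcal M$ has a weak projective $\mathbb Q$-embedding $\beta:P\to\mathrm{PG}(2,\mathbb L)$. Then $\mathcal M$ is isomorphic to a multinet $N$ of the table, and $\beta$ has at least the merged blocks given in the row of $N$; that is, for every isomorphism $\varphi:N\to\mathcal M$: 1. for each new long line $B$ in the row of $N$, $\varphi(B)$ is a merged block of $\beta$ of length $2$; 2. for each set $T$ listed in the component $P_i$ of $N$, $\varphi(T)$ is contained in a merged block $S$ of $\beta$ with $S\subseteq\varphi(P_i)$. -/

import Mathlib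

/-- `op` is the multiplication of a quasigroup: in `x · y = z` any two of the three values determine
the third one. -/
structure IsQuasigroup {Q : Type*} (op : Q → Q → Q) : Prop where
  left_div : ∀ x z, ∃! y, op x y = z
  right_div : ∀ z y, ∃! x, op x y = z

/-- An abstract light dual multinet on the point set `P`, labeled by the quasigroup `(Q, op)`; the
components `P₁, P₂, P₃` are indexed by `0, 1, 2`, and a block is identified with its set of points. -/
structure LightDualMultinet {Q : Type*} (op : Q → Q → Q) (P : Type*) where
  component : Fin 3 → Set P
  component_disjoint : ∀ i j, i ≠ j → Disjoint (component i) (component j)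
  component_cover : ⋃ i, component i = Set.univ
  blocks : Set (Set P)
  eq_of_mem : ∀ p q, p ≠ q → ∀ B ∈ blocks, ∀ C ∈ blocks, p ∈ B → q ∈ B → p ∈ C → q ∈ C → B = C
  label : Fin 3 → Q → P
  label_bijOn : ∀ i, Set.BijOn (label i) Set.univ (component i)
  exists_block : ∀ x y, ∃ S ∈ blocks, label 0 x ∈ S ∧ label 1 y ∈ S ∧ label 2 (op x y) ∈ S
  blocks_nontrivial : blocks.Nontrivial

namespace LightDualMultinet

variable {Q P : Type*} {op : Q → Q → Q}

/-- The set of points `B` has length `r`: each of the three subsets of `Q` which correspond to the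
intersections of `B` with the components has exactly `r` elements. -/
def HasLength (M : LightDualMultinet op P) (B : Set P) (r : ℕ) : Prop :=
  ∀ i, {x : Q | M.label i x ∈ B}.ncard = r

/-- One block has length `r`, and every other block has length `1`. -/
def HasUniqueSuperline (M : LightDualMultinet op P) (r : ℕ) : Prop :=
  ∃ B₀ ∈ M.blocks, M.HasLength B₀ r ∧ ∀ B ∈ M.blocks, B ≠ B₀ → M.HasLength B 1

end LightDualMultinet

/-- An isomorphism of simple incidence structures, given by their sets of blocks: a bijection of the
points which induces a bijection of the blocks. -/
structure IncidenceIso {P P' : Type*} (A : Set (Set P)) (B : Set (Set P')) extends P ≃ P' where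
  mem_iff : ∀ S : Set P, S ∈ A ↔ toEquiv '' S ∈ B

/-- The set of points of the line of `PG(2, L)` given by the submodule `W` of `L³`, pulled back
along `β`. (The lines are the submodules of dimension 2.) -/
def linePreimage {P L : Type*} [Field L] (β : P → Projectivization L (Fin 3 → L))
    (W : Submodule L (Fin 3 → L)) : Set P :=
  {p | (β p).submodule ≤ W}

/-- `β : P → PG(2, L)` is a weak projective `K`-embedding of the simple incidence structure on `P`
with the given set of blocks. -/
structure IsWeakEmbedding (K : Type*) {P L : Type*} [Field K] [Field L] [Algebra K L]
    (blocks : Set (Set P)) (β : P → Projectivization L (Fin 3 → L)) : Prop where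
  injective : Function.Injective β
  spans : ⨆ p, (β p).submodule = ⊤
  collinear : ∀ p q r, p ≠ q → p ≠ r → q ≠ r → (∃ B ∈ blocks, p ∈ B ∧ q ∈ B ∧ r ∈ B) →
    ∃ W : Submodule L (Fin 3 → L), Module.finrank L W = 2 ∧
      p ∈ linePreimage β W ∧ q ∈ linePreimage β W ∧ r ∈ linePreimage β W

/-- `S` is a merged block of `β`: it has more than one point, it is not a block of the incidence
structure, and it is the full preimage of a line of `PG(2, L)`. -/
def IsMergedBlock {P L : Type*} [Field L] (blocks : Set (Set P))
    (β : P → Projectivization L (Fin 3 → L)) (S : Set P) : Prop :=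
  S.Nontrivial ∧ S ∉ blocks ∧
    ∃ W : Submodule L (Fin 3 → L), Module.finrank L W = 2 ∧ S = linePreimage β W

/-- The union of the `S i`, as a set of points: `(i, x)` is the point of the `i`-th component with
label `x`. -/
def tripleUnion {X : Type*} (S : Fin 3 → Finset X) : Set (Fin 3 × X) :=
  {p | p.2 ∈ S p.1}

/-- The blocks of the light dual multinet which arises from the dual 3-net of a quasigroup, when the
lines which belong to the subsquare `(S 0, S 1, S 2)` are replaced by the single superline
`tripleUnion S`. -/
def superlineBlocks {X : Type*} (op : X → X → X) (S : Fin 3 → Finset X) :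
    Set (Set (Fin 3 × X)) :=
  {B | B = tripleUnion S ∨
    ∃ x y, ¬ (x ∈ S 0 ∧ y ∈ S 1) ∧ B = {((0 : Fin 3), x), ((1 : Fin 3), y), ((2 : Fin 3), op x y)}}

/-- A row of the table of merged blocks: a loop on `{0, …, 5}` with unit `0` and with the subloop
`{0, 1}`, the new long lines of its multinet (as triples of subsets of the loop), and for each
component a list of subsets of the component which are contained in merged blocks. -/
structure TableRow where
  op : Fin 6 → Fin 6 → Fin 6
  newLongLines : List (Fin 3 → Finset (Fin 6))
  componentBlocks : Fin 3 → List (Finset (Fin 6))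

/-- The blocks of the multinet of a row; its superline consists of the points with label 0 or 1. -/
def TableRow.blocks (N : TableRow) : Set (Set (Fin 3 × Fin 6)) :=
  superlineBlocks N.op fun _ => {0, 1}

def multinetRow3 : TableRow where
  op := ![![0, 1, 2, 3, 4, 5], ![1, 0, 4, 5, 2, 3], ![2, 4, 3, 1, 5, 0],
    ![3, 5, 1, 4, 0, 2], ![4, 2, 5, 0, 3, 1], ![5, 3, 0, 2, 1, 4]]
  newLongLines := [![{2, 4}, {2, 4}, {3, 5}], ![{3, 5}, {3, 5}, {2, 4}]]
  componentBlocks := ![[], [], []]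

def multinetRow4 : TableRow where
  op := ![![0, 1, 2, 3, 4, 5], ![1, 0, 4, 5, 2, 3], ![2, 5, 0, 4, 3, 1],
    ![3, 4, 5, 0, 1, 2], ![4, 3, 1, 2, 5, 0], ![5, 2, 3, 1, 0, 4]]
  newLongLines := []
  componentBlocks := ![[{0, 4, 5}, {1, 2, 3}], [{0, 4, 5}, {1, 2, 3}], [{0, 4, 5}, {1, 2, 3}]]

def multinetRow8 : TableRow where
  op := ![![0, 1, 2, 3, 4, 5], ![1, 0, 5, 4, 2, 3], ![2, 5, 0, 1, 3, 4],
    ![3, 4, 1, 0, 5, 2], ![4, 2, 3, 5, 0, 1], ![5, 3, 4, 2, 1, 0]]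
  newLongLines := []
  componentBlocks := ![[], [], [{1, 2, 3, 4, 5}]]

def multinetRow9 : TableRow where
  op := ![![0, 1, 2, 3, 4, 5], ![1, 0, 5, 4, 3, 2], ![2, 4, 0, 1, 5, 3],
    ![3, 5, 1, 0, 2, 4], ![4, 2, 3, 5, 1, 0], ![5, 3, 4, 2, 0, 1]]
  newLongLines := []
  componentBlocks := ![[], [], [{0, 4, 5}, {1, 2, 3}]]

def multinetRow10 : TableRow where
  op := ![![0, 1, 2, 3, 4, 5], ![1, 0, 5, 4, 2, 3], ![2, 5, 0, 1, 3, 4],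
    ![3, 4, 1, 0, 5, 2], ![4, 2, 3, 5, 1, 0], ![5, 3, 4, 2, 0, 1]]
  newLongLines := []
  componentBlocks := ![[], [], [{0, 2, 5}, {0, 3, 4}, {1, 2, 4}, {1, 3, 5}]]

def multinetRow11 : TableRow where
  op := ![![0, 1, 2, 3, 4, 5], ![1, 0, 5, 4, 2, 3], ![2, 5, 3, 0, 1, 4],
    ![3, 4, 0, 2, 5, 1], ![4, 2, 1, 5, 3, 0], ![5, 3, 4, 1, 0, 2]]
  newLongLines := []
  componentBlocks := ![[], [], [{0, 2, 3}]]

def multinetRow13 : TableRow where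
  op := ![![0, 1, 2, 3, 4, 5], ![1, 0, 3, 4, 5, 2], ![2, 5, 1, 0, 3, 4],
    ![3, 4, 5, 1, 2, 0], ![4, 2, 0, 5, 1, 3], ![5, 3, 4, 2, 0, 1]]
  newLongLines := []
  componentBlocks := ![[], [], []]

def multinetRow14 : TableRow where
  op := ![![0, 1, 2, 3, 4, 5], ![1, 0, 4, 5, 3, 2], ![2, 3, 5, 4, 0, 1],
    ![3, 2, 0, 1, 5, 4], ![4, 5, 1, 0, 2, 3], ![5, 4, 3, 2, 1, 0]]
  newLongLines := [![{0, 5}, {2, 3}, {2, 3}]]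
  componentBlocks := ![[{0, 2, 4}, {1, 3, 5}], [{0, 3, 4}, {1, 2, 5}], [{0, 2, 4}, {1, 3, 5}]]

def multinetRow15 : TableRow where
  op := ![![0, 1, 2, 3, 4, 5], ![1, 0, 3, 2, 5, 4], ![2, 5, 0, 4, 1, 3],
    ![3, 4, 5, 1, 0, 2], ![4, 2, 1, 5, 3, 0], ![5, 3, 4, 0, 2, 1]]
  newLongLines := []
  componentBlocks := ![[{0, 2, 4}, {1, 3, 5}], [], []]

def multinetRow16 : TableRow where
  op := ![![0, 1, 2, 3, 4, 5], ![1, 0, 3, 5, 2, 4], ![2, 3, 4, 0, 5, 1],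
    ![3, 5, 0, 4, 1, 2], ![4, 2, 5, 1, 0, 3], ![5, 4, 1, 2, 3, 0]]
  newLongLines := [![{4, 5}, {4, 5}, {0, 3}]]
  componentBlocks := ![[], [], [{1, 3, 4}, {2, 4, 5}]]

/-- The table of merged blocks of the ten light dual multinets of order 6 with a unique superline of
length 2 that have a weak projective embedding over a field of characteristic 0. -/
def mergedBlockTable : List TableRow :=
  [multinetRow3, multinetRow4, multinetRow8, multinetRow9, multinetRow10, multinetRow11,
    multinetRow13, multinetRow14, multinetRow15, multinetRow16]

/-- The determinant of three vectors of `L³`. -/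
def tripDet {L : Type*} [Field L] (u v w : Fin 3 → L) : L :=
  u 0 * (v 1 * w 2 - v 2 * w 1) - u 1 * (v 0 * w 2 - v 2 * w 0) + u 2 * (v 0 * w 1 - v 1 * w 0)

section Lines

variable {L : Type*} [Field L]

theorem tripDet_eq_det (u v w : Fin 3 → L) : tripDet u v w = (Matrix.of ![u, v, w]).det := by
  simp [tripDet, Matrix.det_fin_three]
  ring

theorem tripDet_ne_zero_iff (u v w : Fin 3 → L) :
    tripDet u v w ≠ 0 ↔ LinearIndependent L ![u, v, w] := by
  rw [tripDet_eq_det, ← isUnit_iff_ne_zero, ← Matrix.isUnit_iff_isUnit_det,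
    ← Matrix.linearIndependent_rows_iff_isUnit]
  rfl

theorem mem_span_pair_of_tripDet_eq_zero {u v w : Fin 3 → L} (huv : LinearIndependent L ![u, v])
    (h : tripDet u v w = 0) : w ∈ Submodule.span L {u, v} := by
  by_contra hw
  refine (tripDet_ne_zero_iff u v w).2 ?_ h
  have h3 : ![u, v, w] = Fin.snoc (α := fun _ => Fin 3 → L) ![u, v] w := by
    funext i; fin_cases i <;> rfl
  rw [h3, linearIndependent_finSnoc]
  refine ⟨huv, ?_⟩
  simpa [Matrix.range_cons, Matrix.range_empty, Set.pair_comm] using hw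

theorem tripDet_eq_zero_of_mem {W : Submodule L (Fin 3 → L)} (hW : Module.finrank L W = 2)
    {u v w : Fin 3 → L} (hu : u ∈ W) (hv : v ∈ W) (hw : w ∈ W) : tripDet u v w = 0 := by
  by_contra h
  have hli := (tripDet_ne_zero_iff u v w).1 h
  have hli' : LinearIndependent L ![(⟨u, hu⟩ : W), ⟨v, hv⟩, ⟨w, hw⟩] := by
    apply LinearIndependent.of_comp W.subtype
    convert hli using 1
    funext i; fin_cases i <;> rfl
  have := hli'.fintype_card_le_finrank
  simp [hW] at this

variable {P : Type*} {β : P → Projectivization L (Fin 3 → L)}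

theorem mem_linePreimage {W : Submodule L (Fin 3 → L)} {p : P} :
    p ∈ linePreimage β W ↔ (β p).rep ∈ W := by
  rw [linePreimage, Set.mem_ofPred_eq, Projectivization.submodule_eq,
    Submodule.span_singleton_le_iff_mem]

theorem linearIndependent_rep {p q : P} (hpq : β p ≠ β q) :
    LinearIndependent L ![(β p).rep, (β q).rep] :=
  Projectivization.linearIndependent_pair_iff_ne.2 hpq

theorem finrank_span_rep {p q : P} (hpq : β p ≠ β q) :
    Module.finrank L (Submodule.span L {(β p).rep, (β q).rep}) = 2 := by
  have := finrank_span_eq_card (linearIndependent_rep hpq)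
  rwa [Matrix.range_cons_cons_empty, Fintype.card_fin] at this

/-- The three points are collinear in `PG(2, L)`. -/
def ProjCollinear (β : P → Projectivization L (Fin 3 → L)) (p q r : P) : Prop :=
  tripDet (β p).rep (β q).rep (β r).rep = 0

theorem eq_span_rep {W : Submodule L (Fin 3 → L)} (hW : Module.finrank L W = 2) {p q : P}
    (hpq : β p ≠ β q) (hp : p ∈ linePreimage β W) (hq : q ∈ linePreimage β W) :
    W = Submodule.span L {(β p).rep, (β q).rep} := by
  symm
  apply Submodule.eq_of_le_of_finrank_eq
  · rw [Submodule.span_le]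
    rintro _ (rfl | rfl)
    · exact mem_linePreimage.1 hp
    · exact mem_linePreimage.1 hq
  · rw [hW, finrank_span_rep hpq]

theorem mem_linePreimage_iff_projCollinear {W : Submodule L (Fin 3 → L)}
    (hW : Module.finrank L W = 2) {p q : P} (hpq : β p ≠ β q) (hp : p ∈ linePreimage β W)
    (hq : q ∈ linePreimage β W) (r : P) : r ∈ linePreimage β W ↔ ProjCollinear β p q r := by
  constructor
  · intro hr
    exact tripDet_eq_zero_of_mem hW (mem_linePreimage.1 hp) (mem_linePreimage.1 hq)
      (mem_linePreimage.1 hr)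
  · intro h
    rw [mem_linePreimage, eq_span_rep hW hpq hp hq]
    exact mem_span_pair_of_tripDet_eq_zero (linearIndependent_rep hpq) h

theorem exists_line {p q : P} (hpq : β p ≠ β q) :
    ∃ W : Submodule L (Fin 3 → L), Module.finrank L W = 2 ∧ p ∈ linePreimage β W ∧
      q ∈ linePreimage β W :=
  ⟨_, finrank_span_rep hpq, mem_linePreimage.2 (Submodule.subset_span (by simp)),
    mem_linePreimage.2 (Submodule.subset_span (by simp))⟩

end Lines

section Embedding

variable {K L P : Type*} [Field K] [Field L] [Algebra K L] {blocks : Set (Set P)}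
  {β : P → Projectivization L (Fin 3 → L)}

theorem IsWeakEmbedding.ne (hβ : IsWeakEmbedding K blocks β) {p q : P} (h : p ≠ q) : β p ≠ β q :=
  fun e => h (hβ.injective e)

theorem IsWeakEmbedding.projCollinear (hβ : IsWeakEmbedding K blocks β) {p q r : P} (hpq : p ≠ q)
    (hpr : p ≠ r) (hqr : q ≠ r) (h : ∃ B ∈ blocks, p ∈ B ∧ q ∈ B ∧ r ∈ B) :
    ProjCollinear β p q r := by
  obtain ⟨W, hW, h1, h2, h3⟩ := hβ.collinear p q r hpq hpr hqr h
  exact (mem_linePreimage_iff_projCollinear hW (hβ.ne hpq) h1 h2 r).1 h3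

/-- A line which contains two points of a block contains the block. -/
theorem IsWeakEmbedding.mem_of_mem (hβ : IsWeakEmbedding K blocks β)
    {W : Submodule L (Fin 3 → L)} (hW : Module.finrank L W = 2) {p q r : P} (hpq : p ≠ q)
    (hp : p ∈ linePreimage β W) (hq : q ∈ linePreimage β W)
    (h : ∃ B ∈ blocks, p ∈ B ∧ q ∈ B ∧ r ∈ B) : r ∈ linePreimage β W := by
  by_cases hpr : p = r
  · exact hpr ▸ hp
  by_cases hqr : q = r
  · exact hqr ▸ hq
  exact (mem_linePreimage_iff_projCollinear hW (hβ.ne hpq) hp hq r).2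
    (hβ.projCollinear hpq hpr hqr h)

theorem IsWeakEmbedding.exists_notMem (hβ : IsWeakEmbedding K blocks β)
    {W : Submodule L (Fin 3 → L)} (hW : Module.finrank L W = 2) : ∃ p, p ∉ linePreimage β W := by
  by_contra! h
  have : (⊤ : Submodule L (Fin 3 → L)) ≤ W := by
    rw [← hβ.spans]
    exact iSup_le fun p => h p
  rw [top_le_iff] at this
  rw [this, finrank_top] at hW
  simp at hW

end Embedding

section Closure

/-- The position of a point of `Fin 3 × Fin 6` in a bit mask. -/
def pointIndex (i : Fin 3) (x : Fin 6) : ℕ := 6 * i.val + x.val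

def maskOf (l : List (Fin 3 × Fin 6)) : ℕ :=
  l.foldl (fun m p => m ||| 2 ^ pointIndex p.1 p.2) 0

/-- The points of the superline. -/
def superlinePoints : List (Fin 3 × Fin 6) := [(0, 0), (0, 1), (1, 0), (1, 1), (2, 0), (2, 1)]

/-- The blocks, as lists of points. -/
def blockLists (op : Fin 6 → Fin 6 → Fin 6) : List (List (Fin 3 × Fin 6)) :=
  superlinePoints :: (List.finRange 6).flatMap fun x => (List.finRange 6).flatMap fun y =>
    if x.val < 2 && y.val < 2 then [] else [[(0, x), (1, y), (2, op x y)]]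

/-- Add the block `b` to the mask `m` if they have two common points. -/
def joinMask (m b : ℕ) : ℕ :=
  bif Nat.beq (Nat.land (Nat.land m b) (Nat.pred (Nat.land m b))) 0 then m else Nat.lor m b

/-- Add blocks to a mask successively. (The `match` forces the evaluation of the mask.) -/
def joinMasks : List ℕ → ℕ → ℕ
  | [], m => m
  | b :: l, m =>
    match joinMask m b with
    | 0 => 0
    | k + 1 => joinMasks l (k + 1)

/-- The points which can be reached from the points of the mask `m` by joining points of blocks. -/
def closeMask (op : Fin 6 → Fin 6 → Fin 6) (m : ℕ) : ℕ :=
  let r := (blockLists op).map maskOf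
  joinMasks (r ++ (r ++ (r ++ r))) m

/-- The points of the list generate the whole multinet. -/
def generates (op : Fin 6 → Fin 6 → Fin 6) (l : List (Fin 3 × Fin 6)) : Bool :=
  Nat.beq (closeMask op (maskOf l)) 262143

/-- All the points with positions in the mask `m` belong to `S`. -/
def MaskSubset (m : ℕ) (S : Set (Fin 3 × Fin 6)) : Prop :=
  ∀ i x, m.testBit (pointIndex i x) = true → (i, x) ∈ S

theorem pointIndex_injective {i j : Fin 3} {x y : Fin 6} (h : pointIndex i x = pointIndex j y) :
    i = j ∧ x = y := by
  unfold pointIndex at h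
  omega

theorem testBit_maskOf (l : List (Fin 3 × Fin 6)) (k : ℕ) :
    (maskOf l).testBit k = true ↔ ∃ p ∈ l, pointIndex p.1 p.2 = k := by
  have key : ∀ (l : List (Fin 3 × Fin 6)) (m : ℕ),
      (l.foldl (fun m p => m ||| 2 ^ pointIndex p.1 p.2) m).testBit k = true ↔
        m.testBit k = true ∨ ∃ p ∈ l, pointIndex p.1 p.2 = k := by
    intro l
    induction l with
    | nil => simp
    | cons p l ih =>
      intro m
      rw [List.foldl_cons, ih, Nat.testBit_or, Bool.or_eq_true, Nat.testBit_two_pow,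
        decide_eq_true_eq, List.exists_mem_cons_iff, or_assoc]
  simp [maskOf, key]

theorem maskSubset_maskOf {l : List (Fin 3 × Fin 6)} {S : Set (Fin 3 × Fin 6)} :
    MaskSubset (maskOf l) S ↔ ∀ p ∈ l, p ∈ S := by
  constructor
  · exact fun h p hp => h p.1 p.2 ((testBit_maskOf _ _).2 ⟨p, hp, rfl⟩)
  · intro h i x hix
    obtain ⟨p, hp, he⟩ := (testBit_maskOf _ _).1 hix
    obtain ⟨rfl, rfl⟩ := pointIndex_injective he
    exact h p hp

/-- A number which is not a power of 2 (and not 0) has two different bits. -/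
theorem exists_testBit_of_land_pred_ne_zero {n : ℕ} (h : Nat.land n (Nat.pred n) ≠ 0) :
    ∃ i j, i ≠ j ∧ n.testBit i = true ∧ n.testBit j = true := by
  by_contra! hn
  have h0 : n ≠ 0 := by
    rintro rfl
    exact h rfl
  obtain ⟨i, hi⟩ := Nat.exists_testBit_of_ne_zero h0
  have h1 : n = 2 ^ i := by
    apply Nat.eq_of_testBit_eq
    intro j
    rw [Nat.testBit_two_pow]
    by_cases hij : i = j
    · rw [← hij, hi, decide_eq_true rfl]
    · rw [decide_eq_false hij]
      exact Bool.eq_false_iff.2 (hn i j hij hi)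
  apply h
  change n &&& (n - 1) = 0
  rw [h1, Nat.and_two_pow_sub_one_eq_mod, Nat.mod_self]

/-- `S` contains the points of `l` if it contains two of them. -/
def JoinClosed (S : Set (Fin 3 × Fin 6)) (l : List (Fin 3 × Fin 6)) : Prop :=
  ∀ p ∈ l, ∀ q ∈ l, p ≠ q → p ∈ S → q ∈ S → ∀ r ∈ l, r ∈ S

theorem MaskSubset.joinMask {S : Set (Fin 3 × Fin 6)} {l : List (Fin 3 × Fin 6)}
    (hl : JoinClosed S l) {m : ℕ} (hm : MaskSubset m S) :
    MaskSubset (joinMask m (maskOf l)) S := by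
  unfold _root_.joinMask
  cases h : Nat.beq (Nat.land (Nat.land m (maskOf l)) (Nat.pred (Nat.land m (maskOf l)))) 0 with
  | true => exact hm
  | false =>
    obtain ⟨i, j, hij, hi, hj⟩ := exists_testBit_of_land_pred_ne_zero (Nat.ne_of_beq_eq_false h)
    change (m &&& maskOf l).testBit i = true at hi
    change (m &&& maskOf l).testBit j = true at hj
    rw [Nat.testBit_and, Bool.and_eq_true] at hi hj
    obtain ⟨p, hp, rfl⟩ := (testBit_maskOf _ _).1 hi.2
    obtain ⟨q, hq, rfl⟩ := (testBit_maskOf _ _).1 hj.2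
    have hS := hl p hp q hq (fun e => hij (by rw [e])) (hm _ _ hi.1) (hm _ _ hj.1)
    intro i x hix
    change (m ||| maskOf l).testBit _ = true at hix
    rw [Nat.testBit_or, Bool.or_eq_true] at hix
    rcases hix with hix | hix
    · exact hm i x hix
    · exact maskSubset_maskOf.2 hS i x hix

theorem MaskSubset.joinMasks {S : Set (Fin 3 × Fin 6)} {r : List (List (Fin 3 × Fin 6))}
    (hr : ∀ l ∈ r, JoinClosed S l) {m : ℕ} (hm : MaskSubset m S) :
    MaskSubset (joinMasks (r.map maskOf) m) S := by
  induction r generalizing m with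
  | nil => exact hm
  | cons l r ih =>
    have h := hm.joinMask (hr l List.mem_cons_self)
    simp only [List.map_cons, _root_.joinMasks]
    split
    · exact fun i x h => by simp at h
    · rename_i k hk
      exact ih (fun l hl => hr l (List.mem_cons_of_mem _ hl)) (by rwa [hk] at h)

variable {K L : Type*} [Field K] [Field L] [Algebra K L] {op : Fin 6 → Fin 6 → Fin 6}
  {β : Fin 3 × Fin 6 → Projectivization L (Fin 3 → L)}

theorem exists_mem_superlineBlocks {b : List (Fin 3 × Fin 6)} (hb : b ∈ blockLists op) :
    ∃ B ∈ superlineBlocks op fun _ => {0, 1}, ∀ p ∈ b, p ∈ B := by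
  rw [blockLists, List.mem_cons] at hb
  rcases hb with rfl | hb
  · refine ⟨tripleUnion fun _ => {0, 1}, Or.inl rfl, ?_⟩
    have key : ∀ p ∈ superlinePoints, p.2 ∈ ({0, 1} : Finset (Fin 6)) := by decide
    exact key
  · simp only [List.mem_flatMap, List.mem_finRange, true_and] at hb
    obtain ⟨x, y, hb⟩ := hb
    split_ifs at hb with hxy
    · simp at hb
    · have key : ∀ x y : Fin 6, ¬ (decide (x.val < 2) && decide (y.val < 2)) = true →
          ¬ (x ∈ ({0, 1} : Finset (Fin 6)) ∧ y ∈ ({0, 1} : Finset (Fin 6))) := by decide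
      rw [List.mem_singleton] at hb
      refine ⟨_, Or.inr ⟨x, y, key x y hxy, rfl⟩, ?_⟩
      rw [hb]
      simp

/-- A line contains the closure of any set of its points. -/
theorem IsWeakEmbedding.maskSubset_closeMask
    (hβ : IsWeakEmbedding K (superlineBlocks op fun _ => {0, 1}) β) {l : List (Fin 3 × Fin 6)}
    {W : Submodule L (Fin 3 → L)} (hW : Module.finrank L W = 2)
    (h : ∀ p ∈ l, p ∈ linePreimage β W) :
    MaskSubset (closeMask op (maskOf l)) (linePreimage β W) := by
  have hr : ∀ b ∈ blockLists op, JoinClosed (linePreimage β W) b := by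
    intro b hb p hp q hq hpq hpW hqW r hr
    obtain ⟨B, hB, hbB⟩ := exists_mem_superlineBlocks hb
    exact hβ.mem_of_mem hW hpq hpW hqW ⟨B, hB, hbB p hp, hbB q hq, hbB r hr⟩
  have := (maskSubset_maskOf.2 h).joinMasks (r := blockLists op ++ (blockLists op ++
    (blockLists op ++ blockLists op))) (by simpa using hr)
  rw [List.map_append, List.map_append, List.map_append] at this
  exact this

/-- No line contains a set of points which generates the multinet. -/
theorem IsWeakEmbedding.not_subset_line_of_generates
    (hβ : IsWeakEmbedding K (superlineBlocks op fun _ => {0, 1}) β) {l : List (Fin 3 × Fin 6)}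
    (hl : generates op l = true) {W : Submodule L (Fin 3 → L)} (hW : Module.finrank L W = 2) :
    ¬ ∀ p ∈ l, p ∈ linePreimage β W := by
  intro h
  have h4 := hβ.maskSubset_closeMask hW h
  rw [show closeMask op (maskOf l) = 262143 from Nat.eq_of_beq_eq_true hl] at h4
  obtain ⟨⟨i, x⟩, hp⟩ := hβ.exists_notMem hW
  apply hp
  have key : ∀ i x, Nat.testBit 262143 (pointIndex i x) = true := by decide
  exact h4 i x (key i x)

theorem IsWeakEmbedding.not_projCollinear
    (hβ : IsWeakEmbedding K (superlineBlocks op fun _ => {0, 1}) β) {p q r : Fin 3 × Fin 6}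
    (hpq : p ≠ q) (h : generates op [p, q, r] = true) : ¬ ProjCollinear β p q r := by
  intro hc
  obtain ⟨W, hW, hp, hq⟩ := exists_line (hβ.ne hpq)
  refine hβ.not_subset_line_of_generates h hW ?_
  simp only [List.mem_cons, List.not_mem_nil, or_false, forall_eq_or_imp, forall_eq]
  exact ⟨hp, hq, (mem_linePreimage_iff_projCollinear hW (hβ.ne hpq) hp hq r).2 hc⟩

end Closure

section Coordinates

variable {L : Type*} [Field L]

/-- The standard representatives of the points of `PG(2, L)`, the line at infinity being
`z = 0`. -/
def IsNormalized (g : Fin 3 → L) : Prop :=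
  g = ![0, 1, 0] ∨ (∃ m, g = ![1, m, 0]) ∨ ∃ x y, g = ![x, y, 1]

theorem IsNormalized.eq_of_smul {g h : Fin 3 → L} (hg : IsNormalized g) (hh : IsNormalized h)
    {c : L} (hc : g = c • h) : g = h := by
  have h0 := congrFun hc 0
  have h1 := congrFun hc 1
  have h2 := congrFun hc 2
  have hc1 : c = 1 := by
    rcases hg with rfl | ⟨m, rfl⟩ | ⟨x, y, rfl⟩ <;>
      rcases hh with rfl | ⟨m', rfl⟩ | ⟨x', y', rfl⟩ <;>
      simp only [Pi.smul_apply, Matrix.cons_val, smul_eq_mul] at h0 h1 h2 <;> grind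
  rw [hc1, one_smul] at hc
  exact hc

theorem exists_isNormalized {g : Fin 3 → L} (hg : g ≠ 0) :
    ∃ (c : L) (h : Fin 3 → L), c ≠ 0 ∧ IsNormalized h ∧ g = c • h := by
  by_cases h2 : g 2 = 0
  · by_cases h0 : g 0 = 0
    · have h1 : g 1 ≠ 0 := by
        intro h1
        apply hg
        funext i
        fin_cases i <;> assumption
      refine ⟨g 1, _, h1, Or.inl rfl, ?_⟩
      funext i
      fin_cases i <;> simp [h0, h2]
    · refine ⟨g 0, _, h0, Or.inr (Or.inl ⟨g 1 / g 0, rfl⟩), ?_⟩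
      funext i
      fin_cases i <;> simp [h2]
      field_simp
  · refine ⟨g 2, _, h2, Or.inr (Or.inr ⟨g 0 / g 2, g 1 / g 2, rfl⟩), ?_⟩
    funext i
    fin_cases i <;> simp <;> field_simp

theorem tripDet_smul (a b c : L) (u v w : Fin 3 → L) :
    tripDet (a • u) (b • v) (c • w) = a * b * c * tripDet u v w := by
  simp only [tripDet, Pi.smul_apply, smul_eq_mul]
  ring

theorem tripDet_combination (e : Fin 3 → Fin 3 → L) (u v w : Fin 3 → L) :
    tripDet (∑ i, u i • e i) (∑ i, v i • e i) (∑ i, w i • e i) =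
      tripDet u v w * tripDet (e 0) (e 1) (e 2) := by
  simp only [tripDet, Fin.sum_univ_three, Pi.add_apply, Pi.smul_apply, smul_eq_mul]
  ring

variable {P : Type*} {β : P → Projectivization L (Fin 3 → L)}

theorem eq_of_rep_eq_smul {p q : P} {c : L} (h : (β p).rep = c • (β q).rep) : β p = β q := by
  by_contra hne
  have := linearIndependent_rep hne
  rw [LinearIndependent.pair_iff] at this
  have h1 := (this 1 (-c) (by rw [h]; module)).1
  exact one_ne_zero h1

/-- Homogeneous coordinates in which the line `ab` is the line at infinity. -/
theorem exists_coordinates {a b u o : P} (hua : β u ≠ β a) (hub : β u ≠ β b)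
    (hab : β a ≠ β b) (hu : ProjCollinear β a b u) (ho : ¬ ProjCollinear β a b o) :
    ∃ f : P → Fin 3 → L, (∀ p, IsNormalized (f p)) ∧
      (∀ p q r, ProjCollinear β p q r ↔ tripDet (f p) (f q) (f r) = 0) ∧
      (∀ p q, β p ≠ β q → f p ≠ f q) ∧
      f a = ![1, 0, 0] ∧ f b = ![0, 1, 0] ∧ f u = ![1, 1, 0] ∧ f o = ![0, 0, 1] := by
  obtain ⟨s, t, hst⟩ := Submodule.mem_span_pair.1
    (mem_span_pair_of_tripDet_eq_zero (linearIndependent_rep hab) hu)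
  have hs : s ≠ 0 := by
    rintro rfl
    exact hub (eq_of_rep_eq_smul (c := t) (by rw [← hst]; module))
  have ht : t ≠ 0 := by
    rintro rfl
    exact hua (eq_of_rep_eq_smul (c := s) (by rw [← hst]; module))
  set e : Fin 3 → Fin 3 → L := ![s • (β a).rep, t • (β b).rep, (β o).rep] with he
  have hdet : tripDet (e 0) (e 1) (e 2) ≠ 0 := by
    have h1 : tripDet (e 0) (e 1) (e 2) =
        s * t * 1 * tripDet (β a).rep (β b).rep (β o).rep := by
      rw [← tripDet_smul, one_smul]; rfl
    rw [h1, mul_one]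
    exact mul_ne_zero (mul_ne_zero hs ht) ho
  have hli : LinearIndependent L e := by
    have := (tripDet_ne_zero_iff _ _ _).1 hdet
    convert this using 1
    funext i
    fin_cases i <;> rfl
  let B := basisOfLinearIndependentOfCardEqFinrank hli (by simp)
  have hB : ∀ v : Fin 3 → L, ∃ g : Fin 3 → L, v = ∑ i, g i • e i := by
    intro v
    refine ⟨B.equivFun v, ?_⟩
    have := (B.sum_equivFun v).symm
    simpa [B] using this
  have hex : ∀ p, ∃ (h : Fin 3 → L) (c : L), c ≠ 0 ∧ IsNormalized h ∧
      (β p).rep = c • ∑ i, h i • e i := by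
    intro p
    obtain ⟨g, hg⟩ := hB (β p).rep
    have hg0 : g ≠ 0 := by
      rintro rfl
      exact (β p).rep_nonzero (by rw [hg]; simp)
    obtain ⟨c, h, hc, hn, rfl⟩ := exists_isNormalized hg0
    refine ⟨h, c, hc, hn, ?_⟩
    rw [hg, Finset.smul_sum]
    simp only [Pi.smul_apply, smul_eq_mul, mul_smul]
  choose f c hc hf hrep using hex
  have huniq : ∀ p (h : Fin 3 → L) (d : L), IsNormalized h → d • (β p).rep = ∑ i, h i • e i →
      f p = h := by
    intro p h d hh hd
    symm
    refine hh.eq_of_smul (hf p) (c := d * c p) ?_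
    have h2 : ∑ i, (h i - (d * c p) * f p i) • e i = 0 := by
      simp only [sub_smul, Finset.sum_sub_distrib, mul_smul, ← Finset.smul_sum]
      rw [← hd, ← hrep, sub_self]
    have h3 := Fintype.linearIndependent_iff.1 hli _ h2
    funext i
    rw [Pi.smul_apply, smul_eq_mul]
    exact sub_eq_zero.1 (h3 i)
  refine ⟨f, hf, fun p q r => ?_, fun p q hpq hfe => hpq ?_, ?_, ?_, ?_, ?_⟩
  · unfold ProjCollinear
    rw [hrep p, hrep q, hrep r, tripDet_smul, tripDet_combination]
    simp only [mul_eq_zero, hc, hdet, false_or, or_false]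
  · apply eq_of_rep_eq_smul (c := c p * (c q)⁻¹)
    rw [hrep q, smul_smul, mul_assoc, inv_mul_cancel₀ (hc q), mul_one, ← hfe, ← hrep]
  · refine huniq a _ s (Or.inr (Or.inl ⟨0, rfl⟩)) ?_
    simp [Fin.sum_univ_three, he]
  · refine huniq b _ t (Or.inl rfl) ?_
    simp [Fin.sum_univ_three, he]
  · refine huniq u _ 1 (Or.inr (Or.inl ⟨1, rfl⟩)) ?_
    simp [Fin.sum_univ_three, he, hst]
  · refine huniq o _ 1 (Or.inr (Or.inr ⟨0, 0, rfl⟩)) ?_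
    simp [Fin.sum_univ_three, he]

end Coordinates

section CoordPoint

variable {L : Type*} [Field L]

/-- Homogeneous coordinates for the points of the multinet of a loop, with the superline at
infinity; `s` is the inverse of the row of `1`. -/
def coordPoint (op : Fin 6 → Fin 6 → Fin 6) (s : Fin 6 → Fin 6) (X Y : Fin 6 → L) (m n₀ n₁ : L) :
    Fin 3 → Fin 6 → Fin 3 → L
  | 0, x => if x = 0 then ![1, 0, 0] else if x = 1 then ![0, 1, 0] else
      ![Y x - X (s x) - (Y (op x 1) - m * X (s (op x 1))),
        Y x - X (s x) - (Y (op x 1) - m * X (s (op x 1))) + (Y x - X (s x)) * (m - 1), m - 1]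
  | 1, y => if y = 0 then ![1, 1, 0] else if y = 1 then ![1, m, 0] else ![X y, Y y, 1]
  | 2, z => if z = 0 then ![1, n₀, 0] else if z = 1 then ![1, n₁, 0] else ![X (s z), Y z, 1]

/-- The properties of a loop which are needed in order to introduce coordinates. -/
def coordCheck (op : Fin 6 → Fin 6 → Fin 6) (s : Fin 6 → Fin 6) : Bool :=
  decide (∀ x, op 0 x = x ∧ op x 0 = x) &&
  decide (∀ z : Fin 6, 2 ≤ z → 2 ≤ s z ∧ op 1 (s z) = z ∧ 2 ≤ op z 1) &&
  decide (∀ (i : Fin 3) (x : Fin 6), 2 ≤ x → generates op [(0, 0), (0, 1), (i, x)] = true)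

variable {K : Type*} [Field K] [Algebra K L] {op : Fin 6 → Fin 6 → Fin 6} {s : Fin 6 → Fin 6}
  {β : Fin 3 × Fin 6 → Projectivization L (Fin 3 → L)}

theorem IsWeakEmbedding.projCollinear_cell
    (hβ : IsWeakEmbedding K (superlineBlocks op fun _ => {0, 1}) β) (x y : Fin 6)
    (hxy : ¬ (x < 2 ∧ y < 2)) : ProjCollinear β (0, x) (1, y) (2, op x y) := by
  refine hβ.projCollinear (by simp) (by simp) (by simp) ⟨_, Or.inr ⟨x, y, ?_, rfl⟩, ?_, ?_, ?_⟩
  · revert x y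
    decide
  all_goals simp

theorem IsWeakEmbedding.projCollinear_superline
    (hβ : IsWeakEmbedding K (superlineBlocks op fun _ => {0, 1}) β) {p q r : Fin 3 × Fin 6}
    (hpq : p ≠ q) (hpr : p ≠ r) (hqr : q ≠ r) (hp : p.2 < 2) (hq : q.2 < 2) (hr : r.2 < 2) :
    ProjCollinear β p q r := by
  have key : ∀ x : Fin 6, x < 2 → x ∈ ({0, 1} : Finset (Fin 6)) := by decide
  exact hβ.projCollinear hpq hpr hqr ⟨_, Or.inl rfl, key _ hp, key _ hq, key _ hr⟩

theorem IsWeakEmbedding.exists_coordPoint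
    (hβ : IsWeakEmbedding K (superlineBlocks op fun _ => {0, 1}) β)
    (hop : coordCheck op s = true) :
    ∃ X₃ X₄ X₅ Y₃ Y₄ Y₅ m n₀ n₁ : L,
      (m ≠ 0 ∧ n₀ ≠ 0 ∧ n₁ ≠ 0 ∧ m - 1 ≠ 0 ∧ n₀ - 1 ≠ 0 ∧ n₁ - 1 ≠ 0 ∧ m - n₀ ≠ 0 ∧ m - n₁ ≠ 0 ∧
        n₀ - n₁ ≠ 0) ∧
      ∀ i x j y k z, ProjCollinear β (i, x) (j, y) (k, z) ↔
        tripDet (coordPoint op s ![0, 0, 0, X₃, X₄, X₅] ![0, 0, 0, Y₃, Y₄, Y₅] m n₀ n₁ i x)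
          (coordPoint op s ![0, 0, 0, X₃, X₄, X₅] ![0, 0, 0, Y₃, Y₄, Y₅] m n₀ n₁ j y)
          (coordPoint op s ![0, 0, 0, X₃, X₄, X₅] ![0, 0, 0, Y₃, Y₄, Y₅] m n₀ n₁ k z) = 0 := by
  simp only [coordCheck, Bool.and_eq_true, decide_eq_true_eq] at hop
  obtain ⟨⟨hunit, hs⟩, hgen⟩ := hop
  obtain ⟨f, hn, hdet, hinj, fa, fb, fu, fo⟩ := exists_coordinates (β := β) (a := (0, 0))
    (b := (0, 1)) (u := (1, 0)) (o := (1, 2)) (hβ.ne (by decide)) (hβ.ne (by decide))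
    (hβ.ne (by decide))
    (hβ.projCollinear_superline (by decide) (by decide) (by decide) (by decide) (by decide)
      (by decide))
    (hβ.not_projCollinear (by decide) (hgen _ _ (by decide)))
  have hinj' : ∀ p q, p ≠ q → f p ≠ f q := fun p q h => hinj p q (hβ.ne h)
  have hinf : ∀ p : Fin 3 × Fin 6, p.2 < 2 → p ≠ (0, 0) → p ≠ (0, 1) → f p = ![1, f p 1, 0] := by
    intro p hp ha hb
    have h := (hdet _ _ _).1 (hβ.projCollinear_superline (p := (0, 0)) (q := (0, 1)) (by decide)
      ha.symm hb.symm (by simp) (by simp) hp)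
    have h' := hinj' _ _ hb
    rcases hn p with h1 | ⟨m, h1⟩ | ⟨x, y, h1⟩
    · rw [fb] at h'
      exact absurd h1 h'
    · rw [h1]; rfl
    · rw [fa, fb, h1] at h
      simp [tripDet] at h
  have haff : ∀ i x, 2 ≤ x → f (i, x) = ![f (i, x) 0, f (i, x) 1, 1] := by
    intro i x hx
    have h := mt (hdet (0, 0) (0, 1) (i, x)).2
      (hβ.not_projCollinear (by decide) (hgen i x hx))
    rcases hn (i, x) with h1 | ⟨m, h1⟩ | ⟨x, y, h1⟩
    · rw [fa, fb, h1] at h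
      simp [tripDet] at h
    · rw [fa, fb, h1] at h
      simp [tripDet] at h
    · rw [h1]; rfl
  set m := f (1, 1) 1 with hm
  set n₀ := f (2, 0) 1 with hn₀
  set n₁ := f (2, 1) 1 with hn₁
  have f11 : f (1, 1) = ![1, m, 0] := hinf _ (by decide) (by decide) (by decide)
  have f20 : f (2, 0) = ![1, n₀, 0] := hinf _ (by decide) (by decide) (by decide)
  have f21 : f (2, 1) = ![1, n₁, 0] := hinf _ (by decide) (by decide) (by decide)
  have hCY : ∀ z, 2 ≤ z → f (2, z) 1 = f (1, z) 1 := by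
    intro z hz
    have h := (hdet _ _ _).1 (hβ.projCollinear_cell 0 z (by omega))
    rw [(hunit z).1, fa, haff 1 z hz, haff 2 z hz] at h
    simp [tripDet] at h
    linear_combination -h
  have hCX : ∀ z, 2 ≤ z → f (2, z) 0 = f (1, s z) 0 := by
    intro z hz
    obtain ⟨h2, h1, -⟩ := hs z hz
    have h := (hdet _ _ _).1 (hβ.projCollinear_cell 1 (s z) (by omega))
    rw [h1, fb, haff 1 _ h2, haff 2 z hz] at h
    simp [tripDet] at h
    linear_combination h
  have hA₀ : ∀ x, 2 ≤ x → f (0, x) 1 - f (0, x) 0 = f (1, x) 1 - f (1, s x) 0 := by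
    intro x hx
    have h := (hdet _ _ _).1 (hβ.projCollinear_cell x 0 (by omega))
    rw [(hunit x).2, fu, haff 0 _ hx, haff 2 _ hx, hCX x hx, hCY x hx] at h
    simp [tripDet] at h
    linear_combination -h
  have hA₁ : ∀ x, 2 ≤ x →
      f (0, x) 1 - m * f (0, x) 0 = f (1, op x 1) 1 - m * f (1, s (op x 1)) 0 := by
    intro x hx
    obtain ⟨-, -, h2⟩ := hs x hx
    have h := (hdet _ _ _).1 (hβ.projCollinear_cell x 1 (by omega))
    rw [f11, haff 0 _ hx, haff 2 _ h2, hCX _ h2, hCY _ h2] at h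
    simp [tripDet] at h
    linear_combination -h
  have hm1 : m - 1 ≠ 0 := fun h => hinj' (1, 1) (1, 0) (by decide) (by
    rw [f11, fu, sub_eq_zero.1 h])
  have hX : ∀ y, 2 ≤ y → f (1, y) 0 = ![0, 0, 0, f (1, 3) 0, f (1, 4) 0, f (1, 5) 0] y := by
    intro y hy
    fin_cases y
    · exact absurd hy (by decide)
    · exact absurd hy (by decide)
    · exact congrFun fo 0
    all_goals rfl
  have hY : ∀ y, 2 ≤ y → f (1, y) 1 = ![0, 0, 0, f (1, 3) 1, f (1, 4) 1, f (1, 5) 1] y := by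
    intro y hy
    fin_cases y
    · exact absurd hy (by decide)
    · exact absurd hy (by decide)
    · exact congrFun fo 1
    all_goals rfl
  set X : Fin 6 → L := ![0, 0, 0, f (1, 3) 0, f (1, 4) 0, f (1, 5) 0]
  set Y : Fin 6 → L := ![0, 0, 0, f (1, 3) 1, f (1, 4) 1, f (1, 5) 1]
  have h01 : ∀ x : Fin 6, x ≠ 0 → x ≠ 1 → 2 ≤ x := by decide
  have hpt : ∀ i x, ∃ c : L, c ≠ 0 ∧ coordPoint op s X Y m n₀ n₁ i x = c • f (i, x) := by
    intro i x
    fin_cases i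
    · by_cases h0 : x = 0
      · exact ⟨1, one_ne_zero, by simp [coordPoint, h0, fa]⟩
      by_cases h1 : x = 1
      · exact ⟨1, one_ne_zero, by simp [coordPoint, h1, fb]⟩
      have hx := h01 x h0 h1
      obtain ⟨h2, h3, h4⟩ := hs x hx
      refine ⟨m - 1, hm1, ?_⟩
      have e0 := hA₀ x hx
      have e1 := hA₁ x hx
      rw [hX _ h2, hY _ hx] at e0
      rw [hX _ (hs _ h4).1, hY _ h4] at e1
      simp only [Fin.zero_eta, coordPoint, h0, h1, if_false]
      rw [haff 0 x hx]
      funext i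
      fin_cases i <;> simp [-mul_eq_mul_left_iff]
      · linear_combination e1 - e0
      · linear_combination e1 - m * e0
    · refine ⟨1, one_ne_zero, ?_⟩
      by_cases h0 : x = 0
      · simp [coordPoint, h0, fu]
      by_cases h1 : x = 1
      · simp [coordPoint, h1, f11]
      have hx := h01 x h0 h1
      rw [one_smul]
      simp only [Fin.mk_one, coordPoint, h0, h1, if_false]
      rw [haff 1 x hx, hX x hx, hY x hx]
    · refine ⟨1, one_ne_zero, ?_⟩
      by_cases h0 : x = 0
      · simp [coordPoint, h0, f20]
      by_cases h1 : x = 1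
      · simp [coordPoint, h1, f21]
      have hx := h01 x h0 h1
      rw [one_smul]
      simp only [Fin.reduceFinMk, coordPoint, h0, h1, if_false]
      rw [haff 2 x hx, hCX x hx, hCY x hx, hX _ (hs x hx).1, hY x hx]
  refine ⟨f (1, 3) 0, f (1, 4) 0, f (1, 5) 0, f (1, 3) 1, f (1, 4) 1, f (1, 5) 1, m, n₀, n₁,
    ⟨?_, ?_, ?_, hm1, ?_, ?_, ?_, ?_, ?_⟩, ?_⟩
  · exact fun h => hinj' (1, 1) (0, 0) (by decide) (by rw [f11, fa, h])
  · exact fun h => hinj' (2, 0) (0, 0) (by decide) (by rw [f20, fa, h])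
  · exact fun h => hinj' (2, 1) (0, 0) (by decide) (by rw [f21, fa, h])
  · exact fun h => hinj' (2, 0) (1, 0) (by decide) (by rw [f20, fu, sub_eq_zero.1 h])
  · exact fun h => hinj' (2, 1) (1, 0) (by decide) (by rw [f21, fu, sub_eq_zero.1 h])
  · exact fun h => hinj' (1, 1) (2, 0) (by decide) (by rw [f11, f20, sub_eq_zero.1 h])
  · exact fun h => hinj' (1, 1) (2, 1) (by decide) (by rw [f11, f21, sub_eq_zero.1 h])
  · exact fun h => hinj' (2, 0) (2, 1) (by decide) (by rw [f20, f21, sub_eq_zero.1 h])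
  · intro i x j y k z
    obtain ⟨a, ha, h1⟩ := hpt i x
    obtain ⟨b, hb, h2⟩ := hpt j y
    obtain ⟨c, hc, h3⟩ := hpt k z
    rw [h1, h2, h3, tripDet_smul, hdet]
    simp only [mul_eq_zero, ha, hb, hc, false_or]

end CoordPoint

section Certificates

/-- A loop whose multinet has no weak embedding in characteristic 0. -/
def nonembeddableLoop1 : Fin 6 → Fin 6 → Fin 6 :=
  ![![0, 1, 2, 3, 4, 5], ![1, 0, 3, 2, 5, 4], ![2, 3, 4, 5, 0, 1],
    ![3, 2, 5, 4, 1, 0], ![4, 5, 1, 0, 2, 3], ![5, 4, 0, 1, 3, 2]]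

/-- A loop whose multinet has no weak embedding in characteristic 0. -/
def nonembeddableLoop2 : Fin 6 → Fin 6 → Fin 6 :=
  ![![0, 1, 2, 3, 4, 5], ![1, 0, 3, 2, 5, 4], ![2, 3, 4, 5, 0, 1],
    ![3, 4, 5, 1, 2, 0], ![4, 5, 1, 0, 3, 2], ![5, 2, 0, 4, 1, 3]]

/-- A loop whose multinet has no weak embedding in characteristic 0. -/
def nonembeddableLoop3 : Fin 6 → Fin 6 → Fin 6 :=
  ![![0, 1, 2, 3, 4, 5], ![1, 0, 3, 2, 5, 4], ![2, 4, 0, 5, 1, 3],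
    ![3, 5, 1, 4, 0, 2], ![4, 2, 5, 1, 3, 0], ![5, 3, 4, 0, 2, 1]]

/-- A loop whose multinet has no weak embedding in characteristic 0. -/
def nonembeddableLoop4 : Fin 6 → Fin 6 → Fin 6 :=
  ![![0, 1, 2, 3, 4, 5], ![1, 0, 3, 2, 5, 4], ![2, 4, 0, 5, 3, 1],
    ![3, 5, 4, 0, 1, 2], ![4, 2, 5, 1, 0, 3], ![5, 3, 1, 4, 2, 0]]

variable {K L : Type*} [Field K] [Field L] [Algebra K L]
  {β : Fin 3 × Fin 6 → Projectivization L (Fin 3 → L)}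

theorem IsWeakEmbedding.projCollinear_multinetRow3
    (hβ : IsWeakEmbedding K multinetRow3.blocks β) :
    ProjCollinear β (0, 2) (0, 4) (1, 2) ∧
      ProjCollinear β (0, 3) (0, 5) (1, 3) := by
  obtain ⟨X3, X4, X5, Y3, Y4, Y5, m, n0, n1, ⟨-, -, -, -, -, -, -, -, -⟩, hc⟩ :=
    hβ.exists_coordPoint (s := ![1, 0, 4, 5, 2, 3]) (by decide +kernel)
  have he := fun x y h => (hc _ _ _ _ _ _).1 (hβ.projCollinear_cell x y h)
  have e22 := he 2 2 (by decide)
  have e33 := he 3 3 (by decide)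
  have e44 := he 4 4 (by decide)
  have e55 := he 5 5 (by decide)
  simp only [multinetRow3, Matrix.cons_val] at e22 e33 e44 e55
  simp only [tripDet, coordPoint, Matrix.cons_val, Fin.reduceEq, ↓reduceIte] at e22 e33 e44 e55
  have c1 : ProjCollinear β (0, 2) (0, 4) (1, 2) := by
    by_contra hd
    rw [hc] at hd
    simp only [tripDet, coordPoint, multinetRow3, Matrix.cons_val, Fin.reduceEq, ↓reduceIte] at hd
    have h1 : m * X4 ^ 2 - Y4 ^ 2 = 0 := by linear_combination -e44 - e22
    exact hd (by linear_combination (m - 1) * h1)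
  have c2 : ProjCollinear β (0, 3) (0, 5) (1, 3) := by
    by_contra hd
    rw [hc] at hd
    simp only [tripDet, coordPoint, multinetRow3, Matrix.cons_val, Fin.reduceEq, ↓reduceIte] at hd
    have h2 : -m * X3 ^ 2 + 2 * m * X3 * X5 - m * X5 ^ 2 + Y3 ^ 2 - 2 * Y3 * Y5 + Y5 ^ 2 =
        0 := by linear_combination e55 + e33
    exact hd (by linear_combination (-m + 1) * h2)
  exact ⟨c1, c2⟩

theorem not_isWeakEmbedding_nonembeddableLoop1 [CharZero L] :
    ¬ IsWeakEmbedding K (superlineBlocks nonembeddableLoop1 fun _ => {0, 1}) β := by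
  intro hβ
  obtain ⟨X3, X4, X5, Y3, Y4, Y5, m, n0, n1, ⟨-, -, -, hm1, -, -, -, -, -⟩, hc⟩ :=
    hβ.exists_coordPoint (s := ![1, 0, 3, 2, 5, 4]) (by decide +kernel)
  have he := fun x y h => (hc _ _ _ _ _ _).1 (hβ.projCollinear_cell x y h)
  have hz := fun i x j y k z h h' => mt (hc i x j y k z).2 (hβ.not_projCollinear h h')
  have e22 := he 2 2 (by decide)
  have e23 := he 2 3 (by decide)
  have e25 := he 2 5 (by decide)
  have e33 := he 3 3 (by decide)
  have e53 := he 5 3 (by decide)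
  have e55 := he 5 5 (by decide)
  have z1 := hz 0 0 1 2 1 3 (by decide) (by decide +kernel)
  have z2 := hz 0 1 1 4 1 5 (by decide) (by decide +kernel)
  simp only [nonembeddableLoop1, Matrix.cons_val] at e22 e23 e25 e33 e53 e55
  simp only [tripDet, coordPoint, Matrix.cons_val, Fin.reduceEq, ↓reduceIte] at e22 e23 e25 e33
  simp only [tripDet, coordPoint, Matrix.cons_val, Fin.reduceEq, ↓reduceIte] at e53 e55 z1 z2
  have h1 : m * n1 * X3 - m * X3 - m * X4 + m * X5 - m * Y3 + n1 * X4 - n1 * X5 + n1 * Y3 + n1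
      * Y4 - n1 * Y5 - Y4 + Y5 = 0 := by linear_combination e53 + e25
  have h2 : m * X3 ^ 2 - Y3 ^ 2 = 0 := by linear_combination -e33 - e22
  have h3 : -m * X3 * X4 + m * X3 * Y5 - m * X4 * Y3 + Y3 * Y5 = 0 := by
      linear_combination e23 - h2
  have h4 : -m * X3 * X4 + m * X4 * X5 - m * X5 ^ 2 + X3 * Y5 - X4 * Y5 - X5 * Y3 + X5 * Y4 +
      Y3 * Y4 - Y4 * Y5 + Y5 ^ 2 = 0 := by linear_combination e55 + e22
  have h5 : -m * X4 * Y3 + m * X5 * Y3 + n1 * X3 ^ 2 - n1 * X3 * X5 + n1 * X3 * Y3 - n1 * X4 *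
      X5 + n1 * X5 ^ 2 - n1 * X5 * Y3 - n1 * X5 * Y4 + n1 * X5 * Y5 - X3 * Y3 + X3 * Y4 + X4 * Y5
      - X5 * Y5 - Y3 ^ 2 + Y3 * Y5 + Y4 * Y5 - Y5 ^ 2 = 0 := by linear_combination X3 * e25 - X5 *
      h1 + e22 + h2 + h3 - h4
  have h6 : (1 : L) = 0 := mul_left_cancel₀ (mul_ne_zero (mul_ne_zero (mul_ne_zero hm1 hm1)
      z1) z2) (by linear_combination (-X3 - X4 + X5 - Y3 - Y4 + Y5) * e25 + (X3 + Y3) * h1 + (-m +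
      1) * h5)
  exact one_ne_zero h6

theorem IsWeakEmbedding.projCollinear_multinetRow11 [CharZero L]
    (hβ : IsWeakEmbedding K multinetRow11.blocks β) :
    ProjCollinear β (2, 0) (2, 2) (2, 3) := by
  obtain ⟨X3, X4, X5, Y3, Y4, Y5, m, n0, n1, ⟨-, -, -, hm1, -, -, -, -, hnn⟩, hc⟩ :=
    hβ.exists_coordPoint (s := ![1, 0, 4, 5, 3, 2]) (by decide +kernel)
  have he := fun x y h => (hc _ _ _ _ _ _).1 (hβ.projCollinear_cell x y h)
  have hz := fun i x j y k z h h' => mt (hc i x j y k z).2 (hβ.not_projCollinear h h')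
  have e22 := he 2 2 (by decide)
  have e25 := he 2 5 (by decide)
  have e32 := he 3 2 (by decide)
  have e33 := he 3 3 (by decide)
  have e34 := he 3 4 (by decide)
  have e35 := he 3 5 (by decide)
  have e42 := he 4 2 (by decide)
  have e43 := he 4 3 (by decide)
  have e44 := he 4 4 (by decide)
  have e45 := he 4 5 (by decide)
  have e55 := he 5 5 (by decide)
  have z1 := hz 1 0 1 2 2 3 (by decide) (by decide +kernel)
  simp only [multinetRow11, Matrix.cons_val] at e22 e25 e32 e33 e34 e35 e42 e43 e44 e45 e55
  simp only [tripDet, coordPoint, Matrix.cons_val, Fin.reduceEq, ↓reduceIte] at e22 e25 e32 e33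
  simp only [tripDet, coordPoint, Matrix.cons_val, Fin.reduceEq, ↓reduceIte] at e34 e35 e42 e43
  simp only [tripDet, coordPoint, Matrix.cons_val, Fin.reduceEq, ↓reduceIte] at e44 e45 e55 z1
  have c1 : ProjCollinear β (2, 0) (2, 2) (2, 3) := by
    by_contra hd
    rw [hc] at hd
    simp only [tripDet, coordPoint, Matrix.cons_val, Fin.reduceEq, ↓reduceIte] at hd
    have h1 : m * n0 * X3 + m * n0 * X4 - m * n0 * X5 - m * X4 + m * X5 - m * Y3 - m * Y4 + m
        * Y5 - n0 * X3 + n0 * Y3 + Y4 - Y5 = 0 := by linear_combination -e45 - e32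
    have h2 : m * n0 * X3 + m * n0 * X4 - m * n0 * X5 - m * n1 * X3 + m * n1 * X5 + m * X3 - m
        * X4 - m * Y4 - n0 * X3 + n0 * Y3 - n1 * Y3 + n1 * Y4 = 0 := by linear_combination e35 +
        h1
    have h3 : -m * X3 - m * X4 + m * X5 + X3 - Y3 = 0 := mul_left_cancel₀ hnn (by
        linear_combination -e42 - h2)
    have h4 : -m * X3 ^ 2 + m * X3 * X4 + X3 ^ 2 - X3 * X4 - X3 * Y4 + X5 * Y4 - Y3 * Y4 + Y4
        ^ 2 = 0 := by linear_combination e44 + (X3 - X4) * h3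
    have h5 : m ^ 2 * X3 * X4 - m ^ 2 * X4 ^ 2 - m * X3 ^ 2 - m * X3 * Y3 + m * X3 * Y4 - m *
        X4 * Y3 + m * Y3 ^ 2 - m * Y3 * Y4 + 2 * X3 * Y3 - X3 * Y5 - Y3 ^ 2 + Y4 * Y5 = 0 := by
        linear_combination e34 + (X3 - X4) * h1 + m * e33 + e22 + (-m * X3 + m * X4 + n0 * X3 - n0
        * X4 - X3 + X4 + Y3) * h3 + h4
    have h6 : m * X4 ^ 2 - X4 * Y3 + X4 * Y5 + X5 * Y3 - Y3 ^ 2 = 0 := by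
        linear_combination -e43 + (X3 - X4) * h1 + (m - 1) * e33 + (-m * X3 + m * X4 + n0 * X3 -
        n0 * X4 + Y3) * h3 - h5
    have h7 : -m * X3 ^ 2 - m * X3 * X4 + 2 * X3 ^ 2 - X3 * X4 - X3 * Y3 - X3 * Y4 + X5 * Y4 -
        Y3 * Y5 + Y5 ^ 2 = 0 := by linear_combination -e25 - X3 * h1 + (-m - 1) * e33 - e22 + (m *
        X3 - m * X4 - n0 * X3 + 2 * X3 - X4 - Y3 + Y4) * h3 + h5 - h6
    have h8 : m * X4 ^ 2 + X3 ^ 2 - X3 * X4 - X3 * X5 - X3 * Y4 + X5 * Y3 + X5 * Y4 - Y3 ^ 2 =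
        0 := by linear_combination -e55 + (-X3 - X5) * h3 + h6 + h7
    have h9 : -m * n0 * X3 ^ 2 + m * n0 * X3 * Y3 + m * n0 * X4 ^ 2 + m * X3 * Y3 - m * Y3 ^ 2
        + n0 * X3 ^ 2 - n0 * X3 * X4 + n0 * X3 * X5 - 2 * n0 * X3 * Y3 - n0 * X4 * X5 + n0 * X4 *
        Y3 - X3 * Y3 + X4 * Y3 - X5 * Y3 + 2 * Y3 ^ 2 = 0 := by linear_combination (X3 - X4 - Y3)
        * e32 + (-n0 + 1) * e33 + (n0 * X3 - n0 * X4 - Y3) * h3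
    have h10 : m * n0 * X3 ^ 2 + m * n0 * X3 * X4 - m * n0 * X3 * Y3 - m * X3 * Y3 - m * X4 *
        Y3 + m * Y3 ^ 2 - n0 * X3 ^ 2 - n0 * X3 * X5 + 2 * n0 * X3 * Y3 + n0 * X4 * X5 - n0 * X4 *
        Y3 - n0 * X5 ^ 2 + 2 * n0 * X5 * Y3 - n0 * Y3 ^ 2 + X3 * Y3 + X5 * Y3 - 2 * Y3 ^ 2 =
        0 := by linear_combination (X3 - X5) * e32 + (-n0 * X3 + X3 - X4 - X5 + Y3) * h3 + (n0 -
        1) * h8 - h9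
    have h11 : -m * X3 * X4 + X3 ^ 2 - X3 * Y3 - X3 * Y4 + Y3 * Y4 = 0 := mul_left_cancel₀ hm1
        (by linear_combination ((X5 - Y3) * h1 - m * e33 + (m - 1) * e22 + (m * X3 + n0 * X5 - n0
        * Y3 - X3 - X4 - X5 + Y3 + Y4) * h3 - h8) / 2)
    have h12 : (1 : L) = 0 := mul_left_cancel₀ (mul_ne_zero z1 hd) (by linear_combination (-X3
        + Y3) * e32 + (-X3 + Y3) * h3 - h10 + (-n0 + 1) * h11)
    exact one_ne_zero h12
  exact c1

theorem not_isWeakEmbedding_nonembeddableLoop2 :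
    ¬ IsWeakEmbedding K (superlineBlocks nonembeddableLoop2 fun _ => {0, 1}) β := by
  intro hβ
  obtain ⟨X3, X4, X5, Y3, Y4, Y5, m, n0, n1, ⟨-, -, -, -, -, -, -, -, -⟩, hc⟩ :=
    hβ.exists_coordPoint (s := ![1, 0, 3, 2, 5, 4]) (by decide +kernel)
  have he := fun x y h => (hc _ _ _ _ _ _).1 (hβ.projCollinear_cell x y h)
  have hz := fun i x j y k z h h' => mt (hc i x j y k z).2 (hβ.not_projCollinear h h')
  have e22 := he 2 2 (by decide)
  have e23 := he 2 3 (by decide)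
  have e32 := he 3 2 (by decide)
  have e34 := he 3 4 (by decide)
  have e53 := he 5 3 (by decide)
  have e55 := he 5 5 (by decide)
  have z1 := hz 0 0 1 2 1 3 (by decide) (by decide +kernel)
  have z2 := hz 0 3 1 1 1 4 (by decide) (by decide +kernel)
  simp only [nonembeddableLoop2, Matrix.cons_val] at e22 e23 e32 e34 e53 e55 z2
  simp only [tripDet, coordPoint, Matrix.cons_val, Fin.reduceEq, ↓reduceIte] at e22 e23 e32 e34
  simp only [tripDet, coordPoint, Matrix.cons_val, Fin.reduceEq, ↓reduceIte] at e53 e55 z1 z2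
  have h1 : -m * X3 + m * X5 + X4 + Y3 - Y4 - Y5 = 0 := mul_left_cancel₀ z1 (by
      linear_combination e53 + e32 + e23 + e22)
  have h2 : m * X3 * Y5 - m * X4 * Y3 + X3 * X4 + X3 * Y3 - X3 * Y4 - X3 * Y5 - X4 ^ 2 - X4 *
      Y3 + X4 * Y4 + X4 * Y5 - X5 * Y3 - 2 * Y3 ^ 2 + Y3 * Y4 + 2 * Y3 * Y5 - Y4 * Y5 = 0 := by
      linear_combination e55 + e23 + (X3 - X4 - Y3 + Y5) * h1
  have h3 : m * X3 - m * X4 - X5 - Y3 + Y4 + Y5 = 0 := mul_left_cancel₀ z1 (by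
      linear_combination -e34 + e23 + (X3 - X4 + Y4) * h1 - h2)
  exact z2 (by linear_combination m * h1 + m * h3)

theorem IsWeakEmbedding.projCollinear_multinetRow4 [CharZero L]
    (hβ : IsWeakEmbedding K multinetRow4.blocks β) :
    ProjCollinear β (2, 0) (2, 4) (2, 5) ∧
      ProjCollinear β (2, 1) (2, 2) (2, 3) ∧
      ProjCollinear β (0, 0) (0, 4) (0, 5) ∧
      ProjCollinear β (1, 0) (1, 4) (1, 5) ∧
      ProjCollinear β (1, 1) (1, 2) (1, 3) ∧
      ProjCollinear β (0, 1) (0, 2) (0, 3) := by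
  obtain ⟨X3, X4, X5, Y3, Y4, Y5, m, n0, n1, ⟨-, -, -, hm1, -, -, -, -, -⟩, hc⟩ :=
    hβ.exists_coordPoint (s := ![1, 0, 4, 5, 2, 3]) (by decide +kernel)
  have he := fun x y h => (hc _ _ _ _ _ _).1 (hβ.projCollinear_cell x y h)
  have hz := fun i x j y k z h h' => mt (hc i x j y k z).2 (hβ.not_projCollinear h h')
  have e22 := he 2 2 (by decide)
  have e23 := he 2 3 (by decide)
  have e25 := he 2 5 (by decide)
  have e32 := he 3 2 (by decide)
  have e34 := he 3 4 (by decide)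
  have e35 := he 3 5 (by decide)
  have e42 := he 4 2 (by decide)
  have e43 := he 4 3 (by decide)
  have e44 := he 4 4 (by decide)
  have e45 := he 4 5 (by decide)
  have e52 := he 5 2 (by decide)
  have e54 := he 5 4 (by decide)
  have z1 := hz 0 0 1 3 1 5 (by decide) (by decide +kernel)
  have z2 := hz 0 0 1 2 1 3 (by decide) (by decide +kernel)
  simp only [multinetRow4, Matrix.cons_val] at e22 e23 e25 e32 e34 e35 e42 e43 e44 e45 e52 e54
  simp only [tripDet, coordPoint, Matrix.cons_val, Fin.reduceEq, ↓reduceIte] at e22 e23 e25 e32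
  simp only [tripDet, coordPoint, Matrix.cons_val, Fin.reduceEq, ↓reduceIte] at e34 e35 e42 e43
  simp only [tripDet, coordPoint, Matrix.cons_val, Fin.reduceEq, ↓reduceIte] at e44 e45 e52 e54
  simp only [tripDet, coordPoint, Matrix.cons_val, Fin.reduceEq, ↓reduceIte] at z1 z2
  have c1 : ProjCollinear β (2, 0) (2, 4) (2, 5) := by
    by_contra hd
    rw [hc] at hd
    simp only [tripDet, coordPoint, Matrix.cons_val, Fin.reduceEq, ↓reduceIte] at hd
    have h1 : (1 : L) = 0 := mul_left_cancel₀ (mul_ne_zero hm1 hd) (by linear_combination -e54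
        - e22)
    exact one_ne_zero h1
  have d1 := (hc _ _ _ _ _ _).1 c1
  simp only [tripDet, coordPoint, Matrix.cons_val, Fin.reduceEq, ↓reduceIte] at d1
  have c2 : ProjCollinear β (2, 1) (2, 2) (2, 3) := by
    by_contra hd
    rw [hc] at hd
    simp only [tripDet, coordPoint, Matrix.cons_val, Fin.reduceEq, ↓reduceIte] at hd
    have h2 : (1 : L) = 0 := mul_left_cancel₀ (mul_ne_zero hm1 hd) (by linear_combination -e42
        - e34)
    exact one_ne_zero h2
  have d2 := (hc _ _ _ _ _ _).1 c2
  simp only [tripDet, coordPoint, Matrix.cons_val, Fin.reduceEq, ↓reduceIte] at d2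
  have c3 : ProjCollinear β (0, 0) (0, 4) (0, 5) := by
    by_contra hd
    rw [hc] at hd
    simp only [tripDet, coordPoint, multinetRow4, Matrix.cons_val, Fin.reduceEq, ↓reduceIte] at hd
    have h3 : m * X3 - m * X4 + m * Y4 - m * Y5 + n0 * X4 + n0 * Y5 - Y5 = 0 := by
        linear_combination -e54 + d1
    have h4 : -m * X3 * Y3 - m * X4 * Y5 + m * X5 ^ 2 - m * X5 * Y3 + m * X5 * Y5 + X3 * Y3 +
        X3 * Y4 - X4 * Y4 + X4 * Y5 + X5 * Y4 - 2 * X5 * Y5 + Y3 * Y5 - 2 * Y4 * Y5 = 0 := by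
        linear_combination e52 - e32 + e35
    have h5 : -m * X3 * Y4 + m * X4 * Y4 + m * X5 * Y3 - m * X5 * Y5 - Y3 ^ 2 + Y3 * Y4 + Y3 *
        Y5 = 0 := by linear_combination e43 - e32 + e35 - h4
    have h6 : -m * X3 * Y4 - m * X4 * Y3 + m * X4 * Y5 + m * X5 * Y3 + m * X5 * Y4 - m * X5 *
        Y5 + X3 * Y4 + X4 * Y3 - X4 * Y5 - Y3 ^ 2 + Y3 * Y5 + Y4 ^ 2 - Y4 * Y5 = 0 := by
        linear_combination e44 + e32 - e35 + h4 + h5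
    have h7 : m * X3 * Y3 + m * X3 * Y4 - m * X3 * Y5 - X3 * Y4 - X4 * Y3 + X4 * Y5 - Y3 * Y5
        + Y5 ^ 2 = 0 := by linear_combination (-X4 - Y5) * d1 + X3 * h3 + e23
    have h8 : m * X3 - m * X4 + m * X5 + m * Y4 - m * Y5 - Y3 = 0 := mul_left_cancel₀ z1 (by
        linear_combination (-m * X5 + m * Y3 - Y4) * d1 - Y5 * e45 - n0 * e32 + h6 + h7)
    exact hd (by linear_combination (m - 1) * h8)
  have d3 := (hc _ _ _ _ _ _).1 c3
  simp only [tripDet, coordPoint, multinetRow4, Matrix.cons_val, Fin.reduceEq, ↓reduceIte] at d3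
  have c4 : ProjCollinear β (1, 0) (1, 4) (1, 5) := by
    by_contra hd
    rw [hc] at hd
    simp only [tripDet, coordPoint, Matrix.cons_val, Fin.reduceEq, ↓reduceIte] at hd
    have h9 : m * X3 - m * X4 + m * X5 + m * Y4 - m * Y5 - Y3 = 0 := mul_left_cancel₀ hm1 (by
        linear_combination d3)
    have h10 : n1 * Y4 - n1 * Y5 + Y3 = 0 := mul_left_cancel₀ hm1 (by linear_combination e25 +
        (-m + 1) * d2 + e42 + (n1 - 1) * h9)
    have h11 : (1 : L) = 0 := mul_left_cancel₀ (mul_ne_zero z2 hd) (by linear_combination (Y4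
        - Y5) * d2 + (X4 - X5) * h10)
    exact one_ne_zero h11
  have d4 := (hc _ _ _ _ _ _).1 c4
  simp only [tripDet, coordPoint, Matrix.cons_val, Fin.reduceEq, ↓reduceIte] at d4
  have c5 : ProjCollinear β (1, 1) (1, 2) (1, 3) := by
    by_contra hd
    rw [hc] at hd
    simp only [tripDet, coordPoint, Matrix.cons_val, Fin.reduceEq, ↓reduceIte] at hd
    have h12 : (1 : L) = 0 := mul_left_cancel₀ (mul_ne_zero hm1 hd) (by linear_combination d3
        + (-m ^ 2 + m) * d4)
    exact one_ne_zero h12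
  have d5 := (hc _ _ _ _ _ _).1 c5
  simp only [tripDet, coordPoint, Matrix.cons_val, Fin.reduceEq, ↓reduceIte] at d5
  have c6 : ProjCollinear β (0, 1) (0, 2) (0, 3) := by
    by_contra hd
    rw [hc] at hd
    simp only [tripDet, coordPoint, multinetRow4, Matrix.cons_val, Fin.reduceEq, ↓reduceIte] at hd
    exact hd (by linear_combination (-m + 1) * d4 + (-m + 1) * d5)
  exact ⟨c1, c2, c3, c4, c5, c6⟩

theorem not_isWeakEmbedding_nonembeddableLoop3 [CharZero L] :
    ¬ IsWeakEmbedding K (superlineBlocks nonembeddableLoop3 fun _ => {0, 1}) β := by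
  intro hβ
  obtain ⟨X3, X4, X5, Y3, Y4, Y5, m, n0, n1, ⟨-, -, -, -, -, -, -, -, hnn⟩, hc⟩ :=
    hβ.exists_coordPoint (s := ![1, 0, 3, 2, 5, 4]) (by decide +kernel)
  have he := fun x y h => (hc _ _ _ _ _ _).1 (hβ.projCollinear_cell x y h)
  have hz := fun i x j y k z h h' => mt (hc i x j y k z).2 (hβ.not_projCollinear h h')
  have e33 := he 3 3 (by decide)
  have e34 := he 3 4 (by decide)
  have e43 := he 4 3 (by decide)
  have e44 := he 4 4 (by decide)
  have z1 := hz 0 1 0 2 1 5 (by decide) (by decide +kernel)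
  have z2 := hz 1 0 1 4 2 3 (by decide) (by decide +kernel)
  simp only [nonembeddableLoop3, Matrix.cons_val] at e33 e34 e43 e44 z1
  simp only [tripDet, coordPoint, Matrix.cons_val, Fin.reduceEq, ↓reduceIte] at e33 e34 e43 e44
  simp only [tripDet, coordPoint, Matrix.cons_val, Fin.reduceEq, ↓reduceIte] at z1 z2
  have h1 : m * X5 * Y3 - m * X5 * Y4 + m * Y3 ^ 2 - 2 * m * Y3 * Y4 + m * Y4 ^ 2 + n1 * X3 *
      X4 + n1 * X3 * Y3 - n1 * X3 * Y4 - n1 * X4 * X5 + n1 * X4 * Y4 - n1 * X5 * Y3 + n1 * X5 * Y4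
      + n1 * Y3 * Y4 - n1 * Y4 ^ 2 + X3 * Y4 - X3 * Y5 - X4 * Y3 - X5 * Y3 + X5 * Y5 - 2 * Y3 ^ 2
      + 2 * Y3 * Y4 + Y3 * Y5 - Y4 * Y5 = 0 := by linear_combination -e33 + (-X4 - Y3 + Y4) * e43
  have h2 : -X3 * Y4 + X3 * Y5 + X4 * Y3 + X5 * Y4 - X5 * Y5 + Y3 ^ 2 - Y3 * Y5 - Y4 ^ 2 + Y4
      * Y5 = 0 := by linear_combination -e44 + (-X4 - Y3 + Y4) * e43 - h1
  have h3 : (1 : L) = 0 := mul_left_cancel₀ (mul_ne_zero (mul_ne_zero hnn z1) z2) (by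
      linear_combination (-X4 - Y3 + Y4) * e43 + (X3 - X5 - Y3 + Y4) * e34 + (-n0 + 1) * h2)
  exact one_ne_zero h3

theorem IsWeakEmbedding.projCollinear_multinetRow14 [CharZero L]
    (hβ : IsWeakEmbedding K multinetRow14.blocks β) :
    ProjCollinear β (0, 1) (0, 3) (0, 5) ∧
      ProjCollinear β (0, 0) (0, 2) (0, 4) ∧
      ProjCollinear β (0, 0) (0, 5) (1, 2) ∧
      ProjCollinear β (2, 0) (2, 2) (2, 4) ∧
      ProjCollinear β (1, 1) (1, 2) (1, 5) ∧
      ProjCollinear β (1, 0) (1, 3) (1, 4) ∧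
      ProjCollinear β (2, 1) (2, 3) (2, 5) := by
  obtain ⟨X3, X4, X5, Y3, Y4, Y5, m, n0, n1, ⟨-, -, -, hm1, hn01, -, -, -, hnn⟩, hc⟩ :=
    hβ.exists_coordPoint (s := ![1, 0, 5, 4, 2, 3]) (by decide +kernel)
  have he := fun x y h => (hc _ _ _ _ _ _).1 (hβ.projCollinear_cell x y h)
  have hz := fun i x j y k z h h' => mt (hc i x j y k z).2 (hβ.not_projCollinear h h')
  have e22 := he 2 2 (by decide)
  have e24 := he 2 4 (by decide)
  have e25 := he 2 5 (by decide)
  have e32 := he 3 2 (by decide)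
  have e33 := he 3 3 (by decide)
  have e35 := he 3 5 (by decide)
  have e42 := he 4 2 (by decide)
  have e43 := he 4 3 (by decide)
  have e52 := he 5 2 (by decide)
  have e53 := he 5 3 (by decide)
  have e54 := he 5 4 (by decide)
  have e55 := he 5 5 (by decide)
  have z1 := hz 0 1 1 2 1 5 (by decide) (by decide +kernel)
  have z2 := hz 0 1 0 5 1 5 (by decide) (by decide +kernel)
  have z3 := hz 0 1 0 4 1 3 (by decide) (by decide +kernel)
  have z4 := hz 0 0 0 2 1 2 (by decide) (by decide +kernel)
  simp only [multinetRow14, Matrix.cons_val] at e22 e24 e25 e32 e33 e35 e42 e43 e52 e53 e54 e55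
  simp only [multinetRow14] at z2 z3 z4
  simp only [tripDet, coordPoint, Matrix.cons_val, Fin.reduceEq, ↓reduceIte] at e22 e24 e25 e32
  simp only [tripDet, coordPoint, Matrix.cons_val, Fin.reduceEq, ↓reduceIte] at e33 e35 e42 e43
  simp only [tripDet, coordPoint, Matrix.cons_val, Fin.reduceEq, ↓reduceIte] at e52 e53 e54 e55
  simp only [tripDet, coordPoint, Matrix.cons_val, Fin.reduceEq, ↓reduceIte] at z1 z2 z3 z4
  have c1 : ProjCollinear β (0, 1) (0, 3) (0, 5) := by
    by_contra hd
    rw [hc] at hd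
    simp only [tripDet, coordPoint, multinetRow14, Matrix.cons_val, Fin.reduceEq, ↓reduceIte] at hd
    have h1 : -n1 * X3 + n1 * X4 + Y5 = 0 := mul_left_cancel₀ hm1 (by linear_combination -e25
        - e33)
    have h2 : m * n1 * X3 - n1 ^ 2 * X3 + n1 ^ 2 * X4 - m * X3 - m * Y4 + n1 * X3 - n1 * X4 +
        n1 * Y4 = 0 := by linear_combination e54 + (-m + n1) * h1
    have h3 : -n0 * X5 + Y3 - Y4 = 0 := mul_left_cancel₀ hm1 (by linear_combination e32 + e24)
    have h4 : m * n0 * X5 - n0 * n1 * X3 + n0 * n1 * X4 - m * X3 + n0 * X3 - n0 * X5 + n0 * Y4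
        + n1 * X3 - n1 * X4 - Y4 = 0 := by linear_combination -e43 + (n0 - 1) * h1 + (-m + 1) * h3
    have h5 : n0 ^ 2 * X5 + m * X4 - m * X5 - m * Y4 - n0 * X4 + n0 * Y4 = 0 := by
        linear_combination e24 + (-n0 + 1) * h3
    have h6 : -m * n1 * X3 + m * n1 * X5 + n0 * n1 * X5 + m * X4 - m * X5 - n0 * X5 + n1 * X3
        - n1 * X4 + n1 * Y4 - Y4 = 0 := by linear_combination -e33 + (-n1 + 1) * h3
    have h7 : -n0 ^ 2 * n1 * X3 + n0 ^ 2 * n1 * X4 - m ^ 2 * X4 + m ^ 2 * X5 + m ^ 2 * Y4 - m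
        * n0 * X3 + m * n0 * X4 - m * n0 * Y4 + n0 ^ 2 * X3 + n0 ^ 2 * Y4 + n0 * n1 * X3 - n0 * n1
        * X4 + m * X4 - m * X5 - m * Y4 - n0 * X4 = 0 := by linear_combination n0 * h4 + (-m + 1)
        * h5
    have h8 : -X3 + X4 - Y4 = 0 := mul_left_cancel₀ (mul_ne_zero hm1 hnn) (by
        linear_combination (n0 - 1) * h2 + (-n1 + 1) * h4 + (-n1 + 1) * h5 + (n0 - 1) * h6)
    have h9 : n0 ^ 2 * n1 * Y4 - m ^ 2 * X3 + m ^ 2 * X5 + n0 ^ 2 * X3 + n0 ^ 2 * Y4 - n0 * n1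
        * Y4 + m * X3 - m * X5 - n0 * X3 - n0 * Y4 = 0 := by linear_combination h7 + (-n0 ^ 2 * n1
        + m ^ 2 - m * n0 + n0 * n1 - m + n0) * h8
    have h10 : n0 ^ 2 * n1 * Y4 - m ^ 2 * X3 - m * n1 * Y4 + n0 ^ 2 * X3 + n0 ^ 2 * Y4 - m *
        Y4 = 0 := mul_left_cancel₀ hn01 (by linear_combination -m * h4 + (m * n0 * n1 - m * n1) *
        h8 + n0 * h9)
    exact hd (by linear_combination (m - 1) * h1 + (-m + 1) * h3 - h4 + (-m * n1 + n0 * n1 + m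
        - 1) * h8 - h9 + h10)
  have d1 := (hc _ _ _ _ _ _).1 c1
  simp only [tripDet, coordPoint, multinetRow14, Matrix.cons_val, Fin.reduceEq, ↓reduceIte] at d1
  have c2 : ProjCollinear β (0, 0) (0, 2) (0, 4) := by
    by_contra hd
    rw [hc] at hd
    simp only [tripDet, coordPoint, multinetRow14, Matrix.cons_val, Fin.reduceEq, ↓reduceIte] at hd
    have h11 : m * X5 + X3 - X4 + Y3 + Y4 - Y5 = 0 := mul_left_cancel₀ hm1 (by
        linear_combination -d1)
    have h12 : -X3 + X4 - Y4 = 0 := mul_left_cancel₀ hm1 (by linear_combination -e33 + (-n1 +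
        1) * h11 - e42)
    exact hd (by linear_combination (-m + 1) * h11 + (m ^ 2 - 2 * m + 1) * h12)
  have d2 := (hc _ _ _ _ _ _).1 c2
  simp only [tripDet, coordPoint, multinetRow14, Matrix.cons_val, Fin.reduceEq, ↓reduceIte] at d2
  have c3 : ProjCollinear β (0, 0) (0, 5) (1, 2) := by
    by_contra hd
    rw [hc] at hd
    simp only [tripDet, coordPoint, multinetRow14, Matrix.cons_val, Fin.reduceEq, ↓reduceIte] at hd
    have h13 : -m * X5 - X3 + X4 - Y3 - Y4 + Y5 = 0 := mul_left_cancel₀ hm1 (by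
        linear_combination d1)
    have h14 : -m * X5 - Y3 + Y5 = 0 := mul_left_cancel₀ (mul_ne_zero hm1 hm1) (by
        linear_combination -d2 + (m ^ 2 - m) * h13)
    have h15 : m * n0 * X5 + m * X3 - m * X5 - m * Y3 + m * Y4 - n0 * X3 + n0 * Y3 - n0 * Y4 =
        0 := by linear_combination e43 + (-n0 + 1) * h14
    have h16 : n0 * X5 - Y3 + Y4 = 0 := mul_left_cancel₀ hm1 (by linear_combination e55 + (n0
        - 1) * h14 + h15)
    have h17 : m ^ 2 * X5 ^ 2 - m * X5 ^ 2 + m * X5 * Y3 - X3 * Y3 + X3 * Y4 - X5 * Y4 + Y3 ^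
        2 - 2 * Y3 * Y4 + Y4 ^ 2 = 0 := by linear_combination e35 + (Y3 - Y4) * h13 + (-m * X5 +
        X4 - 2 * Y3 + Y4) * h14
    have h18 : m ^ 2 * X5 - m * X3 + m * Y3 - Y4 = 0 := mul_left_cancel₀ z1 (by
        linear_combination -X5 * h15 + (m * X5 - X3 + Y3 - Y4) * h16 + h17)
    exact hd (by linear_combination m * h14 + h18)
  have d3 := (hc _ _ _ _ _ _).1 c3
  simp only [tripDet, coordPoint, multinetRow14, Matrix.cons_val, Fin.reduceEq, ↓reduceIte] at d3
  have c4 : ProjCollinear β (2, 0) (2, 2) (2, 4) := by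
    by_contra hd
    rw [hc] at hd
    simp only [tripDet, coordPoint, Matrix.cons_val, Fin.reduceEq, ↓reduceIte] at hd
    have h19 : Y3 = 0 := mul_left_cancel₀ z2 (by linear_combination -e53 + (-X3 + X5) * d3)
    have h20 : m * X3 + m * Y4 - n0 * X3 - n0 * Y4 + n0 * Y5 - Y5 = 0 := by
        linear_combination e43 + (m - 1) * h19
    have h21 : (1 : L) = 0 := mul_left_cancel₀ (mul_ne_zero hm1 hd) (by
        linear_combination -e55 - h20)
    exact one_ne_zero h21
  have c5 : ProjCollinear β (1, 1) (1, 2) (1, 5) := by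
    by_contra hd
    rw [hc] at hd
    simp only [tripDet, coordPoint, Matrix.cons_val, Fin.reduceEq, ↓reduceIte] at hd
    have h22 : Y3 = 0 := mul_left_cancel₀ z3 (by linear_combination -e52 + X4 * d3)
    have h23 : m * X5 * Y5 + X4 * Y4 - X5 * Y4 - X5 * Y5 = 0 := by linear_combination -e22 +
        (-X4 + X5) * d3 + (-X3 + Y5) * h22
    have h24 : -X4 + X5 = 0 := mul_left_cancel₀ hd (by linear_combination -e35 + (-m * X5 - Y4
        + Y5) * h22 + h23)
    exact z4 (by linear_combination -h22 - m * h24)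
  have d5 := (hc _ _ _ _ _ _).1 c5
  simp only [tripDet, coordPoint, Matrix.cons_val, Fin.reduceEq, ↓reduceIte] at d5
  have c6 : ProjCollinear β (1, 0) (1, 3) (1, 4) := by
    by_contra hd
    rw [hc] at hd
    simp only [tripDet, coordPoint, Matrix.cons_val, Fin.reduceEq, ↓reduceIte] at hd
    have h25 : X3 - X4 + Y3 + Y4 = 0 := mul_left_cancel₀ hm1 (by linear_combination -d1 + (-m
        + 1) * d5)
    have h26 : Y3 = 0 := mul_left_cancel₀ (mul_ne_zero hm1 hm1) (by linear_combination d2 + (m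
        - 1) * d5 + (m ^ 2 - m) * h25)
    exact hd (by linear_combination -h25 + 2 * h26)
  have d6 := (hc _ _ _ _ _ _).1 c6
  simp only [tripDet, coordPoint, Matrix.cons_val, Fin.reduceEq, ↓reduceIte] at d6
  have c7 : ProjCollinear β (2, 1) (2, 3) (2, 5) := by
    by_contra hd
    rw [hc] at hd
    simp only [tripDet, coordPoint, Matrix.cons_val, Fin.reduceEq, ↓reduceIte] at hd
    have h27 : -X3 + X4 - Y4 = 0 := mul_left_cancel₀ z3 (by linear_combination e52 + (-X3 - Y4
        + Y5) * d6 - X4 * d3)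
    have h28 : n1 * Y5 - Y4 - Y5 = 0 := mul_left_cancel₀ hm1 (by linear_combination -e42 + (n1
        - 1) * d3)
    have h29 : n1 * Y4 + Y5 = 0 := mul_left_cancel₀ hm1 (by linear_combination e54 + (n1 - 1)
        * d3 + (-m * n1 + n1) * h27 + (-m + 1) * h28)
    exact hd (by linear_combination d6 + (-n1 - 1) * h27 - h29)
  exact ⟨c1, c2, c3, c4, c5, c6, c7⟩

theorem IsWeakEmbedding.projCollinear_multinetRow15
    (hβ : IsWeakEmbedding K multinetRow15.blocks β) :
    ProjCollinear β (0, 0) (0, 2) (0, 4) ∧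
      ProjCollinear β (0, 1) (0, 3) (0, 5) := by
  obtain ⟨X3, X4, X5, Y3, Y4, Y5, m, n0, n1, ⟨hm, -, -, hm1, -, -, -, -, -⟩, hc⟩ :=
    hβ.exists_coordPoint (s := ![1, 0, 3, 2, 5, 4]) (by decide +kernel)
  have he := fun x y h => (hc _ _ _ _ _ _).1 (hβ.projCollinear_cell x y h)
  have hz := fun i x j y k z h h' => mt (hc i x j y k z).2 (hβ.not_projCollinear h h')
  have e23 := he 2 3 (by decide)
  have e24 := he 2 4 (by decide)
  have e25 := he 2 5 (by decide)
  have e32 := he 3 2 (by decide)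
  have e33 := he 3 3 (by decide)
  have e35 := he 3 5 (by decide)
  have e42 := he 4 2 (by decide)
  have e43 := he 4 3 (by decide)
  have e44 := he 4 4 (by decide)
  have e52 := he 5 2 (by decide)
  have z1 := hz 0 0 1 2 1 3 (by decide) (by decide +kernel)
  have z2 := hz 0 1 1 2 1 3 (by decide) (by decide +kernel)
  simp only [multinetRow15, Matrix.cons_val] at e23 e24 e25 e32 e33 e35 e42 e43 e44 e52
  simp only [tripDet, coordPoint, Matrix.cons_val, Fin.reduceEq, ↓reduceIte] at e23 e24 e25 e32
  simp only [tripDet, coordPoint, Matrix.cons_val, Fin.reduceEq, ↓reduceIte] at e33 e35 e42 e43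
  simp only [tripDet, coordPoint, Matrix.cons_val, Fin.reduceEq, ↓reduceIte] at e44 e52 z1 z2
  have c1 : ProjCollinear β (0, 0) (0, 2) (0, 4) := by
    by_contra hd
    rw [hc] at hd
    simp only [tripDet, coordPoint, multinetRow15, Matrix.cons_val, Fin.reduceEq, ↓reduceIte] at hd
    have h1 : m * X4 - X5 + Y4 - Y5 = 0 := mul_left_cancel₀ z1 (by linear_combination -e32 -
        e52)
    have h2 : m * X3 + m * Y4 - n1 * X3 + n1 * X4 - n1 * Y5 - X5 = 0 := by
        linear_combination -e24 + h1
    have h3 : m * X3 * X5 + m * X5 * Y3 + X3 * Y3 - X3 * Y5 - X5 ^ 2 - 2 * X5 * Y3 + X5 * Y4 +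
        X5 * Y5 + Y3 * Y4 - Y4 * Y5 = 0 := by linear_combination e25 + (X5 + Y3 - Y5) * h1
    have h4 : n1 * X3 ^ 2 - n1 * X3 * X4 + n1 * X3 * Y5 + X3 * Y4 - X3 * Y5 - X5 * Y4 + X5 *
        Y5 + Y4 ^ 2 - Y4 * Y5 = 0 := by linear_combination e23 + (X3 - X5 - Y3 + Y4) * h1 - X3 *
        h2 + h3
    have h5 : m * X3 * X5 + m * X3 * Y3 - X3 * Y5 + X4 * Y3 - X5 ^ 2 - 2 * X5 * Y3 + X5 * Y4 +
        X5 * Y5 + 2 * Y3 * Y4 - Y3 * Y5 - Y4 * Y5 = 0 := by linear_combination e43 + (-X3 + X5 +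
        Y3 - Y4) * h1 + X3 * h2 + h4
    have h6 : m * X3 - m * X5 + n1 * X3 - n1 * X4 + n1 * Y5 + Y4 = 0 := mul_left_cancel₀ z2
        (by linear_combination -e44 + (-X3 + X5 + Y3 - Y4) * h1 + X3 * h2 + 2 * h4 - h5)
    exact hd (by linear_combination (m - 1) * h1 + (-m + 1) * h2 + (-m + 1) * h6)
  have d1 := (hc _ _ _ _ _ _).1 c1
  simp only [tripDet, coordPoint, multinetRow15, Matrix.cons_val, Fin.reduceEq, ↓reduceIte] at d1
  have c2 : ProjCollinear β (0, 1) (0, 3) (0, 5) := by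
    by_contra hd
    rw [hc] at hd
    simp only [tripDet, coordPoint, multinetRow15, Matrix.cons_val, Fin.reduceEq, ↓reduceIte] at hd
    have h7 : m * n1 * X5 - m * X3 - m * Y4 + n1 * X3 - n1 * X5 + n1 * Y3 - Y3 + Y4 = 0 := by
        linear_combination -e33 - e42
    have h8 : -2 * m * X3 + m * X4 + m * X5 - m * Y4 - Y5 = 0 := mul_left_cancel₀ hm1 (by
        linear_combination d1)
    have h9 : -3 * m * X3 * X5 - 3 * m * X3 * Y3 + m * X3 * Y5 + 2 * m * X5 ^ 2 + 2 * m * X5 *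
        Y3 - m * X5 * Y4 - m * Y3 * Y4 + X3 * Y4 - X3 * Y5 + X4 * Y4 - X5 * Y4 - X5 * Y5 - Y3 * Y5
        = 0 := by linear_combination -e32 + (X5 + Y3) * h8 - e35
    have h10 : 2 * m * X3 - m * X5 + m * Y4 - X5 + Y4 = 0 := mul_left_cancel₀ z1 (by
        linear_combination -e52 - X5 * h8 + e35 + h9)
    have h11 : -m * X3 ^ 2 - m * X5 * Y3 - X3 * Y3 + X5 ^ 2 + 2 * X5 * Y3 - 2 * X5 * Y4 - Y3 *
        Y4 + Y4 ^ 2 = 0 := by linear_combination e23 + (X3 - X5 - Y3 + Y4) * h8 + (-X5 - Y3 + Y4)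
        * h10
    have h12 : m * X3 - m * X5 - X3 + X4 + Y4 - Y5 = 0 := mul_left_cancel₀ z1 (by
        linear_combination -e43 + (X3 - X5 - Y3 + Y4) * h8 + (-X5 - Y3 + Y4) * h10 - h11)
    have h13 : -m ^ 2 * X3 + m ^ 2 * X5 + 4 * m * X3 - 3 * m * X5 + m * Y5 + n1 * X3 + n1 * Y3
        - 2 * X5 - Y3 + 4 * Y4 - Y5 = 0 := by linear_combination e42 + h7 + e24 + 2 * h10 + (-m +
        n1) * h12
    have h14 : -m * X3 + 2 * m * X5 - n1 * X3 - n1 * Y3 + Y3 - 2 * Y4 = 0 := by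
        linear_combination h8 + 2 * h10 - m * h12 - h13
    have h15 : n1 + 1 = 0 := mul_left_cancel₀ (mul_ne_zero (mul_ne_zero hm hm1) z2) (by
        linear_combination (-m - 1) * e42 + (m - n1) * h10)
    exact hd (by linear_combination (-m + 1) * h12 + (-m + 1) * h14 + (-m * X3 - m * Y3 + X3 +
        Y3) * h15)
  exact ⟨c1, c2⟩

theorem IsWeakEmbedding.projCollinear_multinetRow9 [CharZero L]
    (hβ : IsWeakEmbedding K multinetRow9.blocks β) :
    ProjCollinear β (2, 1) (2, 2) (2, 3) ∧
      ProjCollinear β (2, 0) (2, 4) (2, 5) := by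
  obtain ⟨X3, X4, X5, Y3, Y4, Y5, m, n0, n1, ⟨-, -, -, hm1, -, -, -, -, -⟩, hc⟩ :=
    hβ.exists_coordPoint (s := ![1, 0, 5, 4, 3, 2]) (by decide +kernel)
  have he := fun x y h => (hc _ _ _ _ _ _).1 (hβ.projCollinear_cell x y h)
  have e22 := he 2 2 (by decide)
  have e32 := he 3 2 (by decide)
  have e45 := he 4 5 (by decide)
  have e55 := he 5 5 (by decide)
  simp only [multinetRow9, Matrix.cons_val] at e22 e32 e45 e55
  simp only [tripDet, coordPoint, Matrix.cons_val, Fin.reduceEq, ↓reduceIte] at e22 e32 e45 e55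
  have c1 : ProjCollinear β (2, 1) (2, 2) (2, 3) := by
    by_contra hd
    rw [hc] at hd
    simp only [tripDet, coordPoint, Matrix.cons_val, Fin.reduceEq, ↓reduceIte] at hd
    have h1 : (1 : L) = 0 := mul_left_cancel₀ (mul_ne_zero hm1 hd) (by linear_combination -e55
        - e32)
    exact one_ne_zero h1
  have c2 : ProjCollinear β (2, 0) (2, 4) (2, 5) := by
    by_contra hd
    rw [hc] at hd
    simp only [tripDet, coordPoint, Matrix.cons_val, Fin.reduceEq, ↓reduceIte] at hd
    have h2 : (1 : L) = 0 := mul_left_cancel₀ (mul_ne_zero hm1 hd) (by linear_combination e45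
        + e22)
    exact one_ne_zero h2
  exact ⟨c1, c2⟩

theorem IsWeakEmbedding.projCollinear_multinetRow8 [CharZero L]
    (hβ : IsWeakEmbedding K multinetRow8.blocks β) :
    ProjCollinear β (2, 1) (2, 2) (2, 5) ∧
      ProjCollinear β (2, 1) (2, 2) (2, 3) ∧
      ProjCollinear β (2, 1) (2, 2) (2, 4) := by
  obtain ⟨X3, X4, X5, Y3, Y4, Y5, m, n0, n1, ⟨hm, -, -, hm1, hn01, -, -, -, hnn⟩, hc⟩ :=
    hβ.exists_coordPoint (s := ![1, 0, 4, 5, 3, 2]) (by decide +kernel)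
  have he := fun x y h => (hc _ _ _ _ _ _).1 (hβ.projCollinear_cell x y h)
  have hz := fun i x j y k z h h' => mt (hc i x j y k z).2 (hβ.not_projCollinear h h')
  have e22 := he 2 2 (by decide)
  have e23 := he 2 3 (by decide)
  have e24 := he 2 4 (by decide)
  have e25 := he 2 5 (by decide)
  have e33 := he 3 3 (by decide)
  have e34 := he 3 4 (by decide)
  have e35 := he 3 5 (by decide)
  have e42 := he 4 2 (by decide)
  have e44 := he 4 4 (by decide)
  have e45 := he 4 5 (by decide)
  have e52 := he 5 2 (by decide)
  have e53 := he 5 3 (by decide)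
  have e54 := he 5 4 (by decide)
  have e55 := he 5 5 (by decide)
  have z1 := hz 0 0 1 2 1 5 (by decide) (by decide +kernel)
  have z2 := hz 0 0 1 2 1 4 (by decide) (by decide +kernel)
  have z3 := hz 0 1 1 2 1 4 (by decide) (by decide +kernel)
  simp only [multinetRow8, Matrix.cons_val] at e22 e23 e24 e25 e33 e34 e35 e42 e44 e45 e52 e53
  simp only [multinetRow8, Matrix.cons_val] at e54 e55
  simp only [tripDet, coordPoint, Matrix.cons_val, Fin.reduceEq, ↓reduceIte] at e22 e23 e24 e25
  simp only [tripDet, coordPoint, Matrix.cons_val, Fin.reduceEq, ↓reduceIte] at e33 e34 e35 e42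
  simp only [tripDet, coordPoint, Matrix.cons_val, Fin.reduceEq, ↓reduceIte] at e44 e45 e52 e53
  simp only [tripDet, coordPoint, Matrix.cons_val, Fin.reduceEq, ↓reduceIte] at e54 e55 z1 z2
  simp only [tripDet, coordPoint, Matrix.cons_val, Fin.reduceEq, ↓reduceIte] at z3
  have c1 : ProjCollinear β (2, 1) (2, 2) (2, 5) := by
    by_contra hd
    rw [hc] at hd
    simp only [tripDet, coordPoint, Matrix.cons_val, Fin.reduceEq, ↓reduceIte] at hd
    have h1 : -m * X3 + n0 * X3 - n0 * Y4 + n0 * Y5 + Y4 - Y5 = 0 := by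
        linear_combination -e33 - e55
    have h2 : m * X3 * X4 + m * X3 * Y5 - m * X4 ^ 2 - m * X4 * Y3 - Y3 * Y5 + Y5 ^ 2 =
        0 := by linear_combination -e25 - e24
    have h3 : -m * X3 * Y4 + m * X4 * Y3 - m * X4 * Y5 + m * X5 * Y4 - Y3 * Y4 + Y3 * Y5 + Y4
        ^ 2 - Y5 ^ 2 = 0 := by linear_combination -e34 - e24 - h2
    have h4 : -m * X3 + m * X4 + m * X5 + n1 * X3 - n1 * X4 - n1 * X5 + n1 * Y3 - n1 * Y4 - n1
        * Y5 - Y3 + Y4 + Y5 = 0 := by linear_combination e54 + e45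
    have h5 : m * X3 * X5 - m * X3 * Y4 - m * X5 ^ 2 + m * X5 * Y3 - Y3 * Y4 + Y4 ^ 2 =
        0 := by linear_combination -e35 + e24 + h2 + h3
    have h6 : m * X3 * Y4 - m * X4 ^ 2 + m * X5 ^ 2 - m * X5 * Y3 - X3 * Y3 + X4 * Y4 - X4 *
        Y5 - X5 * Y4 + X5 * Y5 + 2 * Y3 * Y4 - Y3 * Y5 - Y4 ^ 2 + Y4 * Y5 = 0 := by
        linear_combination -e42 - e24 - h5
    have h7 : m * X3 * Y5 + m * X4 ^ 2 - m * X5 * Y4 - X4 * Y4 + X4 * Y5 + X5 * Y4 - X5 * Y5 +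
        Y3 * Y5 - 2 * Y4 * Y5 = 0 := by linear_combination e52 - h5 - h6
    have h8 : -m * X3 * Y5 + m * X4 * Y5 + m * X5 * Y3 - m * X5 * Y4 - Y3 ^ 2 + Y3 * Y4 + Y3 *
        Y5 = 0 := by linear_combination e53 + e24 + h5 + h6
    have h9 : m ^ 2 * X3 - m ^ 2 * X4 - m ^ 2 * X5 + 2 * m * n1 * X4 - m * n1 * Y3 + m * n1 *
        Y4 + m * n1 * Y5 - m * X3 + 2 * m * X5 - 2 * m * Y4 - n1 * X4 - n1 * X5 + 2 * n1 * Y3 - n1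
        * Y4 - n1 * Y5 - Y3 + 2 * Y4 = 0 := by linear_combination e23 - e45 + (-m + 2) * h4
    have h10 : X3 * Y5 + X4 * Y4 - X4 * Y5 = 0 := mul_left_cancel₀ hm1 (by
        linear_combination (X3 - Y4 + Y5) * e22 + (-X4 - Y5) * h1)
    have h11 : Y3 - Y4 - Y5 = 0 := mul_left_cancel₀ (mul_ne_zero hm1 hnn) (by
        linear_combination (-m + n1) * e22 + (m - n1) * e55 + (m - n1) * h1 + (-m + n0) * h4)
    have h12 : X3 - X4 - X5 = 0 := mul_left_cancel₀ (mul_ne_zero hm z1) (by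
        linear_combination h8 + (-m * X5 + Y3) * h11)
    have h13 : 2 * m * n1 * X4 - m * X4 + m * X5 - 2 * m * Y4 - n1 * X4 - n1 * X5 + n1 * Y4 +
        n1 * Y5 + Y4 - Y5 = 0 := by linear_combination h9 + (m * n1 - 2 * n1 + 1) * h11 + (-m ^ 2
        + m) * h12
    have h14 : m * X4 * Y5 - m * X5 * Y5 + n0 * Y4 ^ 2 - Y4 ^ 2 + Y5 ^ 2 = 0 :=
        mul_left_cancel₀ hm1 (by linear_combination (m * X4 - m * X5 + Y5) * e22 + (m * Y4 - Y4) *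
        e55 + (m - n0) * e24 + (-m ^ 2 + m * n0 + m - n0) * h10 + (-m ^ 2 * X4 + m * n0 * X4 - m *
        n0 * Y4 + m * Y4 - m * Y5 + n0 * Y4 + n0 * Y5 - Y4) * h11 + (m ^ 2 * Y5 - m * n0 * Y5 - m
        * Y5 + n0 * Y5) * h12)
    have h15 : m * X5 - n0 * Y4 = 0 := mul_left_cancel₀ (mul_ne_zero hm1 z1) (by
        linear_combination (-m * X4 - Y5) * e22 + (-m * Y4 + m * Y5 + Y4) * e55 + (-m + n0) * h7 +
        (-m + n0) * h10 + (m * n0 * Y4 - m * n0 * Y5 - m * Y4 + 2 * m * Y5 - n0 * Y4 - n0 * Y5 +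
        Y4) * h11 + (m ^ 2 * Y5 - m * n0 * Y5 + m * Y5 - n0 * Y5) * h12 + (m - 1) * h14)
    have h16 : 2 * n0 * n1 * Y4 - m * X4 - 2 * m * Y5 - n0 * Y4 + n1 * X4 - n1 * X5 - n1 * Y4
        + n1 * Y5 + Y4 + Y5 = 0 := by linear_combination 2 * e45 + (2 * m - 2 * n1) * h12 + h13 +
        (-2 * n1 + 1) * h15
    have h17 : X4 * Y5 + X5 * Y4 - Y4 ^ 2 - Y4 * Y5 + Y5 ^ 2 = 0 := by linear_combination -Y4
        * e55 - h6 - h7 + (m - 1) * h10 + (-X3 + Y4) * h11 + (m * Y4 - Y4) * h12 + h14 + (X5 - Y3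
        + Y4 + Y5) * h15
    have h18 : -2 * m * n0 + n0 ^ 2 + m = 0 := mul_left_cancel₀ z2 (by linear_combination m *
        e55 + (-m * n0 + m) * h11 + (-m + n0) * h15)
    have h19 : m * X4 + n0 * Y5 = 0 := mul_left_cancel₀ hm1 (by linear_combination (-m + n0) *
        e22 + (-X4 - Y5) * h18)
    have h20 : 2 * n0 * n1 * Y5 + 2 * m * Y4 - n0 * Y4 - n0 * Y5 + n1 * X4 + n1 * X5 - n1 * Y4
        - n1 * Y5 - Y4 + Y5 = 0 := by linear_combination -h13 + h15 + (2 * n1 - 1) * h19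
    have h21 : -X4 ^ 2 + X5 ^ 2 - X5 * Y5 - Y4 ^ 2 - Y4 * Y5 + Y5 ^ 2 = 0 := mul_left_cancel₀
        z1 (by linear_combination (-X5 + Y4 + Y5) * h10 + (X5 * Y5 - Y4 * Y5 - Y5 ^ 2) * h12 + (X4
        - Y5) * h17)
    have h22 : 4 * m * Y5 ^ 2 - 2 * n0 * Y5 ^ 2 - n1 * X4 ^ 2 + n1 * X4 * X5 - 3 * n1 * X4 *
        Y5 + n1 * X5 * Y5 - 2 * n1 * Y5 ^ 2 - X4 * Y5 + X5 * Y5 - Y4 * Y5 - 3 * Y5 ^ 2 = 0 := by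
        linear_combination (2 * n1 * Y4 + Y5) * e22 - Y5 * e55 + (-n0 - n1 + 1) * h10 + (n0 * Y5 -
        Y5) * h11 + (n0 * Y5 + n1 * Y5 - Y5) * h12 + Y5 * h15 + (-X4 - 2 * Y5) * h16 + (2 * n1 *
        Y4 - X4 - 3 * Y5) * h19
    have h23 : 2 * m * Y4 * Y5 - 2 * m * Y5 ^ 2 - n0 * Y4 * Y5 + n0 * Y5 ^ 2 + n1 * X4 ^ 2 + 2
        * n1 * X4 * Y5 + n1 * X5 * Y5 - n1 * Y4 * Y5 + n1 * Y5 ^ 2 + X4 * Y5 - Y4 * Y5 + 2 * Y5 ^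
        2 = 0 := by linear_combination ((-2 * n1 * Y5 + Y5) * e22 + Y5 * e55 + (n0 + n1 + 1) * h10
        + (-n0 * Y5 + Y5) * h11 + (-n0 * Y5 - n1 * Y5 - Y5) * h12 - Y5 * h15 + (-2 * n1 * Y5 - 2 *
        Y4 + Y5) * h19 + (X4 + 2 * Y5) * h20 - h22) / 2
    have h24 : 4 * m * Y4 - 2 * n0 * Y4 + n1 * X5 - 2 * n1 * Y4 - Y4 = 0 := mul_left_cancel₀
        z1 (by linear_combination -Y5 * e22 + (2 * n1 * Y4 + Y5) * e55 + n0 * h10 + (-2 * n0 * n1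
        * Y4 - n0 * Y5 + 2 * n1 * Y4 + Y5) * h11 - n0 * Y5 * h12 + (-4 * n1 + 1) * h14 + (-2 * n1
        * Y4 - 4 * n1 * Y5 + X4 + 2 * Y5) * h15 + (X5 - 2 * Y5) * h16 + (n0 + n1 - 1) * h17 + (4 *
        n1 * Y5 - 4 * Y5) * h19 - 2 * Y5 * h20 + n1 * h21 - h22)
    have h25 : -2 * m * Y4 - 2 * m * Y5 + n0 * Y4 + n0 * Y5 + n1 * X4 + n1 * Y4 + n1 * Y5 + Y5
        = 0 := mul_left_cancel₀ z1 (by linear_combination -2 * Y5 * e55 + (-2 * n0 - 2 * n1 - 1) *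
        h10 + (2 * n0 * Y5 - 2 * Y5) * h11 + (2 * n0 * Y5 + 2 * n1 * Y5 + Y5) * h12 + 2 * Y5 * h15
        + 4 * Y4 * h19 + h22 + h23 - X4 * h24)
    have h26 : -2 * m + n0 + n1 = 0 := mul_left_cancel₀ (mul_ne_zero z2 z1) (by
        linear_combination (Y5 * e22 + Y5 * e55 + (n0 + n1) * h10 + (-n0 * Y5 + Y5) * h11 + (-n0 *
        Y5 - n1 * Y5) * h12 - Y5 * h15 + (-2 * Y4 - Y5) * h19 + h23 - 2 * Y5 * h24 + (-X4 - Y5) *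
        h25) / 2)
    exact hd (by linear_combination e22 - h19 - X4 * h26)
  have d1 := (hc _ _ _ _ _ _).1 c1
  simp only [tripDet, coordPoint, Matrix.cons_val, Fin.reduceEq, ↓reduceIte] at d1
  have c2 : ProjCollinear β (2, 1) (2, 2) (2, 3) := by
    by_contra hd
    rw [hc] at hd
    simp only [tripDet, coordPoint, Matrix.cons_val, Fin.reduceEq, ↓reduceIte] at hd
    have h27 : n0 * n1 + m - n0 - n1 = 0 := mul_left_cancel₀ z3 (by linear_combination -e22 +
        (-n0 + 1) * d1)
    have h28 : (1 : L) = 0 := mul_left_cancel₀ (mul_ne_zero hn01 hd) (by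
        linear_combination -e55 + (n0 - 1) * d1 + X5 * h27)
    exact one_ne_zero h28
  have c3 : ProjCollinear β (2, 1) (2, 2) (2, 4) := by
    by_contra hd
    rw [hc] at hd
    simp only [tripDet, coordPoint, Matrix.cons_val, Fin.reduceEq, ↓reduceIte] at hd
    have h29 : n0 * n1 + m - n0 - n1 = 0 := mul_left_cancel₀ z3 (by linear_combination -e22 +
        (-n0 + 1) * d1)
    have h30 : (1 : L) = 0 := mul_left_cancel₀ (mul_ne_zero hn01 hd) (by
        linear_combination e44 + (X3 - X4) * h29)
    exact one_ne_zero h30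
  exact ⟨c1, c2, c3⟩

theorem not_isWeakEmbedding_nonembeddableLoop4 [CharZero L] :
    ¬ IsWeakEmbedding K (superlineBlocks nonembeddableLoop4 fun _ => {0, 1}) β := by
  intro hβ
  obtain ⟨X3, X4, X5, Y3, Y4, Y5, m, n0, n1, ⟨-, -, -, hm1, -, -, -, hmn1, -⟩, hc⟩ :=
    hβ.exists_coordPoint (s := ![1, 0, 3, 2, 5, 4]) (by decide +kernel)
  have he := fun x y h => (hc _ _ _ _ _ _).1 (hβ.projCollinear_cell x y h)
  have hz := fun i x j y k z h h' => mt (hc i x j y k z).2 (hβ.not_projCollinear h h')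
  have e25 := he 2 5 (by decide)
  have e34 := he 3 4 (by decide)
  have e35 := he 3 5 (by decide)
  have e42 := he 4 2 (by decide)
  have e52 := he 5 2 (by decide)
  have z1 := hz 0 0 1 2 1 3 (by decide) (by decide +kernel)
  have z2 := hz 0 0 1 2 1 5 (by decide) (by decide +kernel)
  simp only [nonembeddableLoop4, Matrix.cons_val] at e25 e34 e35 e42 e52
  simp only [tripDet, coordPoint, Matrix.cons_val, Fin.reduceEq, ↓reduceIte] at e25 e34 e35 e42
  simp only [tripDet, coordPoint, Matrix.cons_val, Fin.reduceEq, ↓reduceIte] at e52 z1 z2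
  have h1 : -Y3 + Y4 - Y5 = 0 := mul_left_cancel₀ hm1 (by linear_combination -e34 - e52)
  have h2 : -X3 + X4 + X5 - 2 * Y5 = 0 := mul_left_cancel₀ hmn1 (by linear_combination e25 -
      e52 + (-n1 + 1) * h1)
  have h3 : -m * X3 * Y5 + m * X4 ^ 2 + m * X4 * Y3 - m * X4 * Y5 + X3 * Y5 - X4 * Y5 - Y3 *
      Y5 + Y5 ^ 2 = 0 := by linear_combination e42 + (-m * X4 + Y5) * h1 + (m * X4 - Y5) * h2
  have h4 : (1 : L) = 0 := mul_left_cancel₀ (mul_ne_zero (mul_ne_zero hm1 z1) z2) (by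
      linear_combination (-e35 + (-m * X4 - m * Y3 + Y5) * h2 + h3) / 2)
  exact one_ne_zero h4

theorem IsWeakEmbedding.projCollinear_multinetRow10 [CharZero L]
    (hβ : IsWeakEmbedding K multinetRow10.blocks β) :
    ProjCollinear β (2, 0) (2, 2) (2, 5) ∧
      ProjCollinear β (2, 0) (2, 3) (2, 4) ∧
      ProjCollinear β (2, 1) (2, 3) (2, 5) ∧
      ProjCollinear β (2, 1) (2, 2) (2, 4) := by
  obtain ⟨X3, X4, X5, Y3, Y4, Y5, m, n0, n1, ⟨-, -, -, hm1, hn01, hn11, -, -, -⟩, hc⟩ :=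
    hβ.exists_coordPoint (s := ![1, 0, 4, 5, 3, 2]) (by decide +kernel)
  have he := fun x y h => (hc _ _ _ _ _ _).1 (hβ.projCollinear_cell x y h)
  have hz := fun i x j y k z h h' => mt (hc i x j y k z).2 (hβ.not_projCollinear h h')
  have e22 := he 2 2 (by decide)
  have e23 := he 2 3 (by decide)
  have e24 := he 2 4 (by decide)
  have e25 := he 2 5 (by decide)
  have e33 := he 3 3 (by decide)
  have e35 := he 3 5 (by decide)
  have e42 := he 4 2 (by decide)
  have e44 := he 4 4 (by decide)
  have e45 := he 4 5 (by decide)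
  have e52 := he 5 2 (by decide)
  have e55 := he 5 5 (by decide)
  have z1 := hz 0 2 1 2 2 1 (by decide) (by decide +kernel)
  have z2 := hz 0 0 1 3 1 5 (by decide) (by decide +kernel)
  have z3 := hz 0 0 0 2 1 3 (by decide) (by decide +kernel)
  have z4 := hz 0 0 1 2 1 5 (by decide) (by decide +kernel)
  have z5 := hz 0 1 1 2 1 4 (by decide) (by decide +kernel)
  have z6 := hz 0 1 1 2 1 5 (by decide) (by decide +kernel)
  simp only [multinetRow10, Matrix.cons_val] at e22 e23 e24 e25 e33 e35 e42 e44 e45 e52 e55 z1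
  simp only [multinetRow10] at z3
  simp only [tripDet, coordPoint, Matrix.cons_val, Fin.reduceEq, ↓reduceIte] at e22 e23 e24 e25
  simp only [tripDet, coordPoint, Matrix.cons_val, Fin.reduceEq, ↓reduceIte] at e33 e35 e42 e44
  simp only [tripDet, coordPoint, Matrix.cons_val, Fin.reduceEq, ↓reduceIte] at e45 e52 e55 z1
  simp only [tripDet, coordPoint, Matrix.cons_val, Fin.reduceEq, ↓reduceIte] at z2 z3 z4 z5
  simp only [tripDet, coordPoint, Matrix.cons_val, Fin.reduceEq, ↓reduceIte] at z6
  have c1 : ProjCollinear β (2, 0) (2, 2) (2, 5) := by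
    by_contra hd
    rw [hc] at hd
    simp only [tripDet, coordPoint, Matrix.cons_val, Fin.reduceEq, ↓reduceIte] at hd
    have h1 : m * X3 * X4 + m * X3 * Y5 - m * X4 ^ 2 - m * X4 * Y3 - Y3 * Y5 + Y5 ^ 2 =
        0 := by linear_combination -e25 - e24
    have h2 : m ^ 2 * X3 - m ^ 2 * X4 + m * n1 * X4 + m * n1 * Y4 - m * X3 - m * Y3 - m * Y4 -
        n1 * Y4 + n1 * Y5 + Y3 + Y4 - Y5 = 0 := by linear_combination e23 + (-m + 1) * e44
    have h3 : m * X3 * X5 - m * X4 ^ 2 + m * X4 * X5 - 2 * m * X4 * Y3 + m * X4 * Y5 - m * X5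
        ^ 2 + m * X5 * Y3 + X4 * Y4 - X4 * Y5 - X5 * Y4 + X5 * Y5 - 2 * Y3 * Y5 + Y4 * Y5 + Y5 ^ 2
        = 0 := by linear_combination -e35 + h1
    have h4 : -m * X4 * X5 + 2 * m * X4 * Y3 - m * X4 * Y5 + m * X5 ^ 2 - m * X5 * Y3 - X3 *
        Y3 + Y3 * Y4 + Y3 * Y5 - Y5 ^ 2 = 0 := by linear_combination -e42 - e24 - h3
    have h5 : m * X3 * Y5 + m * X4 * X5 - m * X4 * Y3 - Y4 * Y5 = 0 := by
        linear_combination e52 - e24 - h3 - h4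
    have h6 : X3 * Y5 - X4 * Y3 + X4 * Y4 - X5 * Y5 = 0 := mul_left_cancel₀ hm1 (by
        linear_combination (X3 - X5 + Y3 - Y4) * e22 + (X4 + Y5) * e33)
    have h7 : -Y3 + Y4 + Y5 = 0 := mul_left_cancel₀ z1 (by linear_combination -Y5 * e55 - Y5 *
        e44 + (-m + n1) * h6)
    have h8 : m ^ 2 * X3 - m ^ 2 * X4 + m * n1 * X4 + m * n1 * Y3 - m * n1 * Y5 - m * X3 - 2 *
        m * Y3 + m * Y5 - n1 * Y3 + 2 * n1 * Y5 + 2 * Y3 - 2 * Y5 = 0 := by linear_combination h2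
        + (-m * n1 + m + n1 - 1) * h7
    have h9 : -m ^ 2 * X4 * Y3 + m ^ 2 * X4 * Y5 + m ^ 2 * X5 * Y5 - m * n1 * X4 ^ 2 - m * n1
        * X4 * Y3 + m * n1 * X4 * Y5 + m * X4 ^ 2 + 3 * m * X4 * Y3 - 2 * m * X4 * Y5 - m * X5 *
        Y5 - m * Y3 * Y5 + m * Y5 ^ 2 + n1 * X4 * Y3 - 2 * n1 * X4 * Y5 - 2 * X4 * Y3 + 2 * X4 *
        Y5 + Y3 * Y5 - Y5 ^ 2 = 0 := by linear_combination (m - 1) * h1 + (-m ^ 2 + m) * h6 + (m ^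
        2 * X4 - m * X4) * h7 - X4 * h8
    have h10 : m ^ 2 * X4 * Y3 - m ^ 2 * X4 * Y5 + m * n1 * X4 ^ 2 + m * n1 * X4 * Y3 + m * n1
        * Y3 * Y5 - m * n1 * Y5 ^ 2 - m * X4 ^ 2 - 3 * m * X4 * Y3 + m * X4 * Y5 - m * Y3 * Y5 -
        n1 * X4 * Y3 + 2 * n1 * X4 * Y5 - n1 * Y3 * Y5 + 2 * n1 * Y5 ^ 2 + 2 * X4 * Y3 - 2 * X4 *
        Y5 + Y3 * Y5 - Y5 ^ 2 = 0 := by linear_combination (-m ^ 2 + m) * h6 + (m ^ 2 * X4 - m *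
        X4) * h7 + Y5 * h8 - h9
    have h11 : m * X4 + n1 * Y5 = 0 := mul_left_cancel₀ (mul_ne_zero hm1 z2) (by
        linear_combination m * X4 * e55 - m * Y5 * e44 + (-m + n1) * h5 + (-m * n1 * Y5 + n1 * Y5)
        * h7)
    have h12 : m * X4 ^ 2 + 2 * X4 * Y5 + Y5 ^ 2 = 0 := mul_left_cancel₀ z3 (by
        linear_combination Y5 * h10 + (-m * X4 ^ 2 - m * X4 * Y3 - m * Y3 * Y5 + m * Y5 ^ 2 + X4 *
        Y3 - 2 * X4 * Y5 + Y3 * Y5 - 2 * Y5 ^ 2) * h11)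
    have h13 : -m * X4 + n0 * Y5 - 2 * Y5 = 0 := mul_left_cancel₀ (mul_ne_zero hm1 z4) (by
        linear_combination (m * X4 - m * Y5 + 2 * Y5) * e22 + (m - n0) * h12)
    exact hd (by linear_combination -e22 + h13)
  have d1 := (hc _ _ _ _ _ _).1 c1
  simp only [tripDet, coordPoint, Matrix.cons_val, Fin.reduceEq, ↓reduceIte] at d1
  have c2 : ProjCollinear β (2, 0) (2, 3) (2, 4) := by
    by_contra hd
    rw [hc] at hd
    simp only [tripDet, coordPoint, Matrix.cons_val, Fin.reduceEq, ↓reduceIte] at hd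
    have h14 : n0 ^ 2 + m - 2 * n0 = 0 := mul_left_cancel₀ z5 (by linear_combination -e22 +
        (-n0 + 1) * d1)
    have h15 : (1 : L) = 0 := mul_left_cancel₀ (mul_ne_zero hn01 hd) (by
        linear_combination -e33 + (X3 - X5) * h14)
    exact one_ne_zero h15
  have d2 := (hc _ _ _ _ _ _).1 c2
  simp only [tripDet, coordPoint, Matrix.cons_val, Fin.reduceEq, ↓reduceIte] at d2
  have c3 : ProjCollinear β (2, 1) (2, 3) (2, 5) := by
    by_contra hd
    rw [hc] at hd
    simp only [tripDet, coordPoint, Matrix.cons_val, Fin.reduceEq, ↓reduceIte] at hd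
    have h16 : m * X3 - m * X5 - n0 * Y3 + n0 * Y4 + 2 * Y3 - 2 * Y4 = 0 := by
        linear_combination e33 + d2
    have h17 : m * X4 - n0 * Y5 + 2 * Y5 = 0 := by linear_combination -d1 - e22
    have h18 : -m * X3 - n0 * X5 + n0 * Y3 + 2 * X5 - 2 * Y3 + Y4 = 0 := mul_left_cancel₀ z4
        (by linear_combination e42 + e52 + (-X5 + Y3) * h17)
    have h19 : m * X3 * X5 - X3 * Y3 + 2 * X3 * Y5 + X4 * Y4 - X4 * Y5 - X5 * Y4 - X5 * Y5 +
        Y3 * Y4 + Y3 * Y5 - Y4 * Y5 - Y5 ^ 2 = 0 := by linear_combination e25 + Y5 * d2 + e52 +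
        (X3 - X5) * h17
    have h20 : m * n0 * X5 - m * X3 - m * X5 + m * Y4 - n0 * X5 + n0 * Y5 + 2 * X5 - Y3 - Y5 =
        0 := by linear_combination e45 - d2 + h16 + m * e22 + (m - 1) * h17 + h18
    have h21 : -X3 + X4 + X5 - Y3 + Y4 + Y5 = 0 := mul_left_cancel₀ z4 (by
        linear_combination (e24 - e52 - Y5 * e22 + (-X4 + X5 - Y3 - Y5) * h17 - Y5 * h18 + h19) /
        2)
    have h22 : -Y3 + Y4 + Y5 = 0 := mul_left_cancel₀ hm1 (by linear_combination -d2 + h16 +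
        e22 + (m - n0) * h21)
    have h23 : -m * X3 + m * X5 + n0 * Y5 - 2 * Y5 = 0 := by linear_combination -h17 + m * h21
        - m * h22
    have h24 : (1 : L) = 0 := mul_left_cancel₀ (mul_ne_zero hm1 hd) (by
        linear_combination (-n0 + 1) * e55 + (n1 - 1) * h18 + h20 + (-m - n1 + 1) * h22 - n1 *
        h23)
    exact one_ne_zero h24
  have d3 := (hc _ _ _ _ _ _).1 c3
  simp only [tripDet, coordPoint, Matrix.cons_val, Fin.reduceEq, ↓reduceIte] at d3
  have c4 : ProjCollinear β (2, 1) (2, 2) (2, 4) := by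
    by_contra hd
    rw [hc] at hd
    simp only [tripDet, coordPoint, Matrix.cons_val, Fin.reduceEq, ↓reduceIte] at hd
    have h25 : n1 ^ 2 + m - 2 * n1 = 0 := mul_left_cancel₀ z6 (by linear_combination e55 +
        (-n1 + 1) * d3)
    have h26 : (1 : L) = 0 := mul_left_cancel₀ (mul_ne_zero hn11 hd) (by
        linear_combination e44 + (X3 - X4) * h25)
    exact one_ne_zero h26
  exact ⟨c1, c2, c3, c4⟩

set_option maxHeartbeats 400000 in
theorem IsWeakEmbedding.projCollinear_multinetRow16 [CharZero L]
    (hβ : IsWeakEmbedding K multinetRow16.blocks β) :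
    ProjCollinear β (2, 2) (2, 4) (2, 5) ∧
      ProjCollinear β (0, 4) (0, 5) (1, 4) ∧
      ProjCollinear β (2, 1) (2, 3) (2, 4) := by
  obtain ⟨X3, X4, X5, Y3, Y4, Y5, m, n0, n1, ⟨-, -, -, hm1, hn01, -, -, -, -⟩, hc⟩ :=
    hβ.exists_coordPoint (s := ![1, 0, 4, 2, 5, 3]) (by decide +kernel)
  have he := fun x y h => (hc _ _ _ _ _ _).1 (hβ.projCollinear_cell x y h)
  have hz := fun i x j y k z h h' => mt (hc i x j y k z).2 (hβ.not_projCollinear h h')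
  have e22 := he 2 2 (by decide)
  have e23 := he 2 3 (by decide)
  have e24 := he 2 4 (by decide)
  have e25 := he 2 5 (by decide)
  have e33 := he 3 3 (by decide)
  have e35 := he 3 5 (by decide)
  have e42 := he 4 2 (by decide)
  have e44 := he 4 4 (by decide)
  have e45 := he 4 5 (by decide)
  have e52 := he 5 2 (by decide)
  have e53 := he 5 3 (by decide)
  have e54 := he 5 4 (by decide)
  have e55 := he 5 5 (by decide)
  have z1 := hz 1 0 1 2 2 5 (by decide) (by decide +kernel)
  have z2 := hz 0 1 0 5 1 5 (by decide) (by decide +kernel)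
  have z3 := hz 0 0 1 2 1 5 (by decide) (by decide +kernel)
  simp only [multinetRow16, Matrix.cons_val] at e22 e23 e24 e25 e33 e35 e42 e44 e45 e52 e53 e54
  simp only [multinetRow16, Matrix.cons_val] at e55 z2
  simp only [tripDet, coordPoint, Matrix.cons_val, Fin.reduceEq, ↓reduceIte] at e22 e23 e24 e25
  simp only [tripDet, coordPoint, Matrix.cons_val, Fin.reduceEq, ↓reduceIte] at e33 e35 e42 e44
  simp only [tripDet, coordPoint, Matrix.cons_val, Fin.reduceEq, ↓reduceIte] at e45 e52 e53 e54
  simp only [tripDet, coordPoint, Matrix.cons_val, Fin.reduceEq, ↓reduceIte] at e55 z1 z2 z3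
  have c1 : ProjCollinear β (2, 2) (2, 4) (2, 5) := by
    by_contra hd
    rw [hc] at hd
    simp only [tripDet, coordPoint, Matrix.cons_val, Fin.reduceEq, ↓reduceIte] at hd
    have h1 : m * X3 - m * X4 - n0 * X3 + n0 * X4 + n0 * Y5 - Y5 = 0 := by
        linear_combination -e55 - e44
    have h2 : (1 : L) = 0 := mul_left_cancel₀ (mul_ne_zero hn01 hd) (by linear_combination (X3
        - X4) * e44 + (-X4 + X5) * h1)
    exact one_ne_zero h2
  have d1 := (hc _ _ _ _ _ _).1 c1
  simp only [tripDet, coordPoint, Matrix.cons_val, Fin.reduceEq, ↓reduceIte] at d1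
  have c2 : ProjCollinear β (0, 4) (0, 5) (1, 4) := by
    by_contra hd
    rw [hc] at hd
    simp only [tripDet, coordPoint, multinetRow16, Matrix.cons_val, Fin.reduceEq, ↓reduceIte] at hd
    have h3 : -m * X3 ^ 2 + m * X3 * X5 - 2 * X3 * Y4 + X3 * Y5 + X4 * Y4 - X4 * Y5 + X5 * Y3
        + Y3 ^ 2 - Y3 * Y4 - Y3 * Y5 + Y4 * Y5 = 0 := by linear_combination e33 + d1
    have h4 : -m * X3 ^ 2 + m * X4 ^ 2 - X3 * Y3 + X3 * Y5 + X4 * Y3 - X4 * Y4 + X5 * Y3 + Y3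
        ^ 2 - 2 * Y3 * Y4 = 0 := by linear_combination e42 - d1 + h3 + e24
    have h5 : m * X3 * Y4 - m * X3 * Y5 - m * X4 * Y3 + m * X5 * Y3 - Y3 * Y5 - Y4 * Y5 + Y5 ^
        2 = 0 := by linear_combination -e35 + d1 - h3 - e24 + h4
    have h6 : m * X3 ^ 2 + X3 * Y3 + 2 * X3 * Y4 - 2 * X3 * Y5 - X4 * Y3 - X4 * Y4 + X4 * Y5 -
        X5 * Y3 - 2 * Y3 ^ 2 + 2 * Y3 * Y4 - 2 * Y4 * Y5 + Y5 ^ 2 = 0 := by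
        linear_combination -e53 - h3 - e22 + e24 - h4 + h5
    have h7 : -m * X3 * Y5 + m * X5 * Y4 - 2 * X3 * Y4 + X3 * Y5 + X4 * Y4 - X4 * Y5 + X5 * Y3
        + Y3 ^ 2 - Y3 * Y4 - Y3 * Y5 - Y4 ^ 2 + 2 * Y4 * Y5 = 0 := by linear_combination e54 - e22
        + e24 - h4 + h5 - h6
    have h8 : m * X3 * X4 + m * X5 ^ 2 + X3 * Y3 - 2 * X3 * Y4 - X4 * Y3 - X4 * Y5 + 2 * X5 *
        Y3 - 2 * Y3 * Y4 - Y3 * Y5 - Y4 ^ 2 + 2 * Y4 * Y5 = 0 := by linear_combination e45 + d1 -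
        e22 - e24 + h4 - h5 + h6 + h7
    have h9 : m * X3 * X4 + X3 * Y3 + X3 * Y4 - X3 * Y5 - X4 * Y3 - X4 * Y4 - Y3 ^ 2 - Y3 * Y5
        - Y4 * Y5 + Y5 ^ 2 = 0 := mul_left_cancel₀ hm1 (by linear_combination (m * X3 - X3 + X4 +
        Y3) * e44 + (X4 - X5 + Y4) * e23 + (m - 1) * h3 + (m - 1) * h6)
    exact hd (by linear_combination (2 * m - 2) * e22 + (m - 1) * h4 + (m - 1) * h6 + (m - 1)
        * h8 + (-m + 1) * h9)
  have d2 := (hc _ _ _ _ _ _).1 c2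
  simp only [tripDet, coordPoint, multinetRow16, Matrix.cons_val, Fin.reduceEq, ↓reduceIte] at d2
  have c3 : ProjCollinear β (2, 1) (2, 3) (2, 4) := by
    by_contra hd
    rw [hc] at hd
    simp only [tripDet, coordPoint, Matrix.cons_val, Fin.reduceEq, ↓reduceIte] at hd
    have h10 : -m * X3 - m * X4 + m * X5 + n1 * X3 + n1 * X4 - n1 * X5 + n1 * Y3 + n1 * Y4 -
        n1 * Y5 - Y3 - Y4 + Y5 = 0 := by linear_combination e25 + e52
    have h11 : m * X3 - m * X4 - n0 * X3 + n0 * X4 + n0 * Y5 - Y5 = 0 := by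
        linear_combination -e44 - e55
    have h12 : m * n0 * X3 - m * X3 - m * Y3 + n0 * Y3 - n0 * Y5 + Y5 = 0 := by
        linear_combination e23 - h11
    have h13 : m * X4 * X5 - X3 * Y4 - X4 * Y5 + X5 * Y3 + X5 * Y5 - Y3 * Y4 = 0 := by
        linear_combination -e22 + d1
    have h14 : -m * X3 * X5 + m * X4 ^ 2 - X3 * Y3 + X4 * Y3 - X4 * Y5 + 2 * X5 * Y5 - Y3 * Y4
        + Y3 * Y5 - Y4 * Y5 = 0 := by linear_combination e24 + d1 + e42
    have h15 : -m * X3 * Y4 + m * X3 * Y5 + m * X4 * Y3 - m * X5 * Y3 + Y3 * Y5 + Y4 * Y5 - Y5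
        ^ 2 = 0 := by linear_combination e35 - e42
    have h16 : -m * X3 * Y4 + m * X3 * Y5 + m * X4 * Y5 + m * X5 ^ 2 - m * X5 * Y4 - X3 * Y4 -
        X4 * Y5 + X5 * Y3 - 2 * Y3 * Y4 + Y3 * Y5 + 2 * Y4 * Y5 - Y5 ^ 2 = 0 := by
        linear_combination e45 + h13 + h15
    have h17 : m * X3 ^ 2 - 2 * m * X3 * X5 - X3 * Y3 + X3 * Y4 + X4 * Y3 - X5 * Y3 + X5 * Y5
        + 2 * Y3 * Y5 - Y5 ^ 2 = 0 := by linear_combination e53 + d1 - h13 + e42 + h15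
    have h18 : -m ^ 2 * X3 ^ 2 + 2 * m ^ 2 * X3 * X5 + m * X3 ^ 2 - m * X3 * X5 + m * X3 * Y3
        - 2 * m * X3 * Y4 + m * X5 * Y4 - m * X5 * Y5 - 2 * m * Y3 * Y5 + m * Y5 ^ 2 + Y3 * Y5 -
        Y4 ^ 2 + 2 * Y4 * Y5 - Y5 ^ 2 = 0 := by linear_combination e54 - d1 + h13 - e42 + (-m + 1)
        * h17
    have h19 : -m * X3 ^ 2 + m * X3 * X5 - m * X5 ^ 2 + X3 * Y4 - X5 * Y3 + Y3 * Y4 - Y3 * Y5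
        + Y4 ^ 2 - 2 * Y4 * Y5 + Y5 ^ 2 = 0 := mul_left_cancel₀ hm1 (by linear_combination -d2 +
        (m - 1) * d1 + (-2 * m + 2) * h13 + (m - 1) * h14 + (-m + 1) * h17)
    have h20 : m * X3 ^ 2 - m * X3 * X5 - m * X3 * Y5 + m * X5 * Y4 - Y4 ^ 2 + Y4 * Y5 =
        0 := by linear_combination -h15 + m * h17 + h18
    have h21 : -m * n1 * X3 * Y5 + m * X3 * Y4 - m * X3 * Y5 - m * X5 * Y5 + m * Y4 * Y5 + n1
        * X3 * Y5 + n1 * X4 * X5 - n1 * X5 ^ 2 + n1 * X5 * Y4 - X3 * Y4 - X4 * Y5 + 2 * X5 * Y5 -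
        Y3 * Y5 - 2 * Y4 * Y5 + Y5 ^ 2 = 0 := by linear_combination (-X5 + Y4) * e52 + (-m + n1) *
        d1 + (X5 - Y4 + Y5) * h10 + h13 + n1 * h19 + n1 * h20
    have h22 : m * X5 ^ 2 - X3 * Y4 + X3 * Y5 + X5 * Y3 - X5 * Y5 - Y4 ^ 2 + 2 * Y4 * Y5 - Y5
        ^ 2 = 0 := mul_left_cancel₀ hm1 (by linear_combination (m * X3 + Y3 - Y5) * e55 + (-X3 +
        X5 - Y4 + Y5) * h12 + (-m + 1) * h19)
    have h23 : m * n1 * X3 * Y5 - m * X3 * Y4 + m * X5 * Y4 - m * Y4 * Y5 + n1 * X3 * Y4 - 2 *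
        n1 * X3 * Y5 - n1 * X5 * Y4 + n1 * X5 * Y5 + n1 * Y4 ^ 2 - 2 * n1 * Y4 * Y5 + n1 * Y5 ^ 2
        + X3 * Y5 - X5 * Y5 - Y4 ^ 2 + 3 * Y4 * Y5 - Y5 ^ 2 = 0 := by linear_combination -X5 * e52
        + X5 * h10 + h13 + h19 + h20 - h21 + (-n1 + 1) * h22
    have h24 : 2 * m ^ 2 * X3 * Y5 - 2 * m ^ 2 * X5 * Y4 - m * X3 * X5 - m * X3 * Y4 - 4 * m *
        X3 * Y5 + 4 * m * X5 * Y4 + m * X5 * Y5 + 2 * m * Y3 * Y5 + m * Y4 ^ 2 - m * Y4 * Y5 - m *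
        Y5 ^ 2 + n1 * X3 * X4 - n1 * X3 * X5 + 3 * n1 * X3 * Y4 - n1 * X3 * Y5 - 2 * n1 * X5 * Y4
        + n1 * X5 * Y5 + 2 * n1 * Y4 ^ 2 - 3 * n1 * Y4 * Y5 + n1 * Y5 ^ 2 - X3 * Y3 + 3 * X3 * Y5
        - X4 * Y5 - X5 * Y5 - 2 * Y3 * Y5 - 3 * Y4 ^ 2 + 3 * Y4 * Y5 = 0 := by
        linear_combination (-X3 - Y3 + Y4 + Y5) * e52 + (-m * X5 + X3 + Y5) * h10 + (-m + n1) *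
        h13 + e42 + h16 - h18 + (-m + 2 * n1 + 1) * h19 + (-2 * m + 2 * n1 + 2) * h20 + n1 * h22 +
        2 * h23
    have h25 : -2 * m ^ 2 * X3 * Y5 + 2 * m ^ 2 * X5 * Y4 + m * X3 * X5 - m * X3 * Y4 + 3 * m
        * X3 * Y5 - 2 * m * X5 * Y4 - m * X5 * Y5 - 2 * m * Y3 * Y5 - m * Y4 ^ 2 + m * Y4 * Y5 + m
        * Y5 ^ 2 + X3 * Y3 - X3 * Y4 - X3 * Y5 + X5 * Y4 + Y3 * Y5 + Y4 * Y5 - Y5 ^ 2 = 0 := by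
        linear_combination (X4 - X5 + Y4) * e52 + (-n1 + 1) * d1 + Y5 * h10 + (n1 - 1) * h13 + e42
        + h16 + (n1 + 1) * h19 + (n1 + 1) * h20 + h22 + h23 - h24
    have h26 : n1 * X3 - Y4 = 0 := mul_left_cancel₀ (mul_ne_zero z1 z2) (by
        linear_combination (X3 ^ 2 - X3 * X5 - X3 * Y5 + X5 * Y4) * e52 + (n1 * X5 + X3 - X5 - Y5)
        * h20)
    have h27 : -m * X3 * Y4 + m * X5 * Y4 - n1 * X5 * Y4 + n1 * X5 * Y5 + n1 * Y4 ^ 2 - 2 * n1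
        * Y4 * Y5 + n1 * Y5 ^ 2 + X3 * Y5 - X5 * Y5 + Y4 * Y5 - Y5 ^ 2 = 0 := by
        linear_combination h23 + (-m * Y5 - Y4 + 2 * Y5) * h26
    have h28 : m * X3 + n1 * X5 - n1 * Y4 + n1 * Y5 + Y3 - Y4 - Y5 = 0 := mul_left_cancel₀ z3
        (by linear_combination -d1 + h24 + h25 + (-X4 + X5 - 3 * Y4 + Y5) * h26 - 2 * h27)
    have h29 : -m * X3 + n1 * Y4 - n1 * Y5 + Y5 = 0 := mul_left_cancel₀ hm1 (by
        linear_combination n1 * e55 - h12 + (m - n0) * h26 + (-m + n0) * h28)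
    exact hd (by linear_combination h28 + h29)
  exact ⟨c1, c2, c3⟩

end Certificates

section MergedBlocks

variable {K L : Type*} [Field K] [Field L] [Algebra K L] {op : Fin 6 → Fin 6 → Fin 6}
  {β : Fin 3 × Fin 6 → Projectivization L (Fin 3 → L)}

theorem exists_mem_component_of_mem_superlineBlocks {B : Set (Fin 3 × Fin 6)}
    (hB : B ∈ superlineBlocks op fun _ => {0, 1}) (i : Fin 3) : ∃ x, (i, x) ∈ B := by
  rcases hB with rfl | ⟨x, y, -, rfl⟩
  · exact ⟨0, by simp [tripleUnion]⟩
  · fin_cases i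
    · exact ⟨x, by simp⟩
    · exact ⟨y, by simp⟩
    · exact ⟨op x y, by simp⟩

/-- A block with two points in a component is the superline. -/
theorem mem_of_mem_component {B : Set (Fin 3 × Fin 6)}
    (hB : B ∈ superlineBlocks op fun _ => {0, 1}) {i : Fin 3} {x y : Fin 6} (hxy : x ≠ y)
    (hx : (i, x) ∈ B) (hy : (i, y) ∈ B) : x = 0 ∨ x = 1 := by
  rcases hB with rfl | ⟨u, v, -, rfl⟩
  · simpa [tripleUnion] using hx
  · exfalso
    apply hxy
    simp only [Set.mem_insert_iff, Set.mem_singleton_iff, Prod.mk.injEq] at hx hy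
    rcases hx with ⟨rfl, rfl⟩ | ⟨rfl, rfl⟩ | ⟨rfl, rfl⟩ <;> (symm; simpa using hy)

/-- Three collinear points of a component give a merged block inside that component. -/
theorem IsWeakEmbedding.exists_isMergedBlock
    (hβ : IsWeakEmbedding K (superlineBlocks op fun _ => {0, 1}) β) {i : Fin 3} {a b c : Fin 6}
    {T : Finset (Fin 6)} (h : ProjCollinear β (i, a) (i, b) (i, c))
    (hT : ∀ x ∈ T, x ≠ a → x ≠ b → ProjCollinear β (i, a) (i, b) (i, x)) (hab : a ≠ b)
    (hgen : ∀ j, j ≠ i → ∀ x, generates op [(i, a), (i, b), (i, c), (j, x)] = true) :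
    ∃ S, IsMergedBlock (superlineBlocks op fun _ => {0, 1}) β S ∧ (∀ x ∈ T, (i, x) ∈ S) ∧
      S ⊆ {p | p.1 = i} := by
  have hne : β (i, a) ≠ β (i, b) := hβ.ne (by simpa using hab)
  obtain ⟨W, hW, ha, hb⟩ := exists_line hne
  have hmem := mem_linePreimage_iff_projCollinear hW hne ha hb
  have hsub : linePreimage β W ⊆ {p | p.1 = i} := by
    rintro ⟨j, x⟩ hp
    by_contra hj
    refine hβ.not_subset_line_of_generates (hgen j hj x) hW ?_
    simp only [List.mem_cons, List.not_mem_nil, or_false, forall_eq_or_imp, forall_eq]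
    exact ⟨ha, hb, (hmem _).2 h, hp⟩
  refine ⟨linePreimage β W, ⟨⟨_, ha, _, hb, by simpa using hab⟩, ?_, W, hW, rfl⟩, ?_, hsub⟩
  · intro hB
    obtain ⟨x, hx⟩ := exists_mem_component_of_mem_superlineBlocks hB (i + 1)
    have := hsub hx
    revert this
    fin_cases i <;> simp
  · intro x hx
    by_cases hxa : x = a
    · exact hxa ▸ ha
    by_cases hxb : x = b
    · exact hxb ▸ hb
    exact (hmem _).2 (hT x hx hxa hxb)

/-- A new long line with two points in each component. -/
theorem IsWeakEmbedding.isMergedBlock_tripleUnion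
    (hβ : IsWeakEmbedding K (superlineBlocks op fun _ => {0, 1}) β) {S : Fin 3 → Finset (Fin 6)}
    {i : Fin 3} {a b : Fin 6} {p : Fin 3 × Fin 6} (h : ProjCollinear β (i, a) (i, b) p)
    (hab : a ≠ b) (h0 : b ≠ 0) (h1 : b ≠ 1)
    (hgen : ∀ j x,
      if x ∈ S j then (closeMask op (maskOf [(i, a), (i, b), p])).testBit (pointIndex j x) = true
      else generates op [(i, a), (i, b), p, (j, x)] = true) :
    IsMergedBlock (superlineBlocks op fun _ => {0, 1}) β (tripleUnion S) := by
  have hne : β (i, a) ≠ β (i, b) := hβ.ne (by simpa using hab)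
  obtain ⟨W, hW, ha, hb⟩ := exists_line hne
  have hp := (mem_linePreimage_iff_projCollinear hW hne ha hb p).2 h
  have heq : tripleUnion S = linePreimage β W := by
    ext ⟨j, x⟩
    have hj := hgen j x
    change x ∈ S j ↔ _
    split_ifs at hj with hx
    · refine iff_of_true hx (hβ.maskSubset_closeMask hW ?_ j x hj)
      simp only [List.mem_cons, List.not_mem_nil, or_false, forall_eq_or_imp, forall_eq]
      exact ⟨ha, hb, hp⟩
    · refine iff_of_false hx fun hjx => hβ.not_subset_line_of_generates hj hW ?_
      simp only [List.mem_cons, List.not_mem_nil, or_false, forall_eq_or_imp, forall_eq]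
      exact ⟨ha, hb, hp, hjx⟩
  rw [heq]
  refine ⟨⟨_, ha, _, hb, by simpa using hab⟩, fun hB => ?_, W, hW, rfl⟩
  rcases mem_of_mem_component hB hab.symm hb ha with h | h
  · exact h0 h
  · exact h1 h

/-- The points of the row of `N` lie on merged blocks as listed there. -/
def TableRow.HasMergedBlocks (N : TableRow)
    (β : Fin 3 × Fin 6 → Projectivization L (Fin 3 → L)) : Prop :=
  (∀ S ∈ N.newLongLines, IsMergedBlock N.blocks β (tripleUnion S)) ∧
    ∀ i, ∀ T ∈ N.componentBlocks i, ∃ S, IsMergedBlock N.blocks β S ∧ (∀ x ∈ T, (i, x) ∈ S) ∧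
      S ⊆ {p | p.1 = i}

theorem IsWeakEmbedding.hasMergedBlocks_multinetRow3
    (hβ : IsWeakEmbedding K multinetRow3.blocks β) : multinetRow3.HasMergedBlocks β := by
  obtain ⟨h1, h2⟩ := hβ.projCollinear_multinetRow3
  refine ⟨fun S hS => ?_, fun i T hT => ?_⟩
  · simp [multinetRow3] at hS
    rcases hS with rfl | rfl
    · exact hβ.isMergedBlock_tripleUnion h1 (by decide) (by decide) (by decide) (by decide +kernel)
    · exact hβ.isMergedBlock_tripleUnion h2 (by decide) (by decide) (by decide) (by decide +kernel)
  · fin_cases i <;> simp [multinetRow3] at hT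

theorem IsWeakEmbedding.hasMergedBlocks_multinetRow4 [CharZero L]
    (hβ : IsWeakEmbedding K multinetRow4.blocks β) : multinetRow4.HasMergedBlocks β := by
  obtain ⟨h1, h2, h3, h4, h5, h6⟩ := hβ.projCollinear_multinetRow4
  refine ⟨by simp [multinetRow4], fun i T hT => ?_⟩
  fin_cases i <;> simp [multinetRow4] at hT
  · rcases hT with rfl | rfl
    · exact hβ.exists_isMergedBlock h3 (by simp [h3]) (by decide) (by decide +kernel)
    · exact hβ.exists_isMergedBlock h6 (by simp [h6]) (by decide) (by decide +kernel)
  · rcases hT with rfl | rfl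
    · exact hβ.exists_isMergedBlock h4 (by simp [h4]) (by decide) (by decide +kernel)
    · exact hβ.exists_isMergedBlock h5 (by simp [h5]) (by decide) (by decide +kernel)
  · rcases hT with rfl | rfl
    · exact hβ.exists_isMergedBlock h1 (by simp [h1]) (by decide) (by decide +kernel)
    · exact hβ.exists_isMergedBlock h2 (by simp [h2]) (by decide) (by decide +kernel)

theorem IsWeakEmbedding.hasMergedBlocks_multinetRow8 [CharZero L]
    (hβ : IsWeakEmbedding K multinetRow8.blocks β) : multinetRow8.HasMergedBlocks β := by
  obtain ⟨h1, h2, h3⟩ := hβ.projCollinear_multinetRow8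
  refine ⟨by simp [multinetRow8], fun i T hT => ?_⟩
  fin_cases i <;> simp [multinetRow8] at hT
  subst hT
  exact hβ.exists_isMergedBlock h2 (by simp [h2, h3, h1]) (by decide) (by decide +kernel)

theorem IsWeakEmbedding.hasMergedBlocks_multinetRow9 [CharZero L]
    (hβ : IsWeakEmbedding K multinetRow9.blocks β) : multinetRow9.HasMergedBlocks β := by
  obtain ⟨h1, h2⟩ := hβ.projCollinear_multinetRow9
  refine ⟨by simp [multinetRow9], fun i T hT => ?_⟩
  fin_cases i <;> simp [multinetRow9] at hT
  rcases hT with rfl | rfl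
  · exact hβ.exists_isMergedBlock h2 (by simp [h2]) (by decide) (by decide +kernel)
  · exact hβ.exists_isMergedBlock h1 (by simp [h1]) (by decide) (by decide +kernel)

theorem IsWeakEmbedding.hasMergedBlocks_multinetRow10 [CharZero L]
    (hβ : IsWeakEmbedding K multinetRow10.blocks β) : multinetRow10.HasMergedBlocks β := by
  obtain ⟨h1, h2, h3, h4⟩ := hβ.projCollinear_multinetRow10
  refine ⟨by simp [multinetRow10], fun i T hT => ?_⟩
  fin_cases i <;> simp [multinetRow10] at hT
  rcases hT with rfl | rfl | rfl | rfl
  · exact hβ.exists_isMergedBlock h1 (by simp [h1]) (by decide) (by decide +kernel)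
  · exact hβ.exists_isMergedBlock h2 (by simp [h2]) (by decide) (by decide +kernel)
  · exact hβ.exists_isMergedBlock h4 (by simp [h4]) (by decide) (by decide +kernel)
  · exact hβ.exists_isMergedBlock h3 (by simp [h3]) (by decide) (by decide +kernel)

theorem IsWeakEmbedding.hasMergedBlocks_multinetRow11 [CharZero L]
    (hβ : IsWeakEmbedding K multinetRow11.blocks β) : multinetRow11.HasMergedBlocks β := by
  have h1 := hβ.projCollinear_multinetRow11
  refine ⟨by simp [multinetRow11], fun i T hT => ?_⟩
  fin_cases i <;> simp [multinetRow11] at hT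
  subst hT
  exact hβ.exists_isMergedBlock h1 (by simp [h1]) (by decide) (by decide +kernel)

theorem hasMergedBlocks_multinetRow13 : multinetRow13.HasMergedBlocks β := by
  refine ⟨by simp [multinetRow13], fun i T hT => ?_⟩
  fin_cases i <;> simp [multinetRow13] at hT

theorem IsWeakEmbedding.hasMergedBlocks_multinetRow14 [CharZero L]
    (hβ : IsWeakEmbedding K multinetRow14.blocks β) : multinetRow14.HasMergedBlocks β := by
  obtain ⟨h1, h2, h3, h4, h5, h6, h7⟩ := hβ.projCollinear_multinetRow14
  refine ⟨fun S hS => ?_, fun i T hT => ?_⟩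
  · simp [multinetRow14] at hS
    subst hS
    exact hβ.isMergedBlock_tripleUnion h3 (by decide) (by decide) (by decide) (by decide +kernel)
  · fin_cases i <;> simp [multinetRow14] at hT
    · rcases hT with rfl | rfl
      · exact hβ.exists_isMergedBlock h2 (by simp [h2]) (by decide) (by decide +kernel)
      · exact hβ.exists_isMergedBlock h1 (by simp [h1]) (by decide) (by decide +kernel)
    · rcases hT with rfl | rfl
      · exact hβ.exists_isMergedBlock h6 (by simp [h6]) (by decide) (by decide +kernel)
      · exact hβ.exists_isMergedBlock h5 (by simp [h5]) (by decide) (by decide +kernel)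
    · rcases hT with rfl | rfl
      · exact hβ.exists_isMergedBlock h4 (by simp [h4]) (by decide) (by decide +kernel)
      · exact hβ.exists_isMergedBlock h7 (by simp [h7]) (by decide) (by decide +kernel)

theorem IsWeakEmbedding.hasMergedBlocks_multinetRow15
    (hβ : IsWeakEmbedding K multinetRow15.blocks β) : multinetRow15.HasMergedBlocks β := by
  obtain ⟨h1, h2⟩ := hβ.projCollinear_multinetRow15
  refine ⟨by simp [multinetRow15], fun i T hT => ?_⟩
  fin_cases i <;> simp [multinetRow15] at hT
  rcases hT with rfl | rfl
  · exact hβ.exists_isMergedBlock h1 (by simp [h1]) (by decide) (by decide +kernel)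
  · exact hβ.exists_isMergedBlock h2 (by simp [h2]) (by decide) (by decide +kernel)

theorem IsWeakEmbedding.hasMergedBlocks_multinetRow16 [CharZero L]
    (hβ : IsWeakEmbedding K multinetRow16.blocks β) : multinetRow16.HasMergedBlocks β := by
  obtain ⟨h1, h2, h3⟩ := hβ.projCollinear_multinetRow16
  refine ⟨fun S hS => ?_, fun i T hT => ?_⟩
  · simp [multinetRow16] at hS
    subst hS
    exact hβ.isMergedBlock_tripleUnion h2 (by decide) (by decide) (by decide) (by decide +kernel)
  · fin_cases i <;> simp [multinetRow16] at hT
    rcases hT with rfl | rfl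
    · exact hβ.exists_isMergedBlock h3 (by simp [h3]) (by decide) (by decide +kernel)
    · exact hβ.exists_isMergedBlock h1 (by simp [h1]) (by decide) (by decide +kernel)

theorem IsWeakEmbedding.hasMergedBlocks [CharZero L] {N : TableRow} (hN : N ∈ mergedBlockTable)
    (hβ : IsWeakEmbedding K N.blocks β) : N.HasMergedBlocks β := by
  simp only [mergedBlockTable, List.mem_cons, List.not_mem_nil, or_false] at hN
  rcases hN with rfl | rfl | rfl | rfl | rfl | rfl | rfl | rfl | rfl | rfl
  · exact hβ.hasMergedBlocks_multinetRow3
  · exact hβ.hasMergedBlocks_multinetRow4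
  · exact hβ.hasMergedBlocks_multinetRow8
  · exact hβ.hasMergedBlocks_multinetRow9
  · exact hβ.hasMergedBlocks_multinetRow10
  · exact hβ.hasMergedBlocks_multinetRow11
  · exact hasMergedBlocks_multinetRow13
  · exact hβ.hasMergedBlocks_multinetRow14
  · exact hβ.hasMergedBlocks_multinetRow15
  · exact hβ.hasMergedBlocks_multinetRow16

theorem card_of_mem_newLongLines {N : TableRow} (hN : N ∈ mergedBlockTable)
    {S : Fin 3 → Finset (Fin 6)} (hS : S ∈ N.newLongLines) (i : Fin 3) : (S i).card = 2 := by
  simp only [mergedBlockTable, List.mem_cons, List.not_mem_nil, or_false] at hN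
  rcases hN with rfl | rfl | rfl | rfl | rfl | rfl | rfl | rfl | rfl | rfl
  · simp only [multinetRow3, List.mem_cons, List.not_mem_nil, or_false] at hS
    rcases hS with rfl | rfl <;> revert i <;> decide
  on_goal 7 =>
    simp only [multinetRow14, List.mem_cons, List.not_mem_nil, or_false] at hS
    subst hS
    revert i
    decide
  on_goal 8 =>
    simp only [multinetRow16, List.mem_cons, List.not_mem_nil, or_false] at hS
    subst hS
    revert i
    decide
  all_goals exact absurd hS List.not_mem_nil

end MergedBlocks

section Isomorphisms

variable {P P' P'' : Type*} {A : Set (Set P)} {B : Set (Set P')} {C : Set (Set P'')}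

def IncidenceIso.symm (φ : IncidenceIso A B) : IncidenceIso B A where
  toEquiv := φ.toEquiv.symm
  mem_iff S := by
    rw [φ.mem_iff, Equiv.image_symm_image]

def IncidenceIso.trans (φ : IncidenceIso A B) (ψ : IncidenceIso B C) : IncidenceIso A C where
  toEquiv := φ.toEquiv.trans ψ.toEquiv
  mem_iff S := by
    rw [φ.mem_iff, ψ.mem_iff, Set.image_image]
    rfl

variable {K L : Type*} [Field K] [Field L] [Algebra K L]
  {β : P' → Projectivization L (Fin 3 → L)}

theorem IsWeakEmbedding.comp (hβ : IsWeakEmbedding K B β) (φ : IncidenceIso A B) :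
    IsWeakEmbedding K A (β ∘ φ.toEquiv) where
  injective := hβ.injective.comp φ.toEquiv.injective
  spans := by
    rw [← hβ.spans]
    exact φ.toEquiv.iSup_comp (g := fun p => (β p).submodule)
  collinear := by
    rintro p q r hpq hpr hqr ⟨S, hS, hp, hq, hr⟩
    have h {a b : P} (hab : a ≠ b) := φ.toEquiv.injective.ne hab
    exact hβ.collinear _ _ _ (h hpq) (h hpr) (h hqr) ⟨_, (φ.mem_iff S).1 hS,
      Set.mem_image_of_mem _ hp, Set.mem_image_of_mem _ hq, Set.mem_image_of_mem _ hr⟩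

theorem IsMergedBlock.image {φ : IncidenceIso A B} {S : Set P}
    (h : IsMergedBlock A (β ∘ φ.toEquiv) S) : IsMergedBlock B β (φ.toEquiv '' S) := by
  obtain ⟨hS, hA, W, hW, rfl⟩ := h
  refine ⟨hS.image φ.toEquiv.injective, fun hB => hA ((φ.mem_iff _).2 hB), W, hW, ?_⟩
  exact Set.image_preimage_eq (linePreimage β W) φ.toEquiv.surjective

end Isomorphisms

namespace LightDualMultinet

variable {Q P : Type*} {op : Q → Q → Q} (M : LightDualMultinet op P)

theorem exists_mem_component (p : P) : ∃ i, p ∈ M.component i := by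
  have : p ∈ ⋃ i, M.component i := by
    rw [M.component_cover]
    trivial
  simpa using this

theorem exists_label_eq {i : Fin 3} {p : P} (hp : p ∈ M.component i) : ∃ x, M.label i x = p := by
  obtain ⟨x, -, hx⟩ := (M.label_bijOn i).surjOn hp
  exact ⟨x, hx⟩

theorem label_mem (i : Fin 3) (x : Q) : M.label i x ∈ M.component i :=
  (M.label_bijOn i).mapsTo (Set.mem_univ x)

theorem label_injective (i : Fin 3) : Function.Injective (M.label i) :=
  Set.injOn_univ.1 (M.label_bijOn i).injOn

theorem eq_of_mem_component {i j : Fin 3} {p : P} (hi : p ∈ M.component i)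
    (hj : p ∈ M.component j) : i = j := by
  by_contra h
  exact Set.disjoint_left.1 (M.component_disjoint i j h) hi hj

/-- Two points of different components lie on a common block. -/
theorem exists_block_of_ne (hop : IsQuasigroup op) {i j : Fin 3} (hij : i ≠ j) {p q : P}
    (hp : p ∈ M.component i) (hq : q ∈ M.component j) : ∃ B ∈ M.blocks, p ∈ B ∧ q ∈ B := by
  wlog hlt : i < j generalizing i j p q
  · obtain ⟨B, hB, h1, h2⟩ := this hij.symm hq hp (lt_of_le_of_ne (not_lt.1 hlt) hij.symm)
    exact ⟨B, hB, h2, h1⟩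
  obtain ⟨x, rfl⟩ := M.exists_label_eq hp
  obtain ⟨y, rfl⟩ := M.exists_label_eq hq
  obtain ⟨rfl, rfl⟩ | ⟨rfl, rfl⟩ | ⟨rfl, rfl⟩ : i = 0 ∧ j = 1 ∨ i = 0 ∧ j = 2 ∨ i = 1 ∧ j = 2 := by
    omega
  · obtain ⟨B, hB, h1, h2, -⟩ := M.exists_block x y
    exact ⟨B, hB, h1, h2⟩
  · obtain ⟨z, hz, -⟩ := hop.left_div x y
    obtain ⟨B, hB, h1, -, h2⟩ := M.exists_block x z
    exact ⟨B, hB, h1, hz ▸ h2⟩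
  · obtain ⟨z, hz, -⟩ := hop.right_div y x
    obtain ⟨B, hB, -, h1, h2⟩ := M.exists_block z x
    exact ⟨B, hB, h1, hz ▸ h2⟩

/-- An isomorphism from the multinet of a loop permutes the components. -/
theorem exists_component_perm (hop : IsQuasigroup op) [Nonempty Q] {op' : Fin 6 → Fin 6 → Fin 6}
    (φ : IncidenceIso (superlineBlocks op' fun _ => {0, 1}) M.blocks) :
    ∃ σ : Equiv.Perm (Fin 3), ∀ i x, φ.toEquiv (i, x) ∈ M.component (σ i) := by
  choose c hc using M.exists_mem_component
  have hsame : ∀ i x y, x ≠ 0 → x ≠ 1 → c (φ.toEquiv (i, x)) = c (φ.toEquiv (i, y)) := by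
    intro i x y h0 h1
    by_cases hxy : x = y
    · rw [hxy]
    by_contra hne
    obtain ⟨B, hB, hx, hy⟩ := M.exists_block_of_ne hop hne (hc _) (hc _)
    have hB' := (φ.symm.mem_iff B).1 hB
    have hx' : (i, x) ∈ φ.symm.toEquiv '' B := ⟨_, hx, φ.toEquiv.symm_apply_apply _⟩
    have hy' : (i, y) ∈ φ.symm.toEquiv '' B := ⟨_, hy, φ.toEquiv.symm_apply_apply _⟩
    rcases mem_of_mem_component hB' hxy hx' hy' with h | h
    · exact h0 h
    · exact h1 h
  have hτ : ∀ i x, φ.toEquiv (i, x) ∈ M.component (c (φ.toEquiv (i, 2))) := by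
    intro i x
    rw [hsame i 2 x (by decide) (by decide)]
    exact hc _
  have hsurj : Function.Surjective fun i => c (φ.toEquiv (i, 2)) := by
    intro j
    obtain ⟨a⟩ := ‹Nonempty Q›
    obtain ⟨⟨i, x⟩, hix⟩ := φ.toEquiv.surjective (M.label j a)
    refine ⟨i, M.eq_of_mem_component (hτ i x) ?_⟩
    rw [hix]
    exact M.label_mem j a
  exact ⟨Equiv.ofBijective _ (Finite.surjective_iff_bijective.1 hsurj), hτ⟩

theorem hasLength_image_tripleUnion (hop : IsQuasigroup op) [Nonempty Q]
    {op' : Fin 6 → Fin 6 → Fin 6}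
    (φ : IncidenceIso (superlineBlocks op' fun _ => {0, 1}) M.blocks) {S : Fin 3 → Finset (Fin 6)}
    {r : ℕ} (hS : ∀ i, (S i).card = r) : M.HasLength (φ.toEquiv '' tripleUnion S) r := by
  obtain ⟨σ, hσ⟩ := M.exists_component_perm hop φ
  intro i
  rw [← Set.ncard_image_of_injective _ (M.label_injective i)]
  have h : M.label i '' {x | M.label i x ∈ φ.toEquiv '' tripleUnion S} =
      (fun x => φ.toEquiv (σ.symm i, x)) '' (S (σ.symm i) : Set (Fin 6)) := by
    ext p
    constructor
    · rintro ⟨x, ⟨⟨j, y⟩, hy, hxy⟩, rfl⟩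
      have hj : σ j = i := M.eq_of_mem_component (hσ j y) (by rw [hxy]; exact M.label_mem i x)
      subst hj
      refine ⟨y, ?_, ?_⟩
      · rw [Equiv.symm_apply_apply]
        exact hy
      · simp only [Equiv.symm_apply_apply]
        exact hxy
    · rintro ⟨y, hy, rfl⟩
      obtain ⟨x, hx⟩ := M.exists_label_eq (hσ (σ.symm i) y)
      rw [Equiv.apply_symm_apply] at hx
      exact ⟨x, by simp only [Set.mem_ofPred_eq, hx]; exact ⟨_, hy, rfl⟩, hx⟩
  rw [h, Set.ncard_image_of_injective, Set.ncard_coe_finset, hS]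
  intro x y hxy
  simpa using φ.toEquiv.injective hxy

end LightDualMultinet

section Loops

/-- `op` is the multiplication of a loop on `{0, …, 5}` with unit `0` and subloop `{0, 1}`. -/
structure IsLoopWithSubloop (op : Fin 6 → Fin 6 → Fin 6) : Prop where
  zero_op : ∀ y, op 0 y = y
  op_zero : ∀ x, op x 0 = x
  one_op_one : op 1 1 = 0
  left_injective : ∀ x, Function.Injective (op x)
  right_injective : ∀ y, Function.Injective fun x => op x y

theorem fin_lt_two_iff {x : Fin 6} : x < 2 ↔ x = 0 ∨ x = 1 := by
  revert x
  decide

theorem fin_mem_pair_iff {x : Fin 6} : x ∈ ({0, 1} : Finset (Fin 6)) ↔ x < 2 := by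
  revert x
  decide

/-- The block of the points with labels `t 0`, `t 1`, `t 2` in the three components. -/
def blockOf (t : Fin 3 → Fin 6) : Set (Fin 3 × Fin 6) := Set.range fun i => (i, t i)

theorem mem_superlineBlocks {op : Fin 6 → Fin 6 → Fin 6} {B : Set (Fin 3 × Fin 6)} :
    B ∈ superlineBlocks op (fun _ => {0, 1}) ↔ B = tripleUnion (fun _ => {0, 1}) ∨
      ∃ x y, ¬ (x < 2 ∧ y < 2) ∧ B = blockOf ![x, y, op x y] := by
  have h : ∀ x y, blockOf ![x, y, op x y] = {(0, x), (1, y), (2, op x y)} := by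
    intro x y
    ext p
    simp [blockOf, Fin.exists_fin_succ, eq_comm]
  simp only [superlineBlocks, Set.mem_ofPred_eq, fin_mem_pair_iff, h]

variable {op op' : Fin 6 → Fin 6 → Fin 6}

theorem IsLoopWithSubloop.op_lt_two (h : IsLoopWithSubloop op) {x y : Fin 6} (hx : x < 2)
    (hy : y < 2) : op x y < 2 := by
  rw [fin_lt_two_iff] at hx hy
  rcases hx with rfl | rfl <;> rcases hy with rfl | rfl <;>
    simp [h.zero_op, h.op_zero, h.one_op_one]

theorem IsLoopWithSubloop.lt_two_of_left (h : IsLoopWithSubloop op) {x y : Fin 6} (hx : x < 2)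
    (hz : op x y < 2) : y < 2 := by
  rw [fin_lt_two_iff] at hx
  rcases hx with rfl | rfl
  · rwa [h.zero_op] at hz
  · rw [fin_lt_two_iff] at hz ⊢
    rcases hz with hz | hz
    · exact Or.inr (h.left_injective 1 (hz.trans h.one_op_one.symm))
    · exact Or.inl (h.left_injective 1 (hz.trans (h.op_zero 1).symm))

theorem IsLoopWithSubloop.lt_two_of_right (h : IsLoopWithSubloop op) {x y : Fin 6} (hy : y < 2)
    (hz : op x y < 2) : x < 2 := by
  rw [fin_lt_two_iff] at hy
  rcases hy with rfl | rfl
  · rwa [h.op_zero] at hz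
  · rw [fin_lt_two_iff] at hz ⊢
    rcases hz with hz | hz
    · exact Or.inr (h.right_injective 1 (hz.trans h.one_op_one.symm))
    · exact Or.inl (h.right_injective 1 (hz.trans (h.zero_op 1).symm))

theorem IsLoopWithSubloop.lt_two_of_ne (h : IsLoopWithSubloop op) {x y : Fin 6} {i j : Fin 3}
    (hij : i ≠ j) (hi : ![x, y, op x y] i < 2) (hj : ![x, y, op x y] j < 2) : x < 2 ∧ y < 2 := by
  wlog hlt : i < j generalizing i j
  · exact this hij.symm hj hi (lt_of_le_of_ne (not_lt.1 hlt) hij.symm)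
  obtain ⟨rfl, rfl⟩ | ⟨rfl, rfl⟩ | ⟨rfl, rfl⟩ : i = 0 ∧ j = 1 ∨ i = 0 ∧ j = 2 ∨ i = 1 ∧ j = 2 := by
    omega
  · exact ⟨hi, hj⟩
  · exact ⟨hi, h.lt_two_of_left hi hj⟩
  · exact ⟨h.lt_two_of_right hi hj, hi⟩

theorem IsLoopWithSubloop.exists_of_ne (h : IsLoopWithSubloop op) {i j : Fin 3}
    (hij : i ≠ j) (a b : Fin 6) : ∃ x y, ![x, y, op x y] i = a ∧ ![x, y, op x y] j = b := by
  wlog hlt : i < j generalizing i j a b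
  · obtain ⟨x, y, h1, h2⟩ := this hij.symm b a (lt_of_le_of_ne (not_lt.1 hlt) hij.symm)
    exact ⟨x, y, h2, h1⟩
  obtain ⟨rfl, rfl⟩ | ⟨rfl, rfl⟩ | ⟨rfl, rfl⟩ : i = 0 ∧ j = 1 ∨ i = 0 ∧ j = 2 ∨ i = 1 ∧ j = 2 := by
    omega
  · exact ⟨a, b, rfl, rfl⟩
  · obtain ⟨y, hy⟩ := Finite.surjective_of_injective (h.left_injective a) b
    exact ⟨a, y, rfl, hy⟩
  · obtain ⟨x, hx⟩ := Finite.surjective_of_injective (h.right_injective a) b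
    exact ⟨x, a, rfl, hx⟩

/-- The bijection of the points which maps the component `σ j` to the component `j` by `g j`. -/
def pointEquiv (σ : Equiv.Perm (Fin 3)) (g : Fin 3 → Equiv.Perm (Fin 6)) :
    Fin 3 × Fin 6 ≃ Fin 3 × Fin 6 :=
  ((Equiv.prodShear σ fun j => (g j).symm)).symm

theorem image_pointEquiv_blockOf (σ : Equiv.Perm (Fin 3)) (g : Fin 3 → Equiv.Perm (Fin 6))
    (t : Fin 3 → Fin 6) :
    pointEquiv σ g '' blockOf t = blockOf fun j => g j (t (σ j)) := by
  have h : ∀ j, pointEquiv σ g (σ j, t (σ j)) = (j, g j (t (σ j))) := by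
    intro j
    rw [pointEquiv, Equiv.symm_apply_eq]
    simp
  rw [blockOf, blockOf, ← Set.range_comp]
  rw [← σ.surjective.range_comp]
  exact congrArg Set.range (funext h)

theorem image_pointEquiv_superline (σ : Equiv.Perm (Fin 3)) {g : Fin 3 → Equiv.Perm (Fin 6)}
    (hg : ∀ i x, g i x < 2 ↔ x < 2) :
    pointEquiv σ g '' (tripleUnion fun _ => {0, 1}) = tripleUnion fun _ => {0, 1} := by
  ext ⟨j, x⟩
  rw [Equiv.image_eq_preimage_symm]
  change (g j).symm x ∈ ({0, 1} : Finset (Fin 6)) ↔ x ∈ ({0, 1} : Finset (Fin 6))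
  rw [fin_mem_pair_iff, fin_mem_pair_iff, ← hg j, Equiv.apply_symm_apply]

/-- A paratopism which maps the subsquare to the subsquare gives an isomorphism of multinets. -/
theorem IsLoopWithSubloop.nonempty_incidenceIso (h : IsLoopWithSubloop op)
    (σ : Equiv.Perm (Fin 3)) (g : Fin 3 → Equiv.Perm (Fin 6)) (hg : ∀ i x, g i x < 2 ↔ x < 2)
    (hop : ∀ x y, ¬ (x < 2 ∧ y < 2) →
      op' (g 0 (![x, y, op x y] (σ 0))) (g 1 (![x, y, op x y] (σ 1))) =
        g 2 (![x, y, op x y] (σ 2))) :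
    Nonempty (IncidenceIso (superlineBlocks op fun _ => {0, 1})
      (superlineBlocks op' fun _ => {0, 1})) := by
  have hne : σ 0 ≠ σ 1 := σ.injective.ne (by decide)
  have himage : ∀ x y, ¬ (x < 2 ∧ y < 2) → pointEquiv σ g '' blockOf ![x, y, op x y] =
      blockOf ![g 0 (![x, y, op x y] (σ 0)), g 1 (![x, y, op x y] (σ 1)),
        op' (g 0 (![x, y, op x y] (σ 0))) (g 1 (![x, y, op x y] (σ 1)))] := by
    intro x y hxy
    rw [image_pointEquiv_blockOf, hop x y hxy]
    congr 1
    funext j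
    fin_cases j <;> rfl
  have hinj : Function.Injective fun S : Set (Fin 3 × Fin 6) => pointEquiv σ g '' S :=
    Set.image_injective.2 (pointEquiv σ g).injective
  refine ⟨⟨pointEquiv σ g, fun S => ?_⟩⟩
  rw [mem_superlineBlocks, mem_superlineBlocks]
  constructor
  · rintro (rfl | ⟨x, y, hxy, rfl⟩)
    · exact Or.inl (image_pointEquiv_superline σ hg)
    · refine Or.inr ⟨_, _, ?_, himage x y hxy⟩
      rw [hg, hg]
      exact fun hlt => hxy (h.lt_two_of_ne hne hlt.1 hlt.2)
  · rintro (hS | ⟨u, v, huv, hS⟩)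
    · exact Or.inl (hinj (hS.trans (image_pointEquiv_superline σ hg).symm))
    · obtain ⟨x, y, hx, hy⟩ := h.exists_of_ne hne ((g 0).symm u) ((g 1).symm v)
      have hxy : ¬ (x < 2 ∧ y < 2) := by
        rintro ⟨h1, h2⟩
        have hall : ∀ i, ![x, y, op x y] i < 2 := by
          intro i
          fin_cases i
          · exact h1
          · exact h2
          · exact h.op_lt_two h1 h2
        have h3 := hall (σ 0)
        have h4 := hall (σ 1)
        rw [hx, ← hg 0, Equiv.apply_symm_apply] at h3
        rw [hy, ← hg 1, Equiv.apply_symm_apply] at h4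
        exact huv ⟨h3, h4⟩
      refine Or.inr ⟨x, y, hxy, hinj (hS.trans ?_)⟩
      have := himage x y hxy
      simp only [hx, hy, Equiv.apply_symm_apply] at this
      exact this.symm

end Loops

namespace LightDualMultinet

variable {Q P : Type*} {op : Q → Q → Q} (M : LightDualMultinet op P)

/-- A block of length 1 is determined by its points in the first two components. -/
theorem mem_iff_of_hasLength_one {B : Set P} (hB : B ∈ M.blocks) (h : M.HasLength B 1) {u v : Q}
    (hu : M.label 0 u ∈ B) (hv : M.label 1 v ∈ B) (i : Fin 3) (w : Q) :
    M.label i w ∈ B ↔ w = ![u, v, op u v] i := by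
  obtain ⟨S, hS, h0, h1, h2⟩ := M.exists_block u v
  have hne : M.label 0 u ≠ M.label 1 v := fun e =>
    absurd (M.eq_of_mem_component (M.label_mem 0 u) (e ▸ M.label_mem 1 v)) (by decide)
  obtain rfl := M.eq_of_mem _ _ hne S hS B hB h0 h1 hu hv
  obtain ⟨a, ha⟩ := Set.ncard_eq_one.1 (h i)
  have hmem : ∀ w, M.label i w ∈ S ↔ w = a := fun w => by
    rw [← Set.mem_singleton_iff, ← ha]
    rfl
  have : M.label i (![u, v, op u v] i) ∈ S := by
    fin_cases i
    · exact h0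
    · exact h1
    · exact h2
  rw [hmem, (hmem _).1 this]

/-- A labeling of the points by `{0, …, 5}` which identifies `M` with the multinet of a loop. -/
theorem nonempty_incidenceIso {B₀ : Set P} (hB₀ : B₀ ∈ M.blocks)
    (h1 : ∀ B ∈ M.blocks, B ≠ B₀ → M.HasLength B 1) {op' : Fin 6 → Fin 6 → Fin 6}
    (e : Fin 3 → Fin 6 ≃ Q) (he : ∀ i x, M.label i (e i x) ∈ B₀ ↔ x < 2)
    (hop' : ∀ x y, e 2 (op' x y) = op (e 0 x) (e 1 y)) :
    Nonempty (IncidenceIso (superlineBlocks op' fun _ => {0, 1}) M.blocks) := by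
  have hbij : Function.Bijective fun p : Fin 3 × Fin 6 => M.label p.1 (e p.1 p.2) := by
    constructor
    · rintro ⟨i, x⟩ ⟨j, y⟩ hxy
      dsimp only at hxy
      obtain rfl := M.eq_of_mem_component (M.label_mem i (e i x)) (hxy ▸ M.label_mem j (e j y))
      rw [(e i).injective (M.label_injective i hxy)]
    · intro p
      obtain ⟨i, hi⟩ := M.exists_mem_component p
      obtain ⟨u, rfl⟩ := M.exists_label_eq hi
      exact ⟨(i, (e i).symm u), by simp⟩
  let ψ := Equiv.ofBijective _ hbij
  have hψ : ∀ i x, ψ (i, x) = M.label i (e i x) := fun i x => rfl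
  have himage : ∀ (S : Set (Fin 3 × Fin 6)) (B : Set P),
      ψ '' S = B ↔ ∀ i x, (i, x) ∈ S ↔ M.label i (e i x) ∈ B := by
    intro S B
    constructor
    · rintro rfl i x
      exact (ψ.injective.mem_set_image (s := S) (a := (i, x))).symm
    · intro h
      ext p
      obtain ⟨⟨i, x⟩, rfl⟩ := ψ.surjective p
      rw [ψ.injective.mem_set_image, h i x]
      rfl
  have hline : ψ '' (tripleUnion fun _ => {0, 1}) = B₀ := by
    rw [himage]
    intro i x
    rw [he, ← fin_mem_pair_iff]
    rfl
  have hcell : ∀ B ∈ M.blocks, B ≠ B₀ → ∀ x y, M.label 0 (e 0 x) ∈ B → M.label 1 (e 1 y) ∈ B →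
      ψ '' blockOf ![x, y, op' x y] = B := by
    intro B hB hne x y hx hy
    rw [himage]
    intro i z
    rw [M.mem_iff_of_hasLength_one hB (h1 B hB hne) hx hy, ← hop']
    have hz : (i, z) ∈ blockOf ![x, y, op' x y] ↔ z = ![x, y, op' x y] i := by
      simp [blockOf, eq_comm]
    rw [hz]
    fin_cases i
    · exact (e 0).injective.eq_iff.symm
    · exact (e 1).injective.eq_iff.symm
    · exact (e 2).injective.eq_iff.symm
  have hinj : Function.Injective fun S : Set (Fin 3 × Fin 6) => ψ '' S :=
    Set.image_injective.2 ψ.injective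
  refine ⟨⟨ψ, fun S => ?_⟩⟩
  rw [mem_superlineBlocks]
  constructor
  · rintro (rfl | ⟨x, y, hxy, rfl⟩)
    · rwa [hline]
    · obtain ⟨B, hB, hx, hy, -⟩ := M.exists_block (e 0 x) (e 1 y)
      rw [hcell B hB ?_ x y hx hy]
      · exact hB
      · rintro rfl
        exact hxy ⟨(he 0 x).1 hx, (he 1 y).1 hy⟩
  · intro hS
    by_cases hne : ψ '' S = B₀
    · exact Or.inl (hinj (hne.trans hline.symm))
    · obtain ⟨u, hu⟩ := Set.ncard_eq_one.1 (h1 _ hS hne 0)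
      obtain ⟨v, hv⟩ := Set.ncard_eq_one.1 (h1 _ hS hne 1)
      have hu' : M.label 0 u ∈ ψ '' S := hu.ge rfl
      have hv' : M.label 1 v ∈ ψ '' S := hv.ge rfl
      obtain ⟨x, rfl⟩ := (e 0).surjective u
      obtain ⟨y, rfl⟩ := (e 1).surjective v
      refine Or.inr ⟨x, y, ?_, hinj (hcell _ hS hne x y hu' hv').symm⟩
      rintro ⟨hx, hy⟩
      refine hne (M.eq_of_mem _ _ ?_ _ hS _ hB₀ hu' hv' ((he 0 x).2 hx) ((he 1 y).2 hy))
      exact fun e' => absurd (M.eq_of_mem_component (M.label_mem 0 _) (e' ▸ M.label_mem 1 _))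
        (by decide)

end LightDualMultinet

namespace LightDualMultinet

variable {Q P : Type*} {op : Q → Q → Q} (M : LightDualMultinet op P)

/-- The multinets with a unique superline of length 2 come from loops with a subloop of order 2. -/
theorem exists_isLoopWithSubloop (hop : IsQuasigroup op) (hQ : Nat.card Q = 6)
    (hM : M.HasUniqueSuperline 2) : ∃ op' : Fin 6 → Fin 6 → Fin 6, IsLoopWithSubloop op' ∧
      Nonempty (IncidenceIso (superlineBlocks op' fun _ => {0, 1}) M.blocks) := by
  classical
  obtain ⟨B, hB, hB2, hB1⟩ := hM
  obtain ⟨x₀, x₁, hx, hX⟩ := Set.ncard_eq_two.1 (hB2 0)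
  obtain ⟨y₀, y₁, hy, hY⟩ := Set.ncard_eq_two.1 (hB2 1)
  obtain ⟨z₀, z₁, hz, hZ⟩ := Set.ncard_eq_two.1 (hB2 2)
  have memX : ∀ x, M.label 0 x ∈ B ↔ x = x₀ ∨ x = x₁ := fun x => Set.ext_iff.1 hX x
  have memY : ∀ y, M.label 1 y ∈ B ↔ y = y₀ ∨ y = y₁ := fun y => Set.ext_iff.1 hY y
  have memZ : ∀ z, M.label 2 z ∈ B ↔ z = z₀ ∨ z = z₁ := fun z => Set.ext_iff.1 hZ z
  have left_inj : ∀ x, Function.Injective (op x) := fun x y y' h =>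
    (hop.left_div x (op x y')).unique h rfl
  have right_inj : ∀ y, Function.Injective fun x => op x y := fun y x x' h =>
    (hop.right_div (op x' y) y).unique h rfl
  have hmul : ∀ x y, M.label 0 x ∈ B → M.label 1 y ∈ B → M.label 2 (op x y) ∈ B := by
    intro x y h0 h1
    obtain ⟨S, hS, k0, k1, k2⟩ := M.exists_block x y
    have hne : M.label 0 x ≠ M.label 1 y := fun e =>
      absurd (M.eq_of_mem_component (M.label_mem 0 x) (e ▸ M.label_mem 1 y)) (by decide)
    rwa [M.eq_of_mem _ _ hne S hS B hB k0 k1 h0 h1] at k2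
  have h00 := (memZ _).1 (hmul x₀ y₀ ((memX _).2 (Or.inl rfl)) ((memY _).2 (Or.inl rfl)))
  have h01 := (memZ _).1 (hmul x₀ y₁ ((memX _).2 (Or.inl rfl)) ((memY _).2 (Or.inr rfl)))
  have h10 := (memZ _).1 (hmul x₁ y₀ ((memX _).2 (Or.inr rfl)) ((memY _).2 (Or.inl rfl)))
  have h11 := (memZ _).1 (hmul x₁ y₁ ((memX _).2 (Or.inr rfl)) ((memY _).2 (Or.inr rfl)))
  have n0 : op x₀ y₀ ≠ op x₀ y₁ := fun h => hy (left_inj x₀ h)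
  have n1 : op x₁ y₀ ≠ op x₁ y₁ := fun h => hy (left_inj x₁ h)
  have n2 : op x₀ y₀ ≠ op x₁ y₀ := fun h => hx (right_inj y₀ h)
  have n3 : op x₀ y₁ ≠ op x₁ y₁ := fun h => hx (right_inj y₁ h)
  have e10 : op x₁ y₀ = op x₀ y₁ := by grind
  have e11 : op x₁ y₁ = op x₀ y₀ := by grind
  have memZ' : ∀ z, M.label 2 z ∈ B ↔ z = op x₀ y₀ ∨ z = op x₀ y₁ := by
    intro z
    rw [memZ]
    grind
  have : Finite Q := Nat.finite_of_card_ne_zero (by rw [hQ]; decide)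
  obtain ⟨e₁, he0, he1⟩ : ∃ e₁ : Fin 6 ≃ Q, e₁ 0 = y₀ ∧ e₁ 1 = y₁ := by
    obtain ⟨f⟩ : Nonempty (Fin 6 ≃ Q) := ⟨(Finite.equivFinOfCardEq hQ).symm⟩
    let g := f.trans (Equiv.swap (f 0) y₀)
    have hg0 : g 0 = y₀ := by simp [g]
    refine ⟨g.trans (Equiv.swap (g 1) y₁), ?_, by simp⟩
    rw [Equiv.trans_apply, hg0, Equiv.swap_apply_of_ne_of_ne _ hy]
    exact fun h => absurd (g.injective (hg0.trans h)) (by decide)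
  let e₂ : Fin 6 ≃ Q := e₁.trans (Equiv.ofBijective _
    (Finite.injective_iff_bijective.1 (left_inj x₀)))
  let e₀ : Fin 6 ≃ Q := e₂.trans (Equiv.ofBijective _
    (Finite.injective_iff_bijective.1 (right_inj y₀))).symm
  have h2 : ∀ z, e₂ z = op x₀ (e₁ z) := fun z => rfl
  have h0 : ∀ x, op (e₀ x) y₀ = e₂ x := fun x =>
    (Equiv.ofBijective _ (Finite.injective_iff_bijective.1 (right_inj y₀))).apply_symm_apply (e₂ x)
  have e00 : e₀ 0 = x₀ := right_inj y₀ ((h0 0).trans (by rw [h2, he0]))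
  have e01 : e₀ 1 = x₁ := right_inj y₀ ((h0 1).trans (by rw [h2, he1]; exact e10.symm))
  have e20 : e₂ 0 = op x₀ y₀ := by rw [h2, he0]
  have e21 : e₂ 1 = op x₀ y₁ := by rw [h2, he1]
  have hpair : ∀ (e : Fin 6 ≃ Q) (x : Fin 6), x < 2 ↔ e x = e 0 ∨ e x = e 1 := by
    intro e x
    rw [fin_lt_two_iff, e.injective.eq_iff, e.injective.eq_iff]
  refine ⟨fun x y => e₂.symm (op (e₀ x) (e₁ y)), ⟨?_, ?_, ?_, ?_, ?_⟩,
    M.nonempty_incidenceIso hB hB1 ![e₀, e₁, e₂] ?_ ?_⟩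
  · intro y
    rw [Equiv.symm_apply_eq, e00, h2]
  · intro x
    rw [Equiv.symm_apply_eq, he0, h0]
  · rw [Equiv.symm_apply_eq, e01, he1, e11, e20]
  · intro x y y' h
    exact e₁.injective (left_inj _ (e₂.symm.injective h))
  · intro y x x' h
    exact e₀.injective (right_inj _ (e₂.symm.injective h))
  · intro i x
    fin_cases i
    · exact (memX _).trans (by rw [hpair e₀, e00, e01]; rfl)
    · exact (memY _).trans (by rw [hpair e₁, he0, he1]; rfl)
    · exact (memZ' _).trans (by rw [hpair e₂, e20, e21]; rfl)
  · intro x y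
    exact e₂.apply_symm_apply _

end LightDualMultinet

section Classification

/-- The function on `Fin n` whose values are the decimal digits of `c`. -/
def digits (n : ℕ) [NeZero n] (c : ℕ) (i : Fin n) : Fin n := Fin.ofNat n (c / 10 ^ i.val % 10)

/-- A cell `(x, y, z)` of a multiplication table: the value at `(x, y)` is `z`. -/
abbrev Cell := Fin 6 × Fin 6 × Fin 6

/-- The bits of a cell in the mask of the values which occur in the rows and in the columns. -/
def cellMask (x y z : Fin 6) : ℕ := Nat.lor (2 ^ (6 * x.val + z.val)) (2 ^ (36 + 6 * y.val + z.val))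

/-- All ways to fill in the listed positions without a repetition in a row or a column. -/
def fillCells : List (Fin 6 × Fin 6) → ℕ → List Cell → List (List Cell)
  | [], _, l => [l]
  | (x, y) :: c, m, l => ([0, 1, 2, 3, 4, 5] : List (Fin 6)).flatMap fun z =>
      match Nat.land m (cellMask x y z) with
      | 0 => fillCells c (Nat.lor m (cellMask x y z)) ((x, y, z) :: l)
      | _ + 1 => []

theorem testBit_cellMask {x y z : Fin 6} {k : ℕ} :
    (cellMask x y z).testBit k = true ↔ k = 6 * x.val + z.val ∨ k = 36 + 6 * y.val + z.val := by
  change (2 ^ _ ||| 2 ^ _).testBit k = true ↔ _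
  rw [Nat.testBit_or, Bool.or_eq_true, Nat.testBit_two_pow, Nat.testBit_two_pow,
    decide_eq_true_eq, decide_eq_true_eq, eq_comm, eq_comm (b := k)]

theorem exists_mem_fillCells {op : Fin 6 → Fin 6 → Fin 6} (hl : ∀ x, Function.Injective (op x))
    (hr : ∀ y, Function.Injective fun x => op x y) (c : List (Fin 6 × Fin 6)) (m : ℕ)
    (l : List Cell) (hc : c.Nodup) (hlc : ∀ t ∈ l, (t.1, t.2.1) ∉ c)
    (hop : ∀ t ∈ l, op t.1 t.2.1 = t.2.2)
    (hm : ∀ k, m.testBit k = true → ∃ t ∈ l, (cellMask t.1 t.2.1 t.2.2).testBit k = true) :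
    ∃ r ∈ fillCells c m l, l ⊆ r ∧ ∀ p ∈ c, (p.1, p.2, op p.1 p.2) ∈ r := by
  induction c generalizing m l with
  | nil => exact ⟨l, by simp [fillCells], fun _ h => h, by simp⟩
  | cons p c ih =>
    obtain ⟨x, y⟩ := p
    rw [List.nodup_cons] at hc
    have hland : Nat.land m (cellMask x y (op x y)) = 0 := by
      change m &&& cellMask x y (op x y) = 0
      apply Nat.eq_of_testBit_eq
      intro k
      rw [Nat.zero_testBit, Nat.testBit_and, Bool.and_eq_false_iff]
      by_contra! h
      simp only [ne_eq, Bool.not_eq_false] at h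
      obtain ⟨h1, h2⟩ := h
      obtain ⟨t, ht, h3⟩ := hm k h1
      have hxy : (t.1, t.2.1) ≠ (x, y) := fun e => hlc t ht (by rw [e]; exact List.mem_cons_self)
      rw [testBit_cellMask] at h2 h3
      have ht' := hop t ht
      rcases h2 with h2 | h2 <;> rcases h3 with h3 | h3
      · have h4 : t.1 = x ∧ t.2.2 = op x y := by omega
        obtain ⟨rfl, h5⟩ := h4
        exact hxy (by rw [hl _ (ht'.trans h5)])
      · omega
      · omega
      · have h4 : t.2.1 = y ∧ t.2.2 = op x y := by omega
        obtain ⟨rfl, h5⟩ := h4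
        exact hxy (by rw [hr _ (ht'.trans h5)])
    obtain ⟨r, hr1, hr2, hr3⟩ := ih (Nat.lor m (cellMask x y (op x y))) ((x, y, op x y) :: l) hc.2
      (by
        intro t ht
        rw [List.mem_cons] at ht
        rcases ht with rfl | ht
        · exact hc.1
        · exact fun h => hlc t ht (List.mem_cons_of_mem _ h))
      (by
        intro t ht
        rw [List.mem_cons] at ht
        rcases ht with rfl | ht
        · rfl
        · exact hop t ht)
      (by
        intro k hk
        change (m ||| _).testBit k = true at hk
        rw [Nat.testBit_or, Bool.or_eq_true] at hk
        rcases hk with hk | hk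
        · obtain ⟨t, ht, h⟩ := hm k hk
          exact ⟨t, List.mem_cons_of_mem _ ht, h⟩
        · exact ⟨_, List.mem_cons_self, hk⟩)
    refine ⟨r, ?_, fun t ht => hr2 (List.mem_cons_of_mem _ ht), ?_⟩
    · rw [fillCells, List.mem_flatMap]
      have hz : ∀ z : Fin 6, z ∈ ([0, 1, 2, 3, 4, 5] : List (Fin 6)) := by decide
      exact ⟨op x y, hz _, by rw [hland]; exact hr1⟩
    · intro p hp
      rw [List.mem_cons] at hp
      rcases hp with rfl | hp
      · exact hr2 List.mem_cons_self
      · exact hr3 p hp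

/-- The positions outside the rows of `0` and `1` and the column of `0`. -/
def innerPositions : List (Fin 6 × Fin 6) :=
  [(2, 1), (2, 2), (2, 3), (2, 4), (2, 5), (3, 1), (3, 2), (3, 3), (3, 4), (3, 5),
    (4, 1), (4, 2), (4, 3), (4, 4), (4, 5), (5, 1), (5, 2), (5, 3), (5, 4), (5, 5)]

/-- The cells of the rows of `0` and `1` and of the column of `0` of a loop with row `r` of `1`. -/
def outerCells (r : Fin 6 → Fin 6) : List Cell :=
  [(0, 0, 0), (0, 1, 1), (0, 2, 2), (0, 3, 3), (0, 4, 4), (0, 5, 5),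
    (1, 0, r 0), (1, 1, r 1), (1, 2, r 2), (1, 3, r 3), (1, 4, r 4), (1, 5, r 5),
    (2, 0, 2), (3, 0, 3), (4, 0, 4), (5, 0, 5)]

/-- The mask of a list of cells. -/
def cellsMask (l : List Cell) : ℕ := l.foldl (fun m t => Nat.lor m (cellMask t.1 t.2.1 t.2.2)) 0

theorem exists_of_testBit_cellsMask {l : List Cell} {k : ℕ} (h : (cellsMask l).testBit k = true) :
    ∃ t ∈ l, (cellMask t.1 t.2.1 t.2.2).testBit k = true := by
  have key : ∀ (l : List Cell) (m : ℕ),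
      (l.foldl (fun m t => Nat.lor m (cellMask t.1 t.2.1 t.2.2)) m).testBit k = true →
        m.testBit k = true ∨ ∃ t ∈ l, (cellMask t.1 t.2.1 t.2.2).testBit k = true := by
    intro l
    induction l with
    | nil => exact fun m h => Or.inl h
    | cons t l ih =>
      intro m h
      rcases ih _ h with h | ⟨s, hs, h⟩
      · change (m ||| _).testBit k = true at h
        rw [Nat.testBit_or, Bool.or_eq_true] at h
        rcases h with h | h
        · exact Or.inl h
        · exact Or.inr ⟨t, List.mem_cons_self, h⟩
      · exact Or.inr ⟨s, List.mem_cons_of_mem _ hs, h⟩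
  simpa using key l 0 h

theorem IsLoopWithSubloop.exists_mem_fillCells {op : Fin 6 → Fin 6 → Fin 6}
    (h : IsLoopWithSubloop op) :
    ∃ r ∈ fillCells innerPositions (cellsMask (outerCells (op 1))) (outerCells (op 1)),
      ∀ x y, (x, y, op x y) ∈ r := by
  have houter : ∀ t ∈ outerCells (op 1), op t.1 t.2.1 = t.2.2 := by
    simp [outerCells, h.zero_op, h.op_zero]
  have hout : ∀ t ∈ outerCells (op 1), (t.1, t.2.1) ∉ innerPositions := by
    simp [outerCells, innerPositions]
  obtain ⟨r, hr, h1, h2⟩ := _root_.exists_mem_fillCells h.left_injective h.right_injective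
    innerPositions _ _ (by decide) hout houter fun k hk => exists_of_testBit_cellsMask hk
  refine ⟨r, hr, fun x y => ?_⟩
  by_cases hxy : (x, y) ∈ innerPositions
  · exact h2 _ hxy
  · apply h1
    have key : ∀ x y : Fin 6, (x, y) ∉ innerPositions → x = 0 ∨ x = 1 ∨ y = 0 ∧ 2 ≤ x := by decide
    rcases key x y hxy with rfl | rfl | ⟨rfl, hx⟩
    · rw [h.zero_op]
      fin_cases y <;> simp [outerCells]
    · fin_cases y <;> simp [outerCells]
    · rw [h.op_zero]
      fin_cases x
      · exact absurd hx (by decide)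
      · exact absurd hx (by decide)
      all_goals simp [outerCells]

/-- Representatives of the multinets of order 6 with a unique superline of length 2. -/
def representative : Fin 14 → Fin 6 → Fin 6 → Fin 6 :=
  ![multinetRow3.op, multinetRow4.op, multinetRow8.op, multinetRow9.op, multinetRow10.op,
    multinetRow11.op, multinetRow13.op, multinetRow14.op, multinetRow15.op, multinetRow16.op,
    nonembeddableLoop1, nonembeddableLoop2, nonembeddableLoop3, nonembeddableLoop4]

/-- The code describes a paratopism from the multiplication table `l` to a representative, up to
the contents of the subsquare. -/
def isParatopism (l : List Cell) (h : Fin 14 × ℕ × ℕ × ℕ × ℕ) : Bool :=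
  (decide (Function.Injective (digits 3 h.2.1)) &&
    [h.2.2.1, h.2.2.2.1, h.2.2.2.2].all fun c =>
      decide (Function.Injective (digits 6 c)) && decide (∀ x, digits 6 c x < 2 ↔ x < 2)) &&
  l.all fun t => decide (t.1 < 2 ∧ t.2.1 < 2) ||
    decide (representative h.1 (digits 6 h.2.2.1 (![t.1, t.2.1, t.2.2] (digits 3 h.2.1 0)))
      (digits 6 h.2.2.2.1 (![t.1, t.2.1, t.2.2] (digits 3 h.2.1 1))) =
        digits 6 h.2.2.2.2 (![t.1, t.2.1, t.2.2] (digits 3 h.2.1 2)))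

theorem IsLoopWithSubloop.nonempty_incidenceIso_of_isParatopism {op : Fin 6 → Fin 6 → Fin 6}
    (hop : IsLoopWithSubloop op) {l : List Cell} (hl : ∀ x y, (x, y, op x y) ∈ l)
    {h : Fin 14 × ℕ × ℕ × ℕ × ℕ} (hh : isParatopism l h = true) :
    Nonempty (IncidenceIso (superlineBlocks op fun _ => {0, 1})
      (superlineBlocks (representative h.1) fun _ => {0, 1})) := by
  obtain ⟨k, s, a, b, c⟩ := h
  simp only [isParatopism, Bool.and_eq_true, decide_eq_true_eq, List.all_eq_true, List.mem_cons,
    List.not_mem_nil, or_false, forall_eq_or_imp, forall_eq, Bool.or_eq_true] at hh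
  obtain ⟨⟨hs, ⟨ha, ha'⟩, ⟨hb, hb'⟩, hc, hc'⟩, hcell⟩ := hh
  have bij {n : ℕ} {f : Fin n → Fin n} (hf : Function.Injective f) :=
    Finite.injective_iff_bijective.1 hf
  refine hop.nonempty_incidenceIso (Equiv.ofBijective _ (bij hs))
    ![Equiv.ofBijective _ (bij ha), Equiv.ofBijective _ (bij hb), Equiv.ofBijective _ (bij hc)]
    ?_ ?_
  · intro i
    fin_cases i
    · exact ha'
    · exact hb'
    · exact hc'
  · intro x y hxy
    exact (hcell _ (hl x y)).resolve_left hxy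

/-- Every list is matched with a code of a paratopism. -/
def allParatopisms : List (List Cell) → List (Fin 14 × ℕ × ℕ × ℕ × ℕ) → Bool
  | [], _ => true
  | _ :: _, [] => false
  | l :: L, h :: H => isParatopism l h && allParatopisms L H

theorem exists_isParatopism {L : List (List Cell)} {H : List (Fin 14 × ℕ × ℕ × ℕ × ℕ)}
    (h : allParatopisms L H = true) {l : List Cell} (hl : l ∈ L) : ∃ c, isParatopism l c = true := by
  induction L generalizing H with
  | nil => simp at hl
  | cons l' L ih =>
    cases H with
    | nil => simp [allParatopisms] at h
    | cons c H =>
      rw [allParatopisms, Bool.and_eq_true] at h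
      rw [List.mem_cons] at hl
      rcases hl with rfl | hl
      · exact ⟨c, h.1⟩
      · exact ih h.2 hl

/-- Codes of paratopisms from the loops with the row `103254` to the representatives. -/
def paratopismCodes1 : List (Fin 14 × ℕ × ℕ × ℕ × ℕ) :=
  [(0, 210, 532410, 532410, 532410), (0, 210, 534210, 534210, 534201),
    (10, 210, 543210, 543210, 543210), (10, 210, 542310, 542310, 542301),
    (5, 21, 342501, 524310, 352401), (11, 210, 543210, 543210, 543210),
    (5, 21, 345201, 254310, 532410), (11, 210, 253410, 324501, 324501),
    (10, 210, 543210, 543210, 543201), (10, 210, 542310, 542310, 542310),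
    (0, 210, 532410, 532410, 532401), (0, 210, 534210, 534210, 534210),
    (11, 210, 543210, 543210, 543201), (5, 21, 342501, 524301, 352401),
    (11, 210, 253410, 324501, 324510), (5, 21, 345201, 254301, 532410),
    (0, 210, 352410, 352410, 352401), (0, 210, 354210, 354210, 354210),
    (10, 210, 453210, 453210, 453201), (10, 210, 452310, 452310, 452310),
    (11, 210, 523410, 234501, 234510), (5, 21, 435201, 524301, 352410),
    (11, 210, 453210, 453210, 453201), (5, 21, 432501, 254301, 532401),
    (10, 210, 453210, 453210, 453210), (10, 210, 452310, 452310, 452301),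
    (0, 210, 352410, 352410, 352410), (0, 210, 354210, 354210, 354201),
    (5, 21, 435201, 524310, 352410), (11, 210, 523410, 234501, 234501),
    (5, 21, 432501, 254310, 532401), (11, 210, 453210, 453210, 453210),
    (5, 21, 345201, 523410, 354201), (1, 210, 354210, 354210, 354210),
    (12, 210, 543210, 543210, 543210), (7, 201, 453201, 234510, 453201),
    (7, 201, 324510, 324510, 324510), (7, 102, 324510, 243510, 324510),
    (8, 210, 452310, 235401, 235410), (3, 21, 543210, 453210, 453210),
    (2, 21, 543210, 543210, 543210), (7, 102, 453201, 243510, 453201),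
    (8, 210, 542310, 542310, 542301), (12, 120, 435210, 543210, 543210),
    (11, 210, 542310, 542310, 542301), (7, 102, 235401, 534210, 235401),
    (8, 210, 543201, 235401, 324501), (12, 21, 453210, 534210, 534210),
    (3, 120, 534210, 435210, 435210), (7, 201, 452310, 452310, 452301),
    (7, 201, 325401, 453210, 325401), (13, 210, 543210, 543210, 543210),
    (4, 21, 453210, 543210, 543210), (3, 210, 345210, 345210, 345210),
    (7, 102, 542310, 425310, 542301), (8, 210, 453210, 453210, 453210),
    (5, 21, 345201, 523401, 354201), (12, 210, 543210, 543210, 543201),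
    (1, 210, 354210, 354210, 354201), (7, 201, 324510, 324510, 324501),
    (7, 201, 453201, 234510, 453210), (7, 102, 324501, 243510, 324510),
    (8, 210, 452310, 235401, 235401), (7, 102, 453210, 243510, 453201),
    (8, 210, 542310, 542310, 542310), (12, 120, 435210, 543201, 543210),
    (3, 21, 543210, 453201, 453210), (2, 21, 543210, 543201, 543210),
    (11, 210, 542310, 542310, 542310), (7, 102, 235410, 534210, 235401),
    (8, 210, 543201, 235401, 324510), (3, 120, 534210, 435201, 435210),
    (12, 21, 453210, 534201, 534210), (7, 201, 325401, 453210, 325410),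
    (7, 201, 452310, 452310, 452310), (3, 210, 345210, 345210, 345201),
    (7, 102, 542301, 425310, 542301), (8, 210, 453210, 453210, 453201),
    (13, 210, 543210, 543210, 543201), (4, 21, 453210, 543201, 543210),
    (11, 210, 524310, 235401, 235410), (13, 210, 543210, 325401, 325401),
    (4, 21, 324501, 325401, 453210), (7, 102, 542310, 534210, 542310),
    (8, 210, 453201, 542310, 453210), (3, 210, 345210, 523401, 523401),
    (12, 21, 324501, 425301, 534210), (3, 120, 534210, 524301, 524301),
    (7, 201, 543210, 543210, 543210), (7, 201, 234501, 542310, 234510),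
    (7, 102, 235401, 425310, 235410), (8, 210, 543210, 324501, 324501),
    (5, 21, 432501, 523410, 354210), (3, 21, 325410, 324510, 324510),
    (2, 21, 452310, 543210, 543201), (12, 120, 524310, 325401, 325410),
    (7, 102, 453201, 352410, 453210), (8, 210, 542301, 453210, 542301),
    (7, 102, 324510, 352410, 324501), (8, 210, 452301, 324501, 235410),
    (1, 210, 532410, 532410, 532401), (12, 210, 452310, 452310, 452301),
    (7, 201, 542301, 325410, 542310), (7, 201, 235410, 235410, 235401),
    (11, 210, 524310, 235401, 235401), (7, 102, 542301, 534210, 542310),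
    (8, 210, 453201, 542310, 453201), (3, 210, 345210, 523401, 523410),
    (13, 210, 543210, 325401, 325410), (4, 21, 324501, 325410, 453210),
    (3, 120, 534210, 524310, 524301), (12, 21, 324501, 425310, 534210),
    (7, 201, 234501, 542310, 234501), (7, 201, 543210, 543210, 543201),
    (7, 102, 235410, 425310, 235410), (8, 210, 543210, 324501, 324510),
    (5, 21, 432501, 523401, 354210), (12, 120, 524310, 325410, 325410),
    (7, 102, 453210, 352410, 453210), (8, 210, 542301, 453210, 542310),
    (3, 21, 325410, 324501, 324510), (2, 21, 452310, 543201, 543201),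
    (7, 102, 324501, 352410, 324501), (8, 210, 452301, 324501, 235401),
    (12, 210, 452310, 452310, 452310), (1, 210, 532410, 532410, 532410),
    (7, 201, 235410, 235410, 235410), (7, 201, 542301, 325410, 542301),
    (11, 210, 452310, 452310, 452301), (7, 201, 235401, 543210, 235401),
    (7, 201, 542310, 542310, 542301), (3, 120, 354210, 345210, 345210),
    (12, 21, 543210, 354210, 354210), (8, 210, 453201, 325401, 234501),
    (7, 102, 325401, 354210, 325401), (4, 21, 543210, 453210, 453210),
    (13, 210, 453210, 453210, 453210), (8, 210, 543210, 543210, 543210),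
    (7, 102, 452310, 245310, 452301), (3, 210, 435210, 435210, 435210),
    (5, 21, 435201, 253410, 534201), (8, 210, 542310, 325401, 325410),
    (7, 102, 234510, 423510, 234510), (7, 201, 234510, 234510, 234510),
    (7, 201, 543201, 324510, 543201), (12, 210, 453210, 453210, 453210),
    (1, 210, 534210, 534210, 534210), (2, 21, 235401, 235401, 543210),
    (3, 21, 453210, 543210, 543210), (12, 120, 345210, 453210, 453210),
    (8, 210, 452310, 452310, 452301), (7, 102, 543201, 423510, 543201),
    (11, 210, 452310, 452310, 452310), (7, 201, 542310, 542310, 542310),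
    (7, 201, 235401, 543210, 235410), (12, 21, 543210, 354201, 354210),
    (3, 120, 354210, 345201, 345210), (8, 210, 453201, 325401, 234510),
    (7, 102, 325410, 354210, 325401), (8, 210, 543210, 543210, 543201),
    (7, 102, 452301, 245310, 452301), (3, 210, 435210, 435210, 435201),
    (4, 21, 543210, 453201, 453210), (13, 210, 453210, 453210, 453201),
    (5, 21, 435201, 253401, 534201), (8, 210, 542310, 325401, 325401),
    (7, 102, 234501, 423510, 234510), (7, 201, 543201, 324510, 543210),
    (7, 201, 234510, 234510, 234501), (1, 210, 534210, 534210, 534201),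
    (12, 210, 453210, 453210, 453201), (12, 120, 345210, 453201, 453210),
    (8, 210, 452310, 452310, 452310), (7, 102, 543210, 423510, 543201),
    (2, 21, 235401, 235410, 543210), (3, 21, 453210, 543201, 543210),
    (5, 21, 342501, 253410, 534210), (2, 21, 324501, 235401, 543201),
    (3, 21, 324510, 325410, 325410), (8, 210, 452301, 543210, 452301),
    (7, 102, 543201, 532410, 543210), (12, 120, 523410, 324510, 324510),
    (7, 201, 325410, 325410, 325401), (7, 201, 452301, 235410, 452310),
    (12, 210, 542310, 542310, 542301), (1, 210, 352410, 352410, 352401),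
    (8, 210, 542301, 234501, 325410), (7, 102, 234510, 532410, 234501),
    (11, 210, 254310, 325401, 325410), (4, 21, 234501, 235401, 543210),
    (13, 210, 453210, 235401, 235401), (3, 210, 435210, 253401, 253401),
    (8, 210, 543201, 452310, 543210), (7, 102, 452310, 354210, 452310),
    (8, 210, 453210, 234501, 234501), (7, 102, 325401, 245310, 325410),
    (7, 201, 324501, 452310, 324510), (7, 201, 453210, 453210, 453210),
    (3, 120, 354210, 254301, 254301), (12, 21, 234501, 245301, 354210),
    (5, 21, 342501, 253401, 534210), (8, 210, 452301, 543210, 452310),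
    (7, 102, 543210, 532410, 543210), (12, 120, 523410, 324501, 324510),
    (2, 21, 324501, 235410, 543201), (3, 21, 324510, 325401, 325410),
    (7, 201, 452301, 235410, 452301), (7, 201, 325410, 325410, 325410),
    (1, 210, 352410, 352410, 352410), (12, 210, 542310, 542310, 542310),
    (8, 210, 542301, 234501, 325401), (7, 102, 234501, 532410, 234501),
    (11, 210, 254310, 325401, 325401), (3, 210, 435210, 253401, 253410),
    (8, 210, 543201, 452310, 543201), (7, 102, 452301, 354210, 452310),
    (4, 21, 234501, 235410, 543210), (13, 210, 453210, 235401, 235410),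
    (8, 210, 453210, 234501, 234510), (7, 102, 325410, 245310, 325410),
    (7, 201, 453210, 453210, 453201), (7, 201, 324501, 452310, 324501),
    (12, 21, 234501, 245310, 354210), (3, 120, 354210, 254310, 254301)]

/-- Codes of paratopisms from the loops with the row `103452` to the representatives. -/
def paratopismCodes2 : List (Fin 14 × ℕ × ℕ × ℕ × ℕ) :=
  [(2, 210, 435210, 435210, 435210), (9, 210, 324510, 324510, 324510),
    (4, 210, 435210, 435210, 435210), (9, 210, 532410, 532410, 532410),
    (6, 210, 254310, 254310, 254301), (8, 102, 425310, 245310, 425301),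
    (8, 102, 534210, 345210, 534210), (6, 210, 245301, 452301, 523401),
    (4, 210, 435210, 435210, 435201), (2, 210, 435210, 435210, 435201),
    (9, 210, 324510, 324510, 324501), (9, 210, 532410, 532410, 532401),
    (8, 102, 534201, 345210, 534210), (6, 210, 254310, 254310, 254310),
    (8, 102, 425301, 245310, 425301), (6, 210, 245301, 452301, 523410),
    (5, 120, 435210, 253401, 253401), (11, 201, 543210, 543210, 543201),
    (9, 210, 245310, 245310, 245301), (5, 210, 435210, 435210, 435210),
    (11, 102, 234501, 453210, 234510), (9, 120, 254310, 354201, 354210),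
    (9, 21, 425301, 352410, 543201), (6, 210, 345201, 234510, 345210),
    (11, 201, 543210, 543210, 543210), (5, 120, 435210, 253410, 253401),
    (9, 210, 245310, 245310, 245310), (11, 102, 234510, 453210, 234510),
    (5, 210, 435210, 435210, 435201), (6, 210, 345201, 234510, 345201),
    (9, 120, 254310, 354210, 354210), (9, 21, 425301, 352401, 543201),
    (11, 201, 543201, 452310, 543201), (5, 120, 342510, 253401, 253410),
    (9, 210, 453210, 453210, 453210), (5, 210, 352410, 352410, 352401),
    (11, 102, 345201, 532410, 345210), (6, 210, 354210, 432501, 432501),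
    (9, 21, 524310, 534201, 534210), (9, 120, 354210, 423501, 423501),
    (5, 120, 342510, 253410, 253410), (11, 201, 543201, 452310, 543210),
    (11, 102, 345210, 532410, 345210), (9, 210, 453210, 453210, 453201),
    (5, 210, 352410, 352410, 352410), (9, 21, 524310, 534210, 534210),
    (6, 210, 354210, 432501, 432510), (9, 120, 354210, 423510, 423501),
    (9, 21, 524301, 534210, 452310), (8, 201, 243510, 243510, 243501),
    (6, 210, 325410, 325410, 325401), (7, 210, 435201, 243510, 435201),
    (7, 210, 342510, 342510, 342510), (8, 102, 342510, 324510, 342501),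
    (8, 102, 253401, 234510, 253410), (7, 210, 352401, 435210, 352401),
    (7, 210, 425310, 425310, 425301), (9, 21, 243501, 342501, 523410),
    (8, 201, 352401, 243510, 352410), (6, 210, 235410, 543201, 543210),
    (6, 210, 432510, 432510, 432501), (9, 120, 432510, 423510, 423510),
    (2, 120, 534210, 534210, 534210), (9, 120, 325410, 235410, 235410),
    (8, 201, 524310, 524310, 524301), (6, 210, 234501, 523410, 234510),
    (8, 201, 435210, 435210, 435210), (4, 120, 435210, 534210, 534210),
    (9, 21, 524301, 534201, 452310), (8, 201, 243510, 243510, 243510),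
    (6, 210, 325410, 325410, 325410), (7, 210, 342510, 342510, 342501),
    (7, 210, 435201, 243510, 435210), (8, 102, 253410, 234510, 253410),
    (8, 102, 342501, 324510, 342501), (7, 210, 425310, 425310, 425310),
    (9, 21, 243501, 342510, 523410), (7, 210, 352401, 435210, 352410),
    (8, 201, 352401, 243510, 352401), (6, 210, 235410, 543201, 543201),
    (9, 120, 432510, 423501, 423510), (6, 210, 432510, 432510, 432510),
    (2, 120, 534210, 534201, 534210), (9, 120, 325410, 235401, 235410),
    (8, 201, 524310, 524310, 524310), (6, 210, 234501, 523410, 234501),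
    (8, 201, 435210, 435210, 435201), (4, 120, 435210, 534201, 534210),
    (6, 210, 423510, 254301, 254310), (9, 120, 423510, 354201, 354201),
    (4, 120, 435210, 425301, 425301), (8, 201, 435201, 524310, 435210),
    (6, 210, 324501, 345201, 452301), (8, 201, 524301, 435210, 524301),
    (2, 120, 534210, 425301, 425301), (9, 120, 235410, 542301, 542301),
    (8, 102, 534210, 532410, 534201), (6, 210, 523401, 452310, 523410),
    (8, 102, 425301, 523410, 425310), (9, 21, 425310, 352401, 352401),
    (6, 210, 532401, 234501, 345201), (8, 201, 352410, 352410, 352401),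
    (7, 210, 243501, 524310, 243501), (9, 21, 253410, 524310, 524301),
    (7, 210, 534210, 534210, 534210), (7, 210, 524301, 352410, 524310),
    (7, 210, 253410, 253410, 253410), (8, 201, 243501, 352410, 243510),
    (6, 210, 423510, 254301, 254301), (9, 120, 423510, 354210, 354201),
    (8, 201, 435201, 524310, 435201), (6, 210, 324501, 345201, 452310),
    (4, 120, 435210, 425310, 425301), (8, 201, 524301, 435210, 524310),
    (2, 120, 534210, 425310, 425301), (9, 120, 235410, 542310, 542301),
    (6, 210, 523401, 452310, 523401), (8, 102, 425310, 523410, 425310),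
    (8, 102, 534201, 532410, 534201), (6, 210, 532401, 234501, 345210),
    (9, 21, 425310, 352410, 352401), (7, 210, 534210, 534210, 534201),
    (8, 201, 352410, 352410, 352410), (7, 210, 243501, 524310, 243510),
    (9, 21, 253410, 524301, 524301), (7, 210, 253410, 253410, 253401),
    (7, 210, 524301, 352410, 524301), (8, 201, 243501, 352410, 243501),
    (11, 102, 234501, 532410, 234501), (9, 210, 453210, 245301, 245310),
    (5, 210, 352410, 435201, 435201), (9, 120, 543210, 542301, 542310),
    (5, 120, 352410, 534201, 534201), (6, 210, 543210, 543210, 543201),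
    (11, 201, 432501, 523410, 432501), (9, 21, 352401, 253401, 345210),
    (9, 210, 453210, 245301, 245301), (5, 210, 352410, 435201, 435210),
    (11, 102, 234510, 532410, 234501), (9, 120, 543210, 542310, 542310),
    (5, 120, 352410, 534210, 534201), (6, 210, 543210, 543210, 543210),
    (9, 21, 352401, 253410, 345210), (11, 201, 432501, 523410, 432510),
    (9, 210, 245310, 324501, 324501), (11, 102, 523401, 453210, 523401),
    (5, 210, 435210, 243501, 243510), (9, 21, 342510, 435210, 435201),
    (11, 201, 254301, 345210, 254301), (6, 210, 453201, 523401, 234510),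
    (9, 120, 542310, 235401, 235401), (5, 120, 534210, 425301, 425310),
    (4, 210, 435210, 243501, 243501), (2, 210, 435210, 243501, 243501),
    (9, 210, 324510, 532401, 532401), (9, 210, 532410, 453201, 453201),
    (6, 210, 452301, 345210, 452310), (8, 102, 253401, 453210, 253401),
    (8, 102, 342501, 452310, 342510), (6, 210, 542310, 325401, 325410),
    (9, 210, 245310, 324501, 324510), (5, 210, 435210, 243501, 243501),
    (11, 102, 523410, 453210, 523401), (11, 201, 254301, 345210, 254310),
    (9, 21, 342510, 435201, 435201), (6, 210, 453201, 523401, 234501),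
    (9, 120, 542310, 235410, 235401), (5, 120, 534210, 425310, 425310),
    (2, 210, 435210, 243501, 243510), (9, 210, 324510, 532401, 532410),
    (4, 210, 435210, 243501, 243510), (9, 210, 532410, 453201, 453210),
    (6, 210, 452301, 345210, 452301), (8, 102, 342510, 452310, 342510),
    (8, 102, 253410, 453210, 253401), (6, 210, 542310, 325401, 325401)]

theorem allParatopisms_paratopismCodes1 :
    allParatopisms (fillCells innerPositions (cellsMask (outerCells ![1, 0, 3, 2, 5, 4]))
      (outerCells ![1, 0, 3, 2, 5, 4])) paratopismCodes1 = true := by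
  decide +kernel

theorem allParatopisms_paratopismCodes2 :
    allParatopisms (fillCells innerPositions (cellsMask (outerCells ![1, 0, 3, 4, 5, 2]))
      (outerCells ![1, 0, 3, 4, 5, 2])) paratopismCodes2 = true := by
  decide +kernel

/-- Permutations which conjugate the possible rows of `1` to normal forms. -/
def rowConjugators : List (Fin 6 → Fin 6) :=
  [![0, 1, 2, 3, 4, 5], ![0, 1, 2, 3, 5, 4], ![0, 1, 2, 4, 3, 5], ![0, 1, 2, 4, 5, 3],
    ![0, 1, 2, 5, 3, 4], ![0, 1, 2, 5, 4, 3]]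

theorem rowConjugators_spec : ∀ g ∈ rowConjugators,
    Function.Injective g ∧ g 0 = 0 ∧ g 1 = 1 ∧ ∀ x, g x < 2 ↔ x < 2 := by
  intro g hg
  simp only [rowConjugators, List.mem_cons, List.not_mem_nil, or_false] at hg
  rcases hg with rfl | rfl | rfl | rfl | rfl | rfl <;> decide

theorem exists_rowConjugator : ∀ a : Fin 6, a ≠ 0 → a ≠ 1 → a ≠ 2 →
    ∀ b : Fin 6, b ≠ 0 → b ≠ 1 → b ≠ 3 → b ≠ a →
    ∀ c : Fin 6, c ≠ 0 → c ≠ 1 → c ≠ 4 → c ≠ a → c ≠ b →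
    ∀ d : Fin 6, d ≠ 0 → d ≠ 1 → d ≠ 5 → d ≠ a → d ≠ b → d ≠ c →
    ∃ g ∈ rowConjugators, (∀ y, g (![1, 0, a, b, c, d] y) = ![1, 0, 3, 2, 5, 4] (g y)) ∨
      ∀ y, g (![1, 0, a, b, c, d] y) = ![1, 0, 3, 4, 5, 2] (g y) := by
  decide +kernel

/-- The row of `1` can be brought into one of two normal forms. -/
theorem IsLoopWithSubloop.exists_normal_row {op : Fin 6 → Fin 6 → Fin 6}
    (h : IsLoopWithSubloop op) : ∃ op', IsLoopWithSubloop op' ∧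
      (op' 1 = ![1, 0, 3, 2, 5, 4] ∨ op' 1 = ![1, 0, 3, 4, 5, 2]) ∧
      Nonempty (IncidenceIso (superlineBlocks op fun _ => {0, 1})
        (superlineBlocks op' fun _ => {0, 1})) := by
  have hrow : op 1 = ![1, 0, op 1 2, op 1 3, op 1 4, op 1 5] := by
    funext y
    fin_cases y
    · exact h.op_zero 1
    · exact h.one_op_one
    all_goals rfl
  have h0 : ∀ y, y ≠ 1 → op 1 y ≠ 0 := fun y hy e => hy (h.left_injective 1
    (e.trans h.one_op_one.symm))
  have h1 : ∀ y, y ≠ 0 → op 1 y ≠ 1 := fun y hy e => hy (h.left_injective 1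
    (e.trans (h.op_zero 1).symm))
  have h2 : ∀ y, op 1 y ≠ y := fun y e => absurd (h.right_injective y
    (e.trans (h.zero_op y).symm)) (by decide)
  have h3 : ∀ x y, x ≠ y → op 1 x ≠ op 1 y := fun x y hxy e => hxy (h.left_injective 1 e)
  obtain ⟨g, hg, hgr⟩ := exists_rowConjugator
    (op 1 2) (h0 _ (by decide)) (h1 _ (by decide)) (h2 _)
    (op 1 3) (h0 _ (by decide)) (h1 _ (by decide)) (h2 _) (h3 _ _ (by decide))
    (op 1 4) (h0 _ (by decide)) (h1 _ (by decide)) (h2 _) (h3 _ _ (by decide)) (h3 _ _ (by decide))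
    (op 1 5) (h0 _ (by decide)) (h1 _ (by decide)) (h2 _) (h3 _ _ (by decide)) (h3 _ _ (by decide))
    (h3 _ _ (by decide))
  obtain ⟨hgi, hg0, hg1, hg2⟩ := rowConjugators_spec g hg
  rw [← hrow] at hgr
  let e := Equiv.ofBijective g (Finite.injective_iff_bijective.1 hgi)
  have he : ∀ x, e x = g x := fun x => rfl
  have he0 : e.symm 0 = 0 := by rw [Equiv.symm_apply_eq, he, hg0]
  have he1 : e.symm 1 = 1 := by rw [Equiv.symm_apply_eq, he, hg1]
  refine ⟨fun x y => e (op (e.symm x) (e.symm y)), ⟨?_, ?_, ?_, ?_, ?_⟩, ?_, ?_⟩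
  · intro y
    rw [he0, h.zero_op, e.apply_symm_apply]
  · intro x
    rw [he0, h.op_zero, e.apply_symm_apply]
  · rw [he1, h.one_op_one, he, hg0]
  · intro x
    exact e.injective.comp ((h.left_injective _).comp e.symm.injective)
  · intro y
    exact e.injective.comp ((h.right_injective _).comp e.symm.injective)
  · refine hgr.imp (fun hgr => ?_) fun hgr => ?_ <;>
    · funext y
      change e (op (e.symm 1) (e.symm y)) = _
      rw [he1, he, hgr, ← he, e.apply_symm_apply]
  · refine h.nonempty_incidenceIso 1 (fun _ => e) (fun _ x => hg2 x) fun x y _ => ?_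
    simp

/-- The classification of the multinets of order 6 with a unique superline of length 2. -/
theorem IsLoopWithSubloop.exists_representative {op : Fin 6 → Fin 6 → Fin 6}
    (h : IsLoopWithSubloop op) : ∃ k, Nonempty (IncidenceIso (superlineBlocks op fun _ => {0, 1})
      (superlineBlocks (representative k) fun _ => {0, 1})) := by
  obtain ⟨op', hop', hrow, ⟨φ⟩⟩ := h.exists_normal_row
  obtain ⟨r, hr, hcell⟩ := hop'.exists_mem_fillCells
  obtain ⟨c, hc⟩ : ∃ c, isParatopism r c = true := by
    rcases hrow with hrow | hrow <;> rw [hrow] at hr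
    · exact exists_isParatopism allParatopisms_paratopismCodes1 hr
    · exact exists_isParatopism allParatopisms_paratopismCodes2 hr
  obtain ⟨ψ⟩ := hop'.nonempty_incidenceIso_of_isParatopism hcell hc
  exact ⟨c.1, ⟨φ.trans ψ⟩⟩

end Classification

theorem representative_eq (k : Fin 14) :
    (∃ N ∈ mergedBlockTable, representative k = N.op) ∨
      representative k = nonembeddableLoop1 ∨ representative k = nonembeddableLoop2 ∨
        representative k = nonembeddableLoop3 ∨ representative k = nonembeddableLoop4 := by
  fin_cases k
  · exact Or.inl ⟨multinetRow3, by simp [mergedBlockTable], rfl⟩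
  · exact Or.inl ⟨multinetRow4, by simp [mergedBlockTable], rfl⟩
  · exact Or.inl ⟨multinetRow8, by simp [mergedBlockTable], rfl⟩
  · exact Or.inl ⟨multinetRow9, by simp [mergedBlockTable], rfl⟩
  · exact Or.inl ⟨multinetRow10, by simp [mergedBlockTable], rfl⟩
  · exact Or.inl ⟨multinetRow11, by simp [mergedBlockTable], rfl⟩
  · exact Or.inl ⟨multinetRow13, by simp [mergedBlockTable], rfl⟩
  · exact Or.inl ⟨multinetRow14, by simp [mergedBlockTable], rfl⟩
  · exact Or.inl ⟨multinetRow15, by simp [mergedBlockTable], rfl⟩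
  · exact Or.inl ⟨multinetRow16, by simp [mergedBlockTable], rfl⟩
  · exact Or.inr (Or.inl rfl)
  · exact Or.inr (Or.inr (Or.inl rfl))
  · exact Or.inr (Or.inr (Or.inr (Or.inl rfl)))
  · exact Or.inr (Or.inr (Or.inr (Or.inr rfl)))

/-- A loop whose multinet has a weak embedding in characteristic 0 belongs to the table. -/
theorem exists_mem_mergedBlockTable {K L : Type*} [Field K] [Field L] [Algebra K L] [CharZero L]
    {β : Fin 3 × Fin 6 → Projectivization L (Fin 3 → L)} {k : Fin 14}
    (hβ : IsWeakEmbedding K (superlineBlocks (representative k) fun _ => {0, 1}) β) :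
    ∃ N ∈ mergedBlockTable, representative k = N.op := by
  rcases representative_eq k with h | h | h | h | h
  · exact h
  all_goals rw [h] at hβ
  · exact absurd hβ not_isWeakEmbedding_nonembeddableLoop1
  · exact absurd hβ not_isWeakEmbedding_nonembeddableLoop2
  · exact absurd hβ not_isWeakEmbedding_nonembeddableLoop3
  · exact absurd hβ not_isWeakEmbedding_nonembeddableLoop4

theorem mainTheorem5 {Q P : Type*} (op : Q → Q → Q) (hop : IsQuasigroup op)
    (hQ : Nat.card Q = 6) (M : LightDualMultinet op P) (hM : M.HasUniqueSuperline 2)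
    {L : Type*} [Field L] [Algebra ℚ L] (β : P → Projectivization L (Fin 3 → L))
    (hβ : IsWeakEmbedding ℚ M.blocks β) :
    ∃ N ∈ mergedBlockTable, Nonempty (IncidenceIso N.blocks M.blocks) ∧
      ∀ φ : IncidenceIso N.blocks M.blocks,
        (∀ S ∈ N.newLongLines, IsMergedBlock M.blocks β (φ.toEquiv '' tripleUnion S) ∧
          M.HasLength (φ.toEquiv '' tripleUnion S) 2) ∧
        ∀ i, ∀ T ∈ N.componentBlocks i, ∃ S, IsMergedBlock M.blocks β S ∧
          (∀ x ∈ T, φ.toEquiv (i, x) ∈ S) ∧ S ⊆ φ.toEquiv '' {p | p.1 = i} := by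
  have : CharZero L := algebraRat.charZero L
  have : Nonempty Q := (Nat.card_pos_iff.1 (by rw [hQ]; decide)).1
  obtain ⟨op', hop', ⟨ψ⟩⟩ := M.exists_isLoopWithSubloop hop hQ hM
  obtain ⟨k, ⟨χ⟩⟩ := hop'.exists_representative
  obtain ⟨N, hN, hk⟩ := exists_mem_mergedBlockTable (hβ.comp (χ.symm.trans ψ))
  refine ⟨N, hN, ?_, fun φ => ?_⟩
  · rw [hk] at χ
    exact ⟨χ.symm.trans ψ⟩
  · obtain ⟨hlong, hcomp⟩ := (hβ.comp φ).hasMergedBlocks hN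
    refine ⟨fun S hS => ⟨(hlong S hS).image, ?_⟩, fun i T hT => ?_⟩
    · exact M.hasLength_image_tripleUnion hop φ (card_of_mem_newLongLines hN hS)
    · obtain ⟨S, hS, hTS, hSi⟩ := hcomp i T hT
      exact ⟨_, hS.image, fun x hx => Set.mem_image_of_mem _ (hTS x hx), Set.image_mono hSi⟩
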